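/- Let $n\ge 2$, let $\Omega\subseteq J^n(\mathbb R,\mathbb R)$ be open, with coordinates $(x,y_0,\dots,y_n)$, and let $f\in C^\infty(\Omega)$ satisfy $\partial^2 f/\partial y_n^2\neq 0$ everywhere on $\Omega$. **Equation side.** Let $\mathcal E\subset J^{2n}$ be the Euler–Lagrange equation $\sum_{i=0}^n(-1)^i\frac{d^i}{dx^i}f_{y_i}=0$ of the Lagrangian $f\,dx$ (over $\Omega$), and let $\mathcal S$ be the line distribution on $\mathcal E$ cut out by the contact forms $dy_i-y_{i+1}dx$, $0\le i<2n$; its leaves are the prolonged solutions. Let $\mathrm{Sol}=\mathcal E/\mathrm{Fol}(\mathcal S)$ be the (local) manifold of solutions, with projection $\mathrm{pr}_1$, and let $V^1=\ker d\pi_{2n,2n-2}\cap T\mathcal E$. For a solution $\Gamma\subset\mathcal E$ (the prolongation of a solution on a nonempty open interval), $\mathrm{Lin}^1_\Gamma$ is the curve $\varepsilon\mapsto(\mathrm{pr}_1)_*V^1_\varepsilon$, $\varepsilon\in\Gamma$, in $\mathbb P(T_\Gamma\mathrm{Sol})$. **Distribution side.** On $M=\Omega\times\mathbb R$, with additional coordinate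 $z$, let $D$ be the rank 2 distribution spanned by $X_1=\partial_x+\sum_{i=0}^{n-1}y_{i+1}\partial_{y_i}+f\,\partial_z$ and $X_2=\partial_{y_n}$, and put $D^1=D$, $D^{i+1}=D^i+[D,D^i]$. Let $\mathfrak s$ be the Liouville form on $T^*M$, $\sigma=d\mathfrak s$, and let $(D^i)^\perp\subset T^*M$ be the annihilator of $D^i$. An abnormal extremal of $D$ is an absolutely continuous curve in $D^\perp$ minus the zero section whose velocity lies almost everywhere in $\ker(\sigma|_{D^\perp})$. On $\mathbb P(D^2)^\perp\setminus\mathbb P(D^3)^\perp$ let $\mathcal C$ be the image of the line distribution $\ker(\sigma|_{(D^2)^\perp})$, let $\Delta$ be the distribution induced by $\ker\mathfrak s$, let $\mathcal J^{(0)}$ be the image of $\{v\in T(D^2)^\perp:\pi_*v\in D\}$, where $\pi:T^*M\to M$, and let $\mathcal J^{(i)}=\mathcal J^{(i-1)}+[\mathcal C,\mathcal J^{(i-1)}]$ for $i\ge1$. Let $\mathcal J^{(-i)}\subset\Delta$ be the skew-orthogonal complement of $\mathcal J^{(i)}$ in $\Delta$ for the form induced by $\sigma$ (well defined up to a nonzero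 factor). Let $\mathrm{Abn}$ be the (local) quotient of $\mathbb P(D^2)^\perp\setminus\mathbb P(D^3)^\perp$ by $\mathrm{Fol}(\mathcal C)$, with projection $\mathrm{pr}_2$, and let $\bar\Delta$ be the distribution on $\mathrm{Abn}$ induced by $\Delta$. For an abnormal extremal $\Upsilon$ in $(D^2)^\perp\setminus(D^3)^\perp$, whose points are identified with their images in the projectivization, $J^{(1-n)}_\Upsilon$ is the curve $\lambda\mapsto(\mathrm{pr}_2)_*\mathcal J^{(1-n)}(\lambda)$, $\lambda\in\Upsilon$, in $\mathbb P(\bar\Delta(\Upsilon))$. **Legendre transform.** Write covectors as $\lambda_0\,dx+\sum_{i=0}^n\xi_i\,dy_i+\nu\,dz$ and let $\mathcal H=(D^2)^\perp\cap\{\nu=-1\}$. Let $\phi_Z$ be the projection of $\mathcal H$ onto its quotient by the translations $z\mapsto z+c$; this quotient has coordinates $(x,y_0,\dots,y_n,\xi_0,\dots,\xi_{n-2})$. In these coordinates define $\mathfrak L$ on $\mathcal E$ by $$\mathfrak L(x,y_0,\dots,y_{2n})=(x,y_0,\dots,y_n,\xi_0,\dots,\xi_{n-2}),\qquad \xi_{j-1}=\sum_{k=j}^n(-1)^{k-j}\frac{d^{k-j}}{dx^{k-j}}f_{y_k},\quad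 1\le j\le n-1.$$ **Statement.** Let $\Gamma$ be a solution of the Euler–Lagrange equation and let $\Upsilon\subset\mathcal H$ be an abnormal extremal of $D$ with $\phi_Z(\Upsilon)=\mathfrak L(\Gamma)$. Then $\mathrm{Lin}^1_\Gamma$ and $J^{(1-n)}_\Upsilon$ are indeed curves in projective spaces (their values are lines), and they coincide up to a projective transformation: there is a linear isomorphism $A:T_\Gamma\mathrm{Sol}\to\bar\Delta(\Upsilon)$ such that $A\bigl(\mathrm{Lin}^1_\Gamma(\varepsilon)\bigr)=J^{(1-n)}_\Upsilon(\lambda)$ for all $\varepsilon\in\Gamma$ and $\lambda\in\Upsilon$ with $\phi_Z(\lambda)=\mathfrak L(\varepsilon)$. In particular $A$ maps the first curve, as a set of lines, onto the second. -/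

import Mathlib

open Set Filter Topology MeasureTheory
open scoped ContDiff

noncomputable section

namespace VarLin

/-! ### Submanifolds, distributions and leaf spaces in a normed space -/

section General

variable {E : Type*} [NormedAddCommGroup E] [NormedSpace ℝ E]
variable {Q : Type*} [NormedAddCommGroup Q] [NormedSpace ℝ Q]

/-- Tangent space at `x` of a subset `S` of a vector space: the span of the velocities at `x` of
smooth curves in `S`. If `S` is an embedded submanifold near `x`, this is the usual `T_x S`. -/
def tangent (S : Set E) (x : E) : Submodule ℝ E :=
  Submodule.span ℝ {v | ∃ γ : ℝ → E, γ 0 = x ∧ ContDiffAt ℝ ∞ γ 0 ∧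
    (∀ᶠ t in 𝓝 (0 : ℝ), γ t ∈ S) ∧ deriv γ 0 = v}

/-- `[A, B]` for two distributions `A`, `B` tangent to a submanifold `N`: its value at `x ∈ N` is
spanned by the brackets at `x` of local smooth sections of `A` and `B`. Sections are given by
smooth extensions to the ambient space (the bracket at points of `N` of fields tangent to `N` does
not depend on the extensions). For `N` open this is the usual notion. -/
def bracketDist (N : Set E) (A B : E → Submodule ℝ E) (x : E) : Submodule ℝ E :=
  Submodule.span ℝ {w | ∃ (U : Set E) (X Y : E → E), IsOpen U ∧ x ∈ U ∧
    ContDiffOn ℝ ∞ X U ∧ ContDiffOn ℝ ∞ Y U ∧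
    (∀ y ∈ U ∩ N, X y ∈ A y ∧ Y y ∈ B y) ∧ w = VectorField.lieBracket ℝ X Y x}

/-- The derived flag on an open set `O`: `D^1 = D`, `D^(i+1) = D^i + [D, D^i]`. -/
def derivedFlag (O : Set E) (D : E → Submodule ℝ E) : ℕ → E → Submodule ℝ E
  | 0 => fun _ => ⊥
  | 1 => D
  | i + 2 => fun x => derivedFlag O D (i + 1) x ⊔ bracketDist O D (derivedFlag O D (i + 1)) x

/-- `pr : N ∩ U → Q` represents the projection of the open piece `N ∩ U` of the submanifold `N`
onto the leaf space `N / Fol(G)` of the integrable distribution `G`: it is a smooth submersion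
of `N ∩ U` onto an open piece of the vector space `Q` with `ker d(pr) = G`. So every leaf
`Γ ⊆ U` is contained in a fibre, `pr` induces a local diffeomorphism of the leaf space into `Q`,
and `T_Γ(N / Fol(G))` is identified with `Q`; the differential of the quotient projection is
`fderiv ℝ pr`. The quotient projection, read in any chart of the quotient manifold, is of this
kind. -/
structure IsLeafProjection (N : Set E) (G : E → Submodule ℝ E) (U : Set E) (pr : E → Q) :
    Prop where
  isOpen : IsOpen U
  smooth : ContDiffOn ℝ ∞ pr U
  surj : ∀ x ∈ N ∩ U, (tangent N x).map (fderiv ℝ pr x : E →ₗ[ℝ] Q) = ⊤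
  ker : ∀ x ∈ N ∩ U, ∀ v ∈ tangent N x, fderiv ℝ pr x v = 0 ↔ v ∈ G x

/-- The linearization of the distribution `V` along the leaves of `Fol(G)`:
`x ↦ pr_*(V_x) ⊆ T_Γ(N / Fol(G)) = Q`, where `pr` is a leaf projection for `G`. -/
def linearization (pr : E → Q) (V : E → Submodule ℝ E) (x : E) : Submodule ℝ Q :=
  (V x).map (fderiv ℝ pr x : E →ₗ[ℝ] Q)

end General

/-! ### The cotangent bundle of a vector space `V`, abnormal extremals and Jacobi flags -/

section Cotangent

variable {V : Type*} [NormedAddCommGroup V] [NormedSpace ℝ V]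

/-- `T^*V`: pairs `(q, p)` of a point and a covector. -/
abbrev Cotangent (V : Type*) [NormedAddCommGroup V] [NormedSpace ℝ V] : Type _ := V × (V →L[ℝ] ℝ)

/-- The tautological Liouville form `𝔰 = p dq` at `l = (q, p)`. -/
def liouville (l v : Cotangent V) : ℝ := l.2 v.1

/-- The standard symplectic form `σ = d𝔰 = dp ∧ dq` (constant in these coordinates). -/
def sigma (v w : Cotangent V) : ℝ := v.2 w.1 - w.2 v.1

/-- The vectors of `W` that are `σ`-orthogonal to all of `W'`. -/
def skewCompl (W W' : Submodule ℝ (Cotangent V)) : Submodule ℝ (Cotangent V) where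
  carrier := {v | v ∈ W ∧ ∀ w ∈ W', sigma v w = 0}
  zero_mem' := ⟨W.zero_mem, fun w _ => by simp [sigma]⟩
  add_mem' := by
    rintro a b ⟨ha, ha'⟩ ⟨hb, hb'⟩
    refine ⟨W.add_mem ha hb, fun w hw => ?_⟩
    have h1 := ha' w hw
    have h2 := hb' w hw
    simp only [sigma, Prod.fst_add, Prod.snd_add, map_add, add_apply] at *
    linarith
  smul_mem' := by
    rintro c a ⟨ha, ha'⟩
    refine ⟨W.smul_mem c ha, fun w hw => ?_⟩
    have h1 := ha' w hw
    simp only [sigma, Prod.smul_fst, Prod.smul_snd, map_smul, smul_apply,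
      smul_eq_mul] at *
    rw [← mul_sub, h1, mul_zero]

/-- The annihilator in `T^*O` of a distribution `F` on `O ⊆ V`. -/
def annih (O : Set V) (F : V → Submodule ℝ V) : Set (Cotangent V) :=
  {l | l.1 ∈ O ∧ ∀ v ∈ F l.1, l.2 v = 0}

/-- `Ker(σ|_S)` at a point `l` of a submanifold `S ⊆ T^*V`. -/
def kerSigma (S : Set (Cotangent V)) (l : Cotangent V) : Submodule ℝ (Cotangent V) :=
  skewCompl (tangent S l) (tangent S l)

/-- `Υ` is (the image of) an abnormal extremal of the distribution `D` on `O`: an absolutely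
continuous curve `γ` on an interval `I`, lying in `D^⊥` minus the zero section, with velocity
a.e. in `Ker(σ|_{D^⊥})`. -/
def IsAbnormalExtremal (O : Set V) (D : V → Submodule ℝ V) (Υ : Set (Cotangent V)) : Prop :=
  ∃ (I : Set ℝ) (γ : ℝ → Cotangent V), I.OrdConnected ∧
    (∀ a ∈ I, ∀ b ∈ I, AbsolutelyContinuousOnInterval γ a b) ∧
    (∀ t ∈ I, γ t ∈ annih O D ∧ (γ t).2 ≠ 0) ∧
    (∀ᵐ t : ℝ, t ∈ I → ∃ v ∈ kerSigma (annih O D) (γ t), HasDerivAt γ v t) ∧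
    Υ = γ '' I

/-- `(D^2)^⊥`. -/
def D2perp (O : Set V) (D : V → Submodule ℝ V) : Set (Cotangent V) :=
  annih O (derivedFlag O D 2)

/-- `(D^2)^⊥ \ (D^3)^⊥`. -/
def regPart (O : Set V) (D : V → Submodule ℝ V) : Set (Cotangent V) :=
  D2perp O D \ annih O (derivedFlag O D 3)

/-- The characteristic distribution: `Ker(σ|_{(D^2)^⊥})`. -/
def charDist (O : Set V) (D : V → Submodule ℝ V) (l : Cotangent V) :
    Submodule ℝ (Cotangent V) :=
  kerSigma (D2perp O D) l

/-- The line spanned by the generator of the dilations of the fibres of `T^*V`, i.e. the kernel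
of the differential of the projectivization `Π : T^*V → ℙT^*V`. -/
def euler (l : Cotangent V) : Submodule ℝ (Cotangent V) :=
  Submodule.span ℝ {((0 : V), l.2)}

/- Objects on `ℙ(D^2)^⊥ \ ℙ(D^3)^⊥` are described in homogeneous coordinates: the distributions
`J^(i)`, `Δ`, `C` on the projectivization are given by their full preimages under `Π_*` on the cone
`(D^2)^⊥ \ (D^3)^⊥`. For `C` the preimage is `charDist ⊔ euler`. -/

/-- `J^(0)`: the tangent vectors `v` of `(D^2)^⊥` with `π_* v ∈ D`. -/
def jacobiZero (O : Set V) (D : V → Submodule ℝ V) (l : Cotangent V) :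
    Submodule ℝ (Cotangent V) :=
  tangent (D2perp O D) l ⊓ (D l.1).comap (LinearMap.fst ℝ V (V →L[ℝ] ℝ))

/-- `J^(i) = J^(i-1) + [C, J^(i-1)]` for `i ≥ 1`. -/
def jacobiPos (O : Set V) (D : V → Submodule ℝ V) :
    ℕ → Cotangent V → Submodule ℝ (Cotangent V)
  | 0 => jacobiZero O D
  | i + 1 => fun l => jacobiPos O D i l ⊔
      bracketDist (regPart O D) (charDist O D) (jacobiPos O D i) l

/-- The even-contact distribution `Δ` on `(D^2)^⊥ \ (D^3)^⊥`: the kernel of `𝔰`. -/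
def evenContact (O : Set V) (D : V → Submodule ℝ V) (l : Cotangent V) :
    Submodule ℝ (Cotangent V) :=
  tangent (D2perp O D) l ⊓
    LinearMap.ker ((l.2 : V →ₗ[ℝ] ℝ) ∘ₗ LinearMap.fst ℝ V (V →L[ℝ] ℝ))

/-- The flag `J^(i)`, `i ∈ ℤ`; for `i > 0`, `J^(-i)` is the skew-orthogonal complement of `J^(i)`
in `Δ` (with respect to `d𝔰|_Δ = σ|_Δ`). -/
def jacobiFlag (O : Set V) (D : V → Submodule ℝ V) :
    ℤ → Cotangent V → Submodule ℝ (Cotangent V)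
  | Int.ofNat i => jacobiPos O D i
  | Int.negSucc i => fun l => skewCompl (evenContact O D l) (jacobiPos O D (i + 1) l)

/-- `pr` (defined on the part in `U` of the cone `(D^2)^⊥ \ (D^3)^⊥`) is homogeneous of degree
zero, and the induced map on the corresponding piece of `ℙ(D^2)^⊥ \ ℙ(D^3)^⊥` represents the
projection onto the space `Abn` of leaves of the characteristic distribution `C`. -/
structure IsAbnProjection {Q : Type*} [NormedAddCommGroup Q] [NormedSpace ℝ Q]
    (O : Set V) (D : V → Submodule ℝ V) (U : Set (Cotangent V)) (pr : Cotangent V → Q) :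
    Prop where
  leaf : IsLeafProjection (regPart O D) (fun l => charDist O D l ⊔ euler l) U pr
  homog : ∀ l ∈ U, ∀ r : ℝ, r ≠ 0 → (l.1, r • l.2) ∈ U ∧ pr (l.1, r • l.2) = pr l

/-- `\bar Δ(Υ) ⊆ T_Υ Abn`, the subspace induced by `Δ`: the projections of the spaces `Δ(l)`,
`l ∈ Υ` (all these projections coincide). -/
def barDelta {Q : Type*} [NormedAddCommGroup Q] [NormedSpace ℝ Q]
    (O : Set V) (D : V → Submodule ℝ V) (pr : Cotangent V → Q) (Υ : Set (Cotangent V)) :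
    Submodule ℝ Q :=
  ⨆ l ∈ Υ, linearization pr (evenContact O D) l

/-- The curve `J^(i)_Υ`: the linearization of `J^(i)` along `Υ`. -/
def jacobiCurve {Q : Type*} [NormedAddCommGroup Q] [NormedSpace ℝ Q]
    (O : Set V) (D : V → Submodule ℝ V) (pr : Cotangent V → Q) (i : ℤ) :
    Cotangent V → Submodule ℝ Q :=
  linearization pr (jacobiFlag O D i)

/-- The quasi-impulse `H_X(q, p) = p(X(q))` of a vector field `X`. -/
def quasiImpulse (X : V → V) (l : Cotangent V) : ℝ := l.2 (X l.1)

end Cotangent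

/-! ### Jets, Lagrangians and the Euler-Lagrange equation -/

/-- The jet space `J^k(ℝ, ℝ)` with coordinates `(x, (y_0, …, y_k))`. -/
abbrev Jet (k : ℕ) : Type := ℝ × (Fin (k + 1) → ℝ)

/-- The projection `π_{k,m} : J^k → J^m`, `m ≤ k`. -/
def jetProj {k m : ℕ} (h : m ≤ k) : Jet k →ₗ[ℝ] Jet m where
  toFun j := (j.1, fun i => j.2 (Fin.castLE (Nat.succ_le_succ h) i))
  map_add' _ _ := rfl
  map_smul' _ _ := rfl

/-- `∂g/∂y_i`. -/
def pderiv {k : ℕ} (g : Jet k → ℝ) (i : Fin (k + 1)) (j : Jet k) : ℝ :=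
  fderiv ℝ g j (0, Pi.single i 1)

/-- The vector `∂_x + y_1 ∂_{y_0} + … + y_k ∂_{y_{k-1}}` at `j ∈ J^k`. -/
def jetShift {k : ℕ} (j : Jet k) : Jet k :=
  (1, fun i => if h : (i : ℕ) + 1 < k + 1 then j.2 ⟨(i : ℕ) + 1, h⟩ else 0)

/-- The total derivative `d/dx`, for functions on `J^k` that do not depend on `y_k`. -/
def totalDeriv {k : ℕ} (g : Jet k → ℝ) (j : Jet k) : ℝ := fderiv ℝ g j (jetShift j)

/-- `d^m/dx^m (∂f/∂y_i)` as a function on `J^{2n}`, where `f` is a function on `J^n`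
and `m ≤ n` (it depends only on the coordinates up to `y_{n+m}`). -/
def totalDerivPartial {n : ℕ} (f : Jet n → ℝ) (m : ℕ) (i : Fin (n + 1)) : Jet (2 * n) → ℝ :=
  totalDeriv^[m] (fun e => pderiv f i (jetProj (by omega : n ≤ 2 * n) e))

/-- The Euler-Lagrange expression
`f_{y_0} - d/dx f_{y_1} + … + (-1)^n d^n/dx^n f_{y_n}`. -/
def eulerLagrange {n : ℕ} (f : Jet n → ℝ) (e : Jet (2 * n)) : ℝ :=
  ∑ i : Fin (n + 1), (-1) ^ (i : ℕ) * totalDerivPartial f (i : ℕ) i e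

/-- The Euler-Lagrange equation `𝓔(L) ⊆ J^{2n}` of the Lagrangian `L = f dx`, with `f` defined
on `Ω ⊆ J^n`. -/
def ELset {n : ℕ} (Ω : Set (Jet n)) (f : Jet n → ℝ) : Set (Jet (2 * n)) :=
  {e | jetProj (by omega : n ≤ 2 * n) e ∈ Ω ∧ eulerLagrange f e = 0}

/-- The Cartan distribution on `J^k`: the common kernel of `θ_i = dy_i - y_{i+1} dx`,
`0 ≤ i < k`. -/
def cartan {k : ℕ} (j : Jet k) : Submodule ℝ (Jet k) :=
  ⨅ i : Fin k, LinearMap.ker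
    ((LinearMap.proj i.castSucc ∘ₗ LinearMap.snd ℝ ℝ (Fin (k + 1) → ℝ)) -
      j.2 i.succ • LinearMap.fst ℝ ℝ (Fin (k + 1) → ℝ))

/-- The line distribution `𝓢` on an equation `𝓔 ⊆ J^k`, tangent to the prolonged solutions. -/
def solDist {k : ℕ} (𝓔 : Set (Jet k)) (e : Jet k) : Submodule ℝ (Jet k) :=
  cartan e ⊓ tangent 𝓔 e

/-- The distribution `V^i = ker dπ_{N+1,N-i} ∩ T𝓔` of rank `i` on an equation `𝓔 ⊆ J^k` of
order `k = N + 1`. -/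
def vertDist {k : ℕ} (𝓔 : Set (Jet k)) (i : ℕ) (e : Jet k) : Submodule ℝ (Jet k) :=
  LinearMap.ker (jetProj (by omega : k - 1 - i ≤ k)) ⊓ tangent 𝓔 e

/-- The jet prolongation `x ↦ (x, y(x), y'(x), …, y^(k)(x))`. -/
def prolong (k : ℕ) (y : ℝ → ℝ) (x : ℝ) : Jet k := (x, fun i => iteratedDeriv (i : ℕ) y x)

/-- `Γ` is (the prolongation to `J^k` of) a solution of the equation `𝓔 ⊆ J^k` on a nonempty
open interval. -/
def IsSolution {k : ℕ} (𝓔 : Set (Jet k)) (Γ : Set (Jet k)) : Prop :=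
  ∃ (I : Set ℝ) (y : ℝ → ℝ), IsOpen I ∧ I.OrdConnected ∧ I.Nonempty ∧ ContDiffOn ℝ k y I ∧
    (∀ x ∈ I, prolong k y x ∈ 𝓔) ∧ Γ = prolong k y '' I

/-! ### The rank 2 distribution associated with a Lagrangian and the Legendre transform -/

/-- `J^n × ℝ` with coordinates `(x, y_0, …, y_n, z)`. -/
abbrev JetZ (n : ℕ) : Type := Jet n × ℝ

/-- `X_1 = ∂_x + y_1 ∂_{y_0} + … + y_n ∂_{y_{n-1}} + f ∂_z`. -/
def X1 {n : ℕ} (f : Jet n → ℝ) (q : JetZ n) : JetZ n := (jetShift q.1, f q.1)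

/-- `X_2 = ∂_{y_n}`. -/
def X2 {n : ℕ} (_q : JetZ n) : JetZ n := ((0, Pi.single (Fin.last n) 1), 0)

/-- `Z = ∂_z`. -/
def Zfield {n : ℕ} (_q : JetZ n) : JetZ n := (0, 1)

/-- The distribution `D = ⟨X_1, X_2⟩` associated with the Lagrangian `f dx`. -/
def lagrDist {n : ℕ} (f : Jet n → ℝ) (q : JetZ n) : Submodule ℝ (JetZ n) :=
  Submodule.span ℝ {X1 f q, X2 q}

/-- The domain `Ω × ℝ` of the associated distribution. -/
def domZ {n : ℕ} (Ω : Set (Jet n)) : Set (JetZ n) := {q | q.1 ∈ Ω}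

/-- `𝓗 = {H_Z = -1} ∩ (D^2)^⊥`. -/
def Hset {n : ℕ} (Ω : Set (Jet n)) (f : Jet n → ℝ) : Set (Cotangent (JetZ n)) :=
  {l | l ∈ D2perp (domZ Ω) (lagrDist f) ∧ quasiImpulse Zfield l = -1}

/-- The coordinate space of `(x, y_0, …, y_n, ξ_0, …, ξ_{n-2})`. These functions are coordinates on
`𝓗 / Fol(\vec H_Z)`, where `\vec H_Z = ∂_z`, so that the leaves of `Fol(\vec H_Z)` are the orbits
of the translations `z ↦ z + c`. -/
abbrev Reduced (n : ℕ) : Type := ℝ × (Fin (n + 1) → ℝ) × (Fin (n - 1) → ℝ)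

/-- The canonical projection `φ_Z : 𝓗 → 𝓗 / Fol(\vec H_Z)` in these coordinates; `ξ_i` is the
coefficient of `dy_i` in the covector. -/
def phiZ {n : ℕ} (l : Cotangent (JetZ n)) : Reduced n :=
  (l.1.1.1, l.1.1.2, fun i => l.2 ((0, Pi.single (Fin.castLE (by omega) i) 1), 0))

/-- The Legendre transform `𝔏 : 𝓔(L) → 𝓗 / Fol(\vec H_Z)`,
`(x, y_0, …, y_{2n}) ↦ (x, y_0, …, y_n, ξ_0, …, ξ_{n-2})` with
`ξ_{j-1} = ∑_{k=j}^n (-1)^{k-j} d^{k-j}/dx^{k-j} (f_{y_k})`, `1 ≤ j ≤ n - 1`. -/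
def legendre {n : ℕ} (f : Jet n → ℝ) (e : Jet (2 * n)) : Reduced n :=
  (e.1, (jetProj (by omega : n ≤ 2 * n) e).2, fun i =>
    ∑ k : Fin (n + 1), if (i : ℕ) + 1 ≤ (k : ℕ) then
      (-1) ^ ((k : ℕ) - ((i : ℕ) + 1)) * totalDerivPartial f ((k : ℕ) - ((i : ℕ) + 1)) k e
    else 0)

end VarLin

end

noncomputable section

namespace VarLin

/-! ### Tangent spaces of retracts, brackets, and linear equations along curves. -/

section General

variable {E : Type*} [NormedAddCommGroup E] [NormedSpace ℝ E]
variable {Q : Type*} [NormedAddCommGroup Q] [NormedSpace ℝ Q]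

/-! Both curves are images of the single vector `∂_{y_{2n-1}}` under two families of linear maps
that solve the same linear differential equation along the solution.

The Euler–Lagrange expression is affine in `y_{2n}` with slope `± f_{y_n y_n} ≠ 0`, so `𝓔` is a
graph over `(x, y_0, …, y_{2n-1})`. Instead of changing coordinates, the argument stays on `J^{2n}`
and uses the projection `retr` onto `𝓔` along `∂_{y_{2n}}` and the field `T = flowVec`, whose image
under `d(retr)` spans `𝓢`. In these terms `Lin^1` is spanned by `d(pr₁ ∘ retr)(∂_{y_{2n-1}})`
(`linearization_vertDist`).

On the other side, `legMap` sends `(e, z)` into `𝓗`, and the kernel of its differential is spanned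
by `∂_{y_{2n}}`. Hamilton's equations (`fderiv_mom_flowVec`) say that it carries `T + f ∂_z` to the
characteristic direction. Each bracket with `𝓒` removes one contact form `θ_j` from the equations of
the Jacobi flag (`mem_jacobiPos_iff`). Hence `J^(n-1)` is cut out of `Δ` by `θ_0` alone, and its
skew complement `J^(1-n)` is spanned by `𝓒`, the dilation direction and the vertical vector `θ_0`
(`mem_jacobiFlag_iff`). Only the momentum `ξ_0` involves `y_{2n-1}`, with coefficient `± f_{y_n
y_n}`, so `θ_0` is a nonzero multiple of the image of `∂_{y_{2n-1}}` (`fderiv_legMap_subTopVec`).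

Let `c` be the solution curve, with its top coordinate replaced by zero, and `Z` a primitive of `f`
along it. Put `L(x) = d(pr₁ ∘ retr)` at `c(x)`, and `K(x) w = d(pr₂ ∘ legMap)(w, β w)` at `(c(x),
Z(x))` (`abnLin`), where the form `β = legForm` supplies the `z`-component that places the vector in
`Δ`. The maps `pr₁ ∘ retr` and `pr₂ ∘ legMap` are first integrals of `T` and `T + f ∂_z`, and the
Lie derivative of `β` along `T` is `df`; therefore `L` and `K` both satisfy `M' = -M ∘ dT`. Both
have kernel `⟨T, ∂_{y_{2n}}⟩`, `L` is onto, and `K` has range `\bar Δ`. So `K = A ∘ L` with a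
constant isomorphism `A` onto `\bar Δ` (`exists_intertwining`), and evaluation at `∂_{y_{2n-1}}`
matches the two curves.

Being an abnormal extremal enters only through `dz = f dx` along `Υ`, which identifies its points as
`legMap (c x, Z x)` (`exists_action`). -/

theorem tangent_congr {S S' : Set E} {x : E} (h : ∀ᶠ y in 𝓝 x, y ∈ S ↔ y ∈ S') :
    tangent S x = tangent S' x := by
  unfold tangent
  congr 1
  ext v
  refine exists_congr fun γ => and_congr_right fun h0 => and_congr_right fun hs =>
    and_congr_left fun _ => ?_
  have hc : Tendsto γ (𝓝 0) (𝓝 x) := h0 ▸ hs.continuousAt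
  have := hc.eventually h
  exact ⟨fun h1 => by filter_upwards [this, h1] with t a b using a.1 b,
    fun h1 => by filter_upwards [this, h1] with t a b using a.2 b⟩

/-- A function vanishing on `S` has zero derivative along `S`. -/
theorem fderiv_eq_zero_of_mem_tangent {S : Set E} {x v : E} {g : E → Q}
    (hg : DifferentiableAt ℝ g x) (h : ∀ᶠ y in 𝓝 x, y ∈ S → g y = 0) (hv : v ∈ tangent S x) :
    fderiv ℝ g x v = 0 := by
  induction hv using Submodule.span_induction with
  | mem v hv =>
    obtain ⟨γ, h0, hs, hS, rfl⟩ := hv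
    have hd : HasDerivAt γ (deriv γ 0) 0 := (hs.differentiableAt (by simp)).hasDerivAt
    have hg' : HasFDerivAt g (fderiv ℝ g x) (γ 0) := h0.symm ▸ hg.hasFDerivAt
    have h1 := hg'.comp_hasDerivAt (0 : ℝ) hd
    have hc : Tendsto γ (𝓝 0) (𝓝 x) := h0 ▸ hs.continuousAt
    have h2 : g ∘ γ =ᶠ[𝓝 0] fun _ => (0 : Q) := by
      filter_upwards [hc.eventually h, hS] with t a b using a b
    exact h1.unique ((hasDerivAt_const (0 : ℝ) (0 : Q)).congr_of_eventuallyEq h2)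
  | zero => simp
  | add a b _ _ ha hb => simp [ha, hb]
  | smul c a _ ha => simp [ha]

/-- The tangent space of a smooth local retract. -/
theorem mem_tangent_iff_of_retraction {S : Set E} {x : E} {R : E → E} (hx : R x = x)
    (hR : ContDiffAt ℝ ∞ R x) (hS : ∀ᶠ y in 𝓝 x, R y ∈ S)
    (hid : ∀ᶠ y in 𝓝 x, y ∈ S → R y = y) (v : E) :
    v ∈ tangent S x ↔ fderiv ℝ R x v = v := by
  have hRd := hR.differentiableAt (by simp)
  constructor
  · intro hv
    have := fderiv_eq_zero_of_mem_tangent (g := fun y => R y - y) (hRd.sub differentiableAt_id)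
      (hid.mono fun y h hy => sub_eq_zero.2 (h hy)) hv
    rw [fderiv_fun_sub hRd differentiableAt_fun_id] at this
    simpa [sub_eq_zero] using this
  · intro hv
    -- The retraction bends the straight line into a curve in `S`; its velocity is `dR v = v`.
    refine Submodule.subset_span ⟨fun t => R (x + t • v), by simp [hx], ?_, ?_, ?_⟩
    · refine ContDiffAt.comp (0 : ℝ) (by simpa using hR) ?_
      fun_prop
    · have : Tendsto (fun t : ℝ => x + t • v) (𝓝 0) (𝓝 x) := by
        have : ContinuousAt (fun t : ℝ => x + t • v) 0 := by fun_prop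
        simpa [ContinuousAt] using this
      exact this.eventually hS
    · have h1 : HasDerivAt (fun t : ℝ => x + t • v) v 0 := by
        simpa using ((hasDerivAt_id (0 : ℝ)).smul_const v).const_add x
      have h2 : HasFDerivAt R (fderiv ℝ R x) (x + (0 : ℝ) • v) := by simpa using hRd.hasFDerivAt
      exact (h2.comp_hasDerivAt (0 : ℝ) h1).deriv.trans hv

/-- Cartan's formula for a one-form vanishing on two vector fields along `S`. -/
theorem apply_lieBracket {S : Set E} {x : E} {X Y : E → E} {α : E → E →L[ℝ] Q}
    (hX : DifferentiableAt ℝ X x) (hY : DifferentiableAt ℝ Y x) (hα : DifferentiableAt ℝ α x)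
    (hXS : X x ∈ tangent S x) (hYS : Y x ∈ tangent S x)
    (hαX : ∀ᶠ y in 𝓝 x, y ∈ S → α y (X y) = 0) (hαY : ∀ᶠ y in 𝓝 x, y ∈ S → α y (Y y) = 0) :
    α x (VectorField.lieBracket ℝ X Y x) =
      fderiv ℝ α x (Y x) (X x) - fderiv ℝ α x (X x) (Y x) := by
  have h1 := fderiv_eq_zero_of_mem_tangent (hα.clm_apply hX) hαX hYS
  have h2 := fderiv_eq_zero_of_mem_tangent (hα.clm_apply hY) hαY hXS
  rw [fderiv_clm_apply hα hX] at h1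
  rw [fderiv_clm_apply hα hY] at h2
  simp only [add_apply, ContinuousLinearMap.comp_apply, ContinuousLinearMap.flip_apply] at h1 h2
  rw [VectorField.lieBracket_eq, map_sub, eq_neg_of_add_eq_zero_left h1,
    eq_neg_of_add_eq_zero_left h2]
  abel

/-- Uniqueness for homogeneous linear equations `M' = - M ∘ B`. -/
theorem eq_zero_of_hasDerivAt_neg_comp {J : Set ℝ} (hJ : J.OrdConnected)
    {M : ℝ → E →L[ℝ] Q} {B : ℝ → E →L[ℝ] E} (hB : ContinuousOn B J)
    (hM : ∀ x ∈ J, HasDerivAt M (-(M x).comp (B x)) x) {x₀ : ℝ} (hx₀ : x₀ ∈ J) (h0 : M x₀ = 0)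
    {x : ℝ} (hx : x ∈ J) : M x = 0 := by
  -- The Grönwall estimate propagates a zero only to the right; `s = -1` reverses time and covers
  -- the points to the left of `x₀`.
  have key : ∀ (s : ℝ), s = 1 ∨ s = -1 → ∀ c d : ℝ, c ≤ d → (∀ t ∈ Icc c d, s * t ∈ J) →
      M (s * c) = 0 → M (s * d) = 0 := by
    intro s hs c d hcd hsub hc
    have hcs : ContinuousOn (fun t => B (s * t)) (Icc c d) :=
      hB.comp (by fun_prop) hsub
    obtain ⟨K, hK⟩ := isCompact_Icc.exists_bound_of_continuousOn hcs
    have hd : ∀ t ∈ Icc c d, HasDerivAt (fun t => M (s * t))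
        (s • -(M (s * t)).comp (B (s * t))) t := by
      intro t ht
      have h1 : HasDerivAt (fun t : ℝ => s * t) s t := by
        simpa using (hasDerivAt_id t).const_mul s
      exact (hM _ (hsub t ht)).scomp t h1
    refine eq_zero_of_abs_deriv_le_mul_abs_self_of_eq_zero_right (K := K)
      (fun t ht => (hd t ht).continuousAt.continuousWithinAt)
      (fun t ht => (hd t (Ico_subset_Icc_self ht)).hasDerivWithinAt) hc ?_ d
      (right_mem_Icc.2 hcd)
    intro t ht
    have hs1 : ‖s‖ = 1 := by rcases hs with rfl | rfl <;> simp
    rw [norm_smul, norm_neg, hs1, one_mul]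
    refine (ContinuousLinearMap.opNorm_comp_le _ _).trans ?_
    rw [mul_comm]
    exact mul_le_mul_of_nonneg_right (hK t (Ico_subset_Icc_self ht)) (norm_nonneg _)
  rcases le_total x₀ x with h | h
  · have := key 1 (Or.inl rfl) x₀ x h (fun t ht => by
      rw [one_mul]; exact hJ.out hx₀ hx ht) (by simpa using h0)
    simpa using this
  · have := key (-1) (Or.inr rfl) (-x₀) (-x) (by linarith) (fun t ht => by
      refine hJ.out hx hx₀ ⟨?_, ?_⟩ <;> linarith [ht.1, ht.2]) (by simpa using h0)
    simpa using this

/-- The differential of a first integral of `T` along an integral curve of `T`. -/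
theorem hasDerivAt_fderiv_of_first_integral {p : E → Q} {T : E → E} {c : ℝ → E} {x : ℝ}
    (hp : ContDiffAt ℝ 2 p (c x)) (hT : DifferentiableAt ℝ T (c x))
    (h0 : ∀ᶠ y in 𝓝 (c x), fderiv ℝ p y (T y) = 0) (hc : HasDerivAt c (T (c x)) x) :
    HasDerivAt (fun t => fderiv ℝ p (c t))
      (-(fderiv ℝ p (c x)).comp (fderiv ℝ T (c x))) x := by
  have hp1 : DifferentiableAt ℝ (fderiv ℝ p) (c x) :=
    (hp.fderiv_right (m := 1) (by norm_num)).differentiableAt (by norm_num)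
  have h1 := hp1.hasFDerivAt.comp_hasDerivAt x hc
  refine h1.congr_deriv ?_
  ext w
  -- Differentiating the identity `dp(T) = 0` gives `d²p(w, T) = -dp(dT w)`; symmetry of `d²p` turns
  -- the left side into the derivative along the curve.
  have h2 : fderiv ℝ (fun y => fderiv ℝ p y (T y)) (c x) = 0 := by
    have : (fun y => fderiv ℝ p y (T y)) =ᶠ[𝓝 (c x)] fun _ => (0 : Q) := h0
    rw [this.fderiv_eq]; simp
  rw [fderiv_clm_apply hp1 hT] at h2
  have h3 := congrArg (fun L => L w) h2
  simp only [add_apply, ContinuousLinearMap.comp_apply, ContinuousLinearMap.flip_apply,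
    zero_apply] at h3
  have hsym := (hp.isSymmSndFDerivAt (by simp)).eq w (T (c x))
  simp only [neg_apply, ContinuousLinearMap.comp_apply]
  rw [← hsym, eq_neg_of_add_eq_zero_left h3, neg_neg]

/-- Comparison of two solutions of `M' = - M ∘ B`: they agree up to a constant factor on the left
as soon as the kernels at one point are compatible. -/
theorem exists_factorization {Q' : Type*} [NormedAddCommGroup Q'] [NormedSpace ℝ Q']
    [FiniteDimensional ℝ E]
    {J : Set ℝ} (hJ : J.OrdConnected)
    {L : ℝ → E →L[ℝ] Q} {K : ℝ → E →L[ℝ] Q'} {B : ℝ → E →L[ℝ] E} (hB : ContinuousOn B J)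
    (hL : ∀ x ∈ J, HasDerivAt L (-(L x).comp (B x)) x)
    (hK : ∀ x ∈ J, HasDerivAt K (-(K x).comp (B x)) x) {x₀ : ℝ} (hx₀ : x₀ ∈ J)
    (hsurj : Function.Surjective (L x₀)) (hker : ∀ w, L x₀ w = 0 → K x₀ w = 0) :
    ∃ A : Q →L[ℝ] Q', ∀ x ∈ J, ∀ w, A (L x w) = K x w := by
  have : FiniteDimensional ℝ Q := Module.Finite.of_surjective (L x₀ : E →ₗ[ℝ] Q) hsurj
  -- The factor is forced at `x₀`: `A = K x₀ ∘ s` for a right inverse `s` of `L x₀`. The difference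
  -- `A ∘ L - K` solves the same equation and vanishes at `x₀`.
  obtain ⟨s, hs⟩ := (L x₀ : E →ₗ[ℝ] Q).exists_rightInverse_of_surjective
    (LinearMap.range_eq_top.2 hsurj)
  have hs' : ∀ q, L x₀ (s q) = q := fun q => LinearMap.congr_fun hs q
  let A : Q →L[ℝ] Q' := LinearMap.toContinuousLinearMap ((K x₀ : E →ₗ[ℝ] Q') ∘ₗ s)
  have hA : ∀ q, A q = K x₀ (s q) := fun q => rfl
  refine ⟨A, fun x hx w => ?_⟩
  have hM := eq_zero_of_hasDerivAt_neg_comp (M := fun t => A.comp (L t) - K t) hJ hB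
    (fun t ht => by
      have h1 := ((ContinuousLinearMap.compL ℝ E Q Q' A).hasFDerivAt (x := L t)).comp_hasDerivAt t
        (hL t ht)
      refine (h1.sub (hK t ht)).congr_deriv ?_
      ext w
      simp only [sub_apply, neg_apply, ContinuousLinearMap.comp_apply,
        ContinuousLinearMap.compL_apply, map_neg]
      abel) hx₀ (by
      ext w
      simp only [sub_apply, ContinuousLinearMap.comp_apply, zero_apply]
      rw [hA, sub_eq_zero, ← sub_eq_zero, ← map_sub]
      apply hker
      simp [hs']) hx
  have := congrArg (fun L => L w) hM
  simpa [sub_eq_zero] using this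

/-- The relation between the first integrals of `(T, f)` on `E × ℝ` and a one-form `β` with
`L_T β = df`. -/
theorem hasDerivAt_fderiv_comp_graph {p : E × ℝ → Q} {T : E → E} {f : E → ℝ}
    {β : E → E →L[ℝ] ℝ} {c : ℝ → E} {Z : ℝ → ℝ} {x : ℝ}
    (hp : ContDiffAt ℝ 2 p (c x, Z x)) (hT : DifferentiableAt ℝ T (c x))
    (hf : DifferentiableAt ℝ f (c x)) (hβ : DifferentiableAt ℝ β (c x))
    (h0 : ∀ᶠ y in 𝓝 (c x, Z x), fderiv ℝ p y (T y.1, f y.1) = 0)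
    (hc : HasDerivAt c (T (c x)) x) (hZ : HasDerivAt Z (f (c x)) x)
    (hβT : ∀ w, fderiv ℝ β (c x) (T (c x)) w + β (c x) (fderiv ℝ T (c x) w) =
      fderiv ℝ f (c x) w) :
    HasDerivAt
      (fun t => (fderiv ℝ p (c t, Z t)).comp ((ContinuousLinearMap.id ℝ E).prod (β (c t))))
      (-((fderiv ℝ p (c x, Z x)).comp ((ContinuousLinearMap.id ℝ E).prod (β (c x)))).comp
        (fderiv ℝ T (c x))) x := by
  have hT' : HasFDerivAt (fun y : E × ℝ => (T y.1, f y.1))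
      (((fderiv ℝ T (c x)).comp (ContinuousLinearMap.fst ℝ E ℝ)).prod
        ((fderiv ℝ f (c x)).comp (ContinuousLinearMap.fst ℝ E ℝ))) (c x, Z x) :=
    HasFDerivAt.prodMk
      (HasFDerivAt.comp (c x, Z x) (g := T) hT.hasFDerivAt hasFDerivAt_fst)
      (HasFDerivAt.comp (c x, Z x) (g := f) hf.hasFDerivAt hasFDerivAt_fst)
  have h1 := hasDerivAt_fderiv_of_first_integral (c := fun t => (c t, Z t)) hp
    hT'.differentiableAt h0 (hc.prodMk hZ)
  have hb : HasDerivAt (fun t => β (c t)) (fderiv ℝ β (c x) (T (c x))) x :=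
    hβ.hasFDerivAt.comp_hasDerivAt x hc
  have h2 : HasDerivAt (fun t => (ContinuousLinearMap.id ℝ E).prod (β (c t)))
      ((0 : E →L[ℝ] E).prod (fderiv ℝ β (c x) (T (c x)))) x := by
    have := (ContinuousLinearMap.compL ℝ E ℝ (E × ℝ)
      (ContinuousLinearMap.inr ℝ E ℝ)).hasFDerivAt (x := β (c x)) |>.comp_hasDerivAt x hb
    have h3 := this.const_add ((ContinuousLinearMap.inl ℝ E ℝ))
    refine (h3.congr_deriv ?_).congr_of_eventuallyEq (Eventually.of_forall fun t => ?_)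
    · ext w <;> simp
    · ext w <;> simp
  -- The product rule applies `dp` to `-d(T, f)(w, β w) + (0, β' w)`. The hypothesis `hβT` says
  -- exactly that this vector is `-(dT w, β(dT w))`.
  refine (h1.clm_comp h2).congr_deriv ?_
  rw [hT'.fderiv]
  ext w
  simp only [add_apply, neg_apply, ContinuousLinearMap.comp_apply,
    ContinuousLinearMap.prod_apply, ContinuousLinearMap.coe_fst', ContinuousLinearMap.id_apply,
    zero_apply]
  rw [← map_neg, ← map_neg, ← map_add]
  congr 1
  ext
  · simp
  · have := hβT w
    simp only [Prod.snd_add, Prod.snd_neg]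
    linarith

end General

/-! ### Symplectic linear algebra, Hamiltonian vectors and annihilators of frames. -/

section Cotangent

variable {V : Type*} [NormedAddCommGroup V] [NormedSpace ℝ V]

theorem sigma_add_left (u v w : Cotangent V) : sigma (u + v) w = sigma u w + sigma v w := by
  simp [sigma]; ring

theorem sigma_smul_left (c : ℝ) (v w : Cotangent V) : sigma (c • v) w = c * sigma v w := by
  simp [sigma]; ring

theorem sigma_swap (v w : Cotangent V) : sigma v w = -sigma w v := by
  simp [sigma]

/-- `σ(v, ·)` as a linear form. -/
def sigmaForm : Cotangent V →ₗ[ℝ] Cotangent V →ₗ[ℝ] ℝ :=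
  LinearMap.mk₂ ℝ sigma sigma_add_left sigma_smul_left
    (fun u v w => by rw [sigma_swap, sigma_add_left, sigma_swap v, sigma_swap w]; ring)
    (fun c v w => by rw [sigma_swap, sigma_smul_left, sigma_swap w]; simp)

@[simp] theorem sigmaForm_apply (v w : Cotangent V) : sigmaForm v w = sigma v w := rfl

/-- Covectors separate points by Hahn–Banach, so nondegeneracy needs no finite dimension. -/
theorem eq_zero_of_sigma_eq_zero {v : Cotangent V} (h : ∀ w, sigma v w = 0) : v = 0 := by
  have h2 : v.2 = 0 := by
    ext q
    simpa [sigma] using h (q, 0)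
  have h1 : v.1 = 0 := by
    refine SeparatingDual.eq_zero_of_forall_dual_eq_zero (R := ℝ) fun g => ?_
    simpa [sigma] using h (0, g)
  exact Prod.ext h1 h2

theorem sigmaForm_injective : Function.Injective (sigmaForm (V := V)) := by
  rw [← LinearMap.ker_eq_bot, LinearMap.ker_eq_bot']
  exact fun v hv => eq_zero_of_sigma_eq_zero fun w => LinearMap.congr_fun hv w

/-- The double skew-orthogonal complement of finitely many vectors is their span. -/
theorem mem_span_of_sigma_eq_zero {ι : Type*} [Finite ι] {u : ι → Cotangent V} {v : Cotangent V}
    (h : ∀ w, (∀ i, sigma (u i) w = 0) → sigma v w = 0) : v ∈ Submodule.span ℝ (range u) := by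
  have h1 : sigmaForm v ∈ Submodule.span ℝ (range fun i => sigmaForm (u i)) := by
    -- A linear form that vanishes on the common kernel of finitely many forms is a combination of
    -- them.
    refine mem_span_of_iInf_ker_le_ker fun w hw => ?_
    simp only [Submodule.mem_iInf, LinearMap.mem_ker, sigmaForm_apply] at hw ⊢
    exact h w hw
  have h2 : (range fun i => sigmaForm (u i)) = sigmaForm '' range u := by
    rw [← range_comp]; rfl
  rw [h2, ← Submodule.map_span] at h1
  obtain ⟨v', hv', he⟩ := h1
  exact sigmaForm_injective he ▸ hv'

/-- The Hamiltonian vector field of the quasi-impulse of `X`. -/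
def hamVec (X : V → V) (l : Cotangent V) : Cotangent V := (X l.1, -(l.2.comp (fderiv ℝ X l.1)))

theorem hasFDerivAt_quasiImpulse {X : V → V} {l : Cotangent V} (hX : DifferentiableAt ℝ X l.1) :
    HasFDerivAt (quasiImpulse X)
      ((ContinuousLinearMap.apply ℝ ℝ (X l.1)).comp (ContinuousLinearMap.snd ℝ V (V →L[ℝ] ℝ)) +
        (l.2.comp (fderiv ℝ X l.1)).comp (ContinuousLinearMap.fst ℝ V (V →L[ℝ] ℝ))) l := by
  have h1 : HasFDerivAt (fun l : Cotangent V => X l.1)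
      ((fderiv ℝ X l.1).comp (ContinuousLinearMap.fst ℝ V (V →L[ℝ] ℝ))) l :=
    HasFDerivAt.comp l (g := X) hX.hasFDerivAt hasFDerivAt_fst
  have h2 := HasFDerivAt.clm_apply (c := fun l : Cotangent V => l.2) (hasFDerivAt_snd (p := l)) h1
  refine h2.congr_fderiv ?_
  ext v <;> simp

theorem fderiv_quasiImpulse {X : V → V} {l : Cotangent V} (hX : DifferentiableAt ℝ X l.1)
    (v : Cotangent V) :
    fderiv ℝ (quasiImpulse X) l v = v.2 (X l.1) + l.2 (fderiv ℝ X l.1 v.1) := by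
  rw [(hasFDerivAt_quasiImpulse hX).fderiv]; simp

/-- Fixes the sign: tangency to a level set of `H_X` becomes `σ`-orthogonality to `hamVec X`. -/
theorem sigma_hamVec {X : V → V} {l : Cotangent V} (hX : DifferentiableAt ℝ X l.1)
    (v : Cotangent V) : sigma v (hamVec X l) = fderiv ℝ (quasiImpulse X) l v := by
  simp [fderiv_quasiImpulse hX, sigma, hamVec]

theorem contDiffAt_quasiImpulse {X : V → V} {l : Cotangent V} (hX : ContDiffAt ℝ ∞ X l.1) :
    ContDiffAt ℝ ∞ (quasiImpulse X) l :=
  contDiffAt_snd.clm_apply (ContDiffAt.comp l hX contDiffAt_fst)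

theorem contDiffAt_hamVec {X : V → V} {l : Cotangent V} (hX : ContDiffAt ℝ ∞ X l.1) :
    ContDiffAt ℝ ∞ (hamVec X) l :=
  (ContDiffAt.comp l hX contDiffAt_fst).prodMk
    (contDiffAt_snd.clm_comp
      (ContDiffAt.comp l (hX.fderiv_right (m := ∞) (by simp)) contDiffAt_fst)).neg

/-- Cartan's formula for the pull-back of a one-form on the base. -/
theorem apply_lieBracket_fst {S : Set (Cotangent V)} {l : Cotangent V}
    {X Y : Cotangent V → Cotangent V} {α : V → V →L[ℝ] ℝ}
    (hX : DifferentiableAt ℝ X l) (hY : DifferentiableAt ℝ Y l) (hα : DifferentiableAt ℝ α l.1)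
    (hXS : X l ∈ tangent S l) (hYS : Y l ∈ tangent S l)
    (hαX : ∀ᶠ y in 𝓝 l, y ∈ S → α y.1 (X y).1 = 0)
    (hαY : ∀ᶠ y in 𝓝 l, y ∈ S → α y.1 (Y y).1 = 0) :
    α l.1 (VectorField.lieBracket ℝ X Y l).1 =
      fderiv ℝ α l.1 (Y l).1 (X l).1 - fderiv ℝ α l.1 (X l).1 (Y l).1 := by
  let c := (ContinuousLinearMap.compL ℝ (Cotangent V) V ℝ).flip
    (ContinuousLinearMap.fst ℝ V (V →L[ℝ] ℝ))
  have h1 : HasFDerivAt (fun l : Cotangent V => c (α l.1))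
      (c.comp ((fderiv ℝ α l.1).comp (ContinuousLinearMap.fst ℝ V (V →L[ℝ] ℝ)))) l :=
    HasFDerivAt.comp l (g := c) (f := fun l : Cotangent V => α l.1) c.hasFDerivAt
      (HasFDerivAt.comp l (g := α) hα.hasFDerivAt hasFDerivAt_fst)
  have := apply_lieBracket hX hY h1.differentiableAt hXS hYS hαX hαY
  rw [h1.fderiv] at this
  exact this

/-- Cartan's formula for the Liouville form. -/
theorem liouville_lieBracket {S : Set (Cotangent V)} {l : Cotangent V}
    {X Y : Cotangent V → Cotangent V}
    (hX : DifferentiableAt ℝ X l) (hY : DifferentiableAt ℝ Y l)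
    (hXS : X l ∈ tangent S l) (hYS : Y l ∈ tangent S l)
    (hαX : ∀ᶠ y in 𝓝 l, y ∈ S → y.2 (X y).1 = 0)
    (hαY : ∀ᶠ y in 𝓝 l, y ∈ S → y.2 (Y y).1 = 0) :
    l.2 (VectorField.lieBracket ℝ X Y l).1 = sigma (Y l) (X l) := by
  let c := (ContinuousLinearMap.compL ℝ (Cotangent V) V ℝ).flip
    (ContinuousLinearMap.fst ℝ V (V →L[ℝ] ℝ))
  have h1 : HasFDerivAt (fun l : Cotangent V => c l.2)
      (c.comp (ContinuousLinearMap.snd ℝ V (V →L[ℝ] ℝ))) l :=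
    HasFDerivAt.comp l (g := c) (f := fun l : Cotangent V => l.2) c.hasFDerivAt hasFDerivAt_snd
  have := apply_lieBracket hX hY h1.differentiableAt hXS hYS hαX hαY
  rw [h1.fderiv] at this
  exact this

/-- The tangent space of the annihilator of a smooth frame with smooth dual coframe. -/
theorem mem_tangent_zeros_iff {ι : Type*} [Fintype ι] [DecidableEq ι] {O : Set V} (hO : IsOpen O)
    {F : ι → V → V} {α : ι → V → V →L[ℝ] ℝ} (hF : ∀ i, ContDiffOn ℝ ∞ (F i) O)
    (hα : ∀ i, ContDiffOn ℝ ∞ (α i) O)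
    (hdual : ∀ q ∈ O, ∀ i j, α i q (F j q) = if i = j then 1 else 0)
    {l : Cotangent V} (hl : l.1 ∈ O) (hl0 : ∀ i, quasiImpulse (F i) l = 0) (v : Cotangent V) :
    v ∈ tangent {l : Cotangent V | l.1 ∈ O ∧ ∀ i, quasiImpulse (F i) l = 0} l ↔
      ∀ i, fderiv ℝ (quasiImpulse (F i)) l v = 0 := by
  -- Subtracting the values on the frame by means of the dual coframe retracts onto the annihilator,
  -- without moving the base point.
  let R : Cotangent V → Cotangent V := fun l => (l.1, l.2 - ∑ i, quasiImpulse (F i) l • α i l.1)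
  have hFl : ∀ i, ContDiffAt ℝ ∞ (F i) l.1 := fun i => (hF i).contDiffAt (hO.mem_nhds hl)
  have hαl : ∀ i, ContDiffAt ℝ ∞ (α i) l.1 := fun i => (hα i).contDiffAt (hO.mem_nhds hl)
  have hαl' : ∀ i, ContDiffAt ℝ ∞ (fun l : Cotangent V => α i l.1) l := fun i =>
    ContDiffAt.comp l (hαl i) contDiffAt_fst
  have hq : ∀ i, ContDiffAt ℝ ∞ (quasiImpulse (F i)) l := fun i => contDiffAt_quasiImpulse (hFl i)
  have hR : ContDiffAt ℝ ∞ R l :=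
    contDiffAt_fst.prodMk (contDiffAt_snd.sub (ContDiffAt.sum fun i _ => (hq i).smul (hαl' i)))
  have hO' : ∀ᶠ y : Cotangent V in 𝓝 l, y.1 ∈ O :=
    continuous_fst.continuousAt.eventually_mem (hO.mem_nhds hl)
  rw [mem_tangent_iff_of_retraction (R := R) (by simp [R, hl0]) hR]
  · have hd : fderiv ℝ R l v =
        (v.1, v.2 - ∑ i, fderiv ℝ (quasiImpulse (F i)) l v • α i l.1) := by
      have h1 : ∀ i, HasFDerivAt (fun l : Cotangent V => quasiImpulse (F i) l • α i l.1)
          (quasiImpulse (F i) l • fderiv ℝ (fun l : Cotangent V => α i l.1) l +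
            (fderiv ℝ (quasiImpulse (F i)) l).smulRight (α i l.1)) l := fun i =>
        ((hq i).differentiableAt (by simp)).hasFDerivAt.smul
          ((hαl' i).differentiableAt (by simp)).hasFDerivAt
      have h2 : HasFDerivAt R _ l :=
        hasFDerivAt_fst.prodMk (hasFDerivAt_snd.sub (HasFDerivAt.fun_sum fun i _ => h1 i))
      rw [h2.fderiv]
      simp [hl0]
    rw [hd]
    constructor
    · intro h i
      have h2 := congrArg Prod.snd h
      simp only [sub_eq_self] at h2
      have h3 := congrArg (fun p : V →L[ℝ] ℝ => p (F i l.1)) h2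
      simpa [sum_apply, hdual _ hl] using h3
    · intro h
      simp [h]
  · filter_upwards [hO'] with y hy
    refine ⟨hy, fun j => ?_⟩
    simp only [quasiImpulse, R]
    simp [hdual _ hy]
  · exact Eventually.of_forall fun y hy => by simp [R, hy.2]

end Cotangent

/-! ### The fields `X_1, X_2, X_3` on `J^n × ℝ`, the contact forms, and `(D^2)^⊥`. -/

section Fields

variable {n : ℕ} {Ω : Set (Jet n)} {f : Jet n → ℝ}

/-- The form `dx` on `J^n × ℝ`. -/
def dxForm : JetZ n →L[ℝ] ℝ :=
  (ContinuousLinearMap.fst ℝ ℝ _).comp (ContinuousLinearMap.fst ℝ (Jet n) ℝ)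

/-- The form `dy_i` on `J^n × ℝ`. -/
def dyForm (i : Fin (n + 1)) : JetZ n →L[ℝ] ℝ :=
  (ContinuousLinearMap.proj (R := ℝ) (φ := fun _ : Fin (n + 1) => ℝ) i).comp
    ((ContinuousLinearMap.snd ℝ ℝ _).comp (ContinuousLinearMap.fst ℝ (Jet n) ℝ))

/-- The form `dz` on `J^n × ℝ`. -/
def dzForm : JetZ n →L[ℝ] ℝ := ContinuousLinearMap.snd ℝ (Jet n) ℝ

/-- The vector `∂_{y_i}`. -/
def eY (i : Fin (n + 1)) : JetZ n := ((0, Pi.single i 1), 0)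

/-- The vector `∂_z`. -/
def eZ : JetZ n := (0, 1)

/-- The vector `∂_x`. -/
def eX : JetZ n := ((1, 0), 0)

@[simp] theorem dxForm_apply (v : JetZ n) : dxForm v = v.1.1 := rfl
@[simp] theorem dyForm_apply (i : Fin (n + 1)) (v : JetZ n) : dyForm i v = v.1.2 i := rfl
@[simp] theorem dzForm_apply (v : JetZ n) : dzForm v = v.2 := rfl

theorem sum_smul_single {k : ℕ} (y : Fin k → ℝ) : y = ∑ i, y i • Pi.single i (1 : ℝ) := by
  ext j; simp [Finset.sum_apply, Pi.single_apply]

theorem eq_sum_basis (v : JetZ n) : v = v.1.1 • eX + ∑ i, v.1.2 i • eY i + v.2 • eZ := by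
  refine Prod.ext (Prod.ext ?_ ?_) ?_
  · simp [eX, eY, eZ, Prod.fst_sum]
  · simp only [eX, eY, eZ, Prod.fst_add, Prod.snd_add, Prod.smul_mk, Prod.fst_sum,
      Prod.snd_sum, smul_zero, zero_add, add_zero]
    simpa using sum_smul_single v.1.2
  · simp [eX, eY, eZ, Prod.snd_sum]

theorem covector_ext {p p' : JetZ n →L[ℝ] ℝ} (hx : p eX = p' eX)
    (hy : ∀ i, p (eY i) = p' (eY i)) (hz : p eZ = p' eZ) : p = p' := by
  refine ContinuousLinearMap.ext fun v => ?_
  rw [eq_sum_basis v]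
  simp [hx, hy, hz]

/-- The linear part of `jetShift`. -/
def shiftL {k : ℕ} : Jet k →L[ℝ] Jet k :=
  (0 : Jet k →L[ℝ] ℝ).prod (ContinuousLinearMap.pi fun i : Fin (k + 1) =>
    if h : (i : ℕ) + 1 < k + 1 then
      (ContinuousLinearMap.proj (R := ℝ) (φ := fun _ : Fin (k + 1) => ℝ) ⟨(i : ℕ) + 1, h⟩).comp
        (ContinuousLinearMap.snd ℝ ℝ _)
    else 0)

theorem shiftL_apply {k : ℕ} (v : Jet k) :
    shiftL v = (0, fun i : Fin (k + 1) => if h : (i : ℕ) + 1 < k + 1 then v.2 ⟨(i : ℕ) + 1, h⟩ else 0) := by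
  refine Prod.ext rfl (funext fun i => ?_)
  simp only [shiftL, ContinuousLinearMap.prod_apply, ContinuousLinearMap.pi_apply]
  split_ifs <;> rfl

theorem jetShift_eq {k : ℕ} (j : Jet k) : jetShift j = (1, 0) + shiftL j := by
  rw [shiftL_apply]; simp [jetShift]

theorem hasFDerivAt_jetShift {k : ℕ} (j : Jet k) : HasFDerivAt jetShift (shiftL (k := k)) j := by
  have : (jetShift (k := k)) = fun j => (1, 0) + shiftL j := funext jetShift_eq
  rw [this]
  exact (shiftL (k := k)).hasFDerivAt.const_add _

theorem shiftL_single_succ {k : ℕ} (i : Fin k) :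
    shiftL ((0, Pi.single i.succ 1) : Jet k) = (0, Pi.single i.castSucc 1) := by
  rw [shiftL_apply]
  refine Prod.ext rfl (funext fun j => ?_)
  simp only [Pi.single_apply, Fin.ext_iff, Fin.val_succ, Fin.val_castSucc]
  split_ifs <;> first | rfl | omega

theorem shiftL_single_zero {k : ℕ} :
    shiftL ((0, Pi.single 0 1) : Jet k) = 0 := by
  rw [shiftL_apply]
  refine Prod.ext rfl (funext fun j => ?_)
  dsimp only
  split_ifs with h
  · exact Pi.single_eq_of_ne (fun h0 => absurd (congrArg Fin.val h0) (Nat.succ_ne_zero _)) 1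
  · rfl

theorem jetShift_castSucc {k : ℕ} (j : Jet k) (i : Fin k) :
    (jetShift j).2 i.castSucc = j.2 i.succ := by
  simp [jetShift]; rfl

theorem jetShift_last {k : ℕ} (j : Jet k) : (jetShift j).2 (Fin.last k) = 0 := by
  simp [jetShift]

/-- The vector field `[X_2, X_1] = ∂_{y_{n-1}} + f_{y_n} ∂_z`. -/
def X3 (f : Jet n → ℝ) (q : JetZ n) : JetZ n :=
  (shiftL (0, Pi.single (Fin.last n) 1), pderiv f (Fin.last n) q.1)

/-- The frame `X_1, X_2, X_3` of `D^2`. -/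
def frame (f : Jet n → ℝ) : Fin 3 → JetZ n → JetZ n := ![X1 f, X2, X3 f]

/-- The contact form `θ_j = dy_j - y_{j+1} dx`. -/
def theta (j : Fin n) (q : JetZ n) : JetZ n →L[ℝ] ℝ :=
  dyForm j.castSucc - q.1.2 j.succ • dxForm

theorem theta_apply (j : Fin n) (q v : JetZ n) :
    theta j q v = v.1.2 j.castSucc - q.1.2 j.succ * v.1.1 := rfl

theorem contDiff_theta (j : Fin n) : ContDiff ℝ ∞ (theta j) := by
  have : ContDiff ℝ ∞ (fun q : JetZ n => q.1.2 j.succ) := (dyForm j.succ).contDiff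
  exact contDiff_const.sub (this.smul contDiff_const)

theorem isOpen_domZ (hΩ : IsOpen Ω) : IsOpen (domZ Ω) := hΩ.preimage continuous_fst

theorem contDiffOn_pderiv {k : ℕ} {O : Set (Jet k)} {g : Jet k → ℝ} (hO : IsOpen O)
    (hg : ContDiffOn ℝ ∞ g O) (i : Fin (k + 1)) : ContDiffOn ℝ ∞ (pderiv g i) O :=
  (hg.fderiv_of_isOpen hO (m := ∞) (by simp)).clm_apply contDiffOn_const

theorem contDiffOn_frame (hΩ : IsOpen Ω) (hf : ContDiffOn ℝ ∞ f Ω) (i : Fin 3) :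
    ContDiffOn ℝ ∞ (frame f i) (domZ Ω) := by
  have hm : MapsTo (fun q : JetZ n => q.1) (domZ Ω) Ω := fun q hq => hq
  have hs : ContDiff ℝ ∞ (jetShift (k := n)) := by
    have : (jetShift (k := n)) = fun j => (1, 0) + shiftL j := funext jetShift_eq
    rw [this]; fun_prop
  fin_cases i
  · exact (hs.comp contDiff_fst).contDiffOn.prodMk (hf.comp contDiffOn_fst hm)
  · exact contDiffOn_const
  · exact contDiffOn_const.prodMk ((contDiffOn_pderiv hΩ hf _).comp contDiffOn_fst hm)

theorem differentiableAt_frame (hΩ : IsOpen Ω) (hf : ContDiffOn ℝ ∞ f Ω) (i : Fin 3) {q : JetZ n}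
    (hq : q ∈ domZ Ω) : DifferentiableAt ℝ (frame f i) q :=
  ((contDiffOn_frame hΩ hf i).contDiffAt ((isOpen_domZ hΩ).mem_nhds hq)).differentiableAt
    (by simp)

theorem fderiv_X1 (hΩ : IsOpen Ω) (hf : ContDiffOn ℝ ∞ f Ω) {q : JetZ n}
    (hq : q ∈ domZ Ω) (v : JetZ n) : fderiv ℝ (X1 f) q v = (shiftL v.1, fderiv ℝ f q.1 v.1) := by
  have h1 : HasFDerivAt f (fderiv ℝ f q.1) q.1 :=
    ((hf.contDiffAt (hΩ.mem_nhds hq)).differentiableAt (by simp)).hasFDerivAt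
  have h2 : HasFDerivAt (X1 f) _ q :=
    ((hasFDerivAt_jetShift q.1).comp q hasFDerivAt_fst).prodMk (h1.comp q hasFDerivAt_fst)
  rw [h2.fderiv]; rfl

theorem fderiv_X2 (q v : JetZ n) : fderiv ℝ (X2 (n := n)) q v = 0 := by
  have : (X2 (n := n)) = fun _ => ((0, Pi.single (Fin.last n) 1), 0) := rfl
  rw [this]; simp

theorem fderiv_X3 (hΩ : IsOpen Ω) (hf : ContDiffOn ℝ ∞ f Ω) {q : JetZ n}
    (hq : q ∈ domZ Ω) (v : JetZ n) :
    fderiv ℝ (X3 f) q v = (0, fderiv ℝ (pderiv f (Fin.last n)) q.1 v.1) := by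
  have h1 : HasFDerivAt (pderiv f (Fin.last n)) (fderiv ℝ (pderiv f (Fin.last n)) q.1) q.1 :=
    (((contDiffOn_pderiv hΩ hf _).contDiffAt (hΩ.mem_nhds hq)).differentiableAt
      (by simp)).hasFDerivAt
  have h2 : HasFDerivAt (X3 f) _ q :=
    (hasFDerivAt_const (shiftL (0, Pi.single (Fin.last n) 1) : Jet n) q).prodMk
      (h1.comp q hasFDerivAt_fst)
  rw [h2.fderiv]; rfl

theorem fderiv_X1_X2 (hΩ : IsOpen Ω) (hf : ContDiffOn ℝ ∞ f Ω) {q : JetZ n}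
    (hq : q ∈ domZ Ω) : fderiv ℝ (X1 f) q (X2 q) = X3 f q := by
  rw [fderiv_X1 hΩ hf hq]; rfl

theorem X3_eq (hn : 0 < n) (q : JetZ n) :
    X3 f q = ((0, Pi.single (Fin.castSucc ⟨n - 1, by omega⟩) 1), pderiv f (Fin.last n) q.1) := by
  have h := shiftL_single_succ (⟨n - 1, by omega⟩ : Fin n)
  have h2 : (⟨n - 1, by omega⟩ : Fin n).succ = Fin.last n := by ext; simp; omega
  rw [h2] at h
  simp [X3, h]

theorem theta_X1 (j : Fin n) (q : JetZ n) : theta j q (X1 f q) = 0 := by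
  simp only [theta_apply, X1, jetShift_castSucc]; simp [jetShift]

theorem theta_X2 (j : Fin n) (q : JetZ n) : theta j q (X2 q) = 0 := by
  have : Fin.castSucc j ≠ Fin.last n := (Fin.castSucc_lt_last j).ne
  simp [theta_apply, X2, this]

theorem theta_X3 (hn : 0 < n) (j : Fin n) (q : JetZ n) :
    theta j q (X3 f q) = if (j : ℕ) = n - 1 then 1 else 0 := by
  simp [theta_apply, X3_eq hn, Pi.single_apply, Fin.ext_iff]

/-- A coframe dual to `frame f`. -/
def coframe (hn : 0 < n) : Fin 3 → JetZ n → JetZ n →L[ℝ] ℝ :=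
  ![fun _ => dxForm, fun _ => dyForm (Fin.last n), theta ⟨n - 1, by omega⟩]

theorem contDiff_coframe (hn : 0 < n) (i : Fin 3) : ContDiff ℝ ∞ (coframe hn i) := by
  fin_cases i
  · exact contDiff_const
  · exact contDiff_const
  · exact contDiff_theta _

theorem coframe_frame (hn : 0 < n) (q : JetZ n) (i j : Fin 3) :
    coframe hn i q (frame f j q) = if i = j then 1 else 0 := by
  have h3 : (X3 f q).1.1 = 0 := by rw [X3_eq hn]
  have h4 : (X3 f q).1.2 (Fin.last n) = 0 := by
    rw [X3_eq hn]
    simp only [Pi.single_apply, (Fin.castSucc_lt_last _).ne', if_false]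
  fin_cases i <;> fin_cases j <;>
    simp [coframe, frame, theta_X1, theta_X2, theta_X3 hn, h3, h4] <;>
    simp [X1, X2, jetShift]

/-! ### The square of the distribution and its annihilator -/

theorem X1_mem (q : JetZ n) : X1 f q ∈ lagrDist f q := Submodule.subset_span (by simp)

theorem X2_mem (q : JetZ n) : X2 q ∈ lagrDist f q := Submodule.subset_span (by simp)

theorem eq_of_mem_lagrDist {q v : JetZ n} (hv : v ∈ lagrDist f q) :
    v = v.1.1 • X1 f q + v.1.2 (Fin.last n) • X2 q := by
  obtain ⟨a, b, rfl⟩ := Submodule.mem_span_pair.1 hv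
  simp [X1, X2, jetShift]

/-- The coefficients of a section of `D` are its `dx` and `dy_n` components, hence differentiable
with it. Their derivatives only contribute elements of `D`, and `X_2` is constant, so `dX_1` alone
survives modulo `D`. -/
theorem fderiv_section {X : JetZ n → JetZ n} (hΩ : IsOpen Ω) (hf : ContDiffOn ℝ ∞ f Ω)
    {q : JetZ n} (hq : q ∈ domZ Ω) (hX : DifferentiableAt ℝ X q)
    (hm : ∀ᶠ y in 𝓝 q, X y ∈ lagrDist f y) (v : JetZ n) :
    ∃ u ∈ lagrDist f q, fderiv ℝ X q v = (X q).1.1 • fderiv ℝ (X1 f) q v + u := by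
  have he : X =ᶠ[𝓝 q] fun y => dxForm (X y) • X1 f y + dyForm (Fin.last n) (X y) • X2 y :=
    hm.mono fun y hy => eq_of_mem_lagrDist hy
  have h1 : HasFDerivAt (X1 f) (fderiv ℝ (X1 f) q) q :=
    (differentiableAt_frame hΩ hf 0 hq).hasFDerivAt
  have h2 : HasFDerivAt (X2 (n := n)) (0 : JetZ n →L[ℝ] JetZ n) q := hasFDerivAt_const _ _
  have ha : HasFDerivAt (fun y => dxForm (X y)) (dxForm.comp (fderiv ℝ X q)) q :=
    dxForm.hasFDerivAt.comp q hX.hasFDerivAt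
  have hb : HasFDerivAt (fun y => dyForm (Fin.last n) (X y))
    ((dyForm (Fin.last n)).comp (fderiv ℝ X q)) q :=
    (dyForm (Fin.last n)).hasFDerivAt.comp q hX.hasFDerivAt
  have h := (ha.smul h1).add (hb.smul h2)
  refine ⟨dxForm (fderiv ℝ X q v) • X1 f q + dyForm (Fin.last n) (fderiv ℝ X q v) • X2 q,
    add_mem (Submodule.smul_mem _ _ (X1_mem q)) (Submodule.smul_mem _ _ (X2_mem q)), ?_⟩
  have h' : fderiv ℝ X q = _ := he.fderiv_eq.trans h.fderiv
  conv_lhs => rw [h']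
  simp [add_assoc]

theorem lieBracket_apply {V : Type*} [NormedAddCommGroup V] [NormedSpace ℝ V] (X Y : V → V)
    (x : V) : VectorField.lieBracket ℝ X Y x = fderiv ℝ Y x (X x) - fderiv ℝ X x (Y x) := rfl

theorem mem_bracketDist {V : Type*} [NormedAddCommGroup V] [NormedSpace ℝ V]
    {N : Set V} {A B : V → Submodule ℝ V} {x : V} {U : Set V} {X Y : V → V}
    (hU : IsOpen U) (hx : x ∈ U) (hX : ContDiffOn ℝ ∞ X U) (hY : ContDiffOn ℝ ∞ Y U)
    (h : ∀ y ∈ U ∩ N, X y ∈ A y ∧ Y y ∈ B y) :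
    VectorField.lieBracket ℝ X Y x ∈ bracketDist N A B x :=
  Submodule.subset_span ⟨U, X, Y, hU, hx, hX, hY, h, rfl⟩

/-- Modulo `D`, the bracket of two sections is `X_3` times the determinant of their coefficients,
because the terms `dX_1(X_1)` cancel. -/
theorem derivedFlag_two (hΩ : IsOpen Ω) (hf : ContDiffOn ℝ ∞ f Ω) {q : JetZ n}
    (hq : q ∈ domZ Ω) :
    derivedFlag (domZ Ω) (lagrDist f) 2 q =
      Submodule.span ℝ (range fun i => frame f i q) := by
  have hO := isOpen_domZ hΩ
  have hmem : ∀ i, frame f i q ∈ Submodule.span ℝ (range fun i => frame f i q) := fun i =>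
    Submodule.subset_span ⟨i, rfl⟩
  have hle : lagrDist f q ≤ Submodule.span ℝ (range fun i => frame f i q) := by
    refine Submodule.span_le.2 ?_
    rintro v (rfl | rfl)
    · exact hmem 0
    · exact hmem 1
  change lagrDist f q ⊔ bracketDist _ (lagrDist f) (lagrDist f) q = _
  refine le_antisymm (sup_le hle (Submodule.span_le.2 ?_)) (Submodule.span_le.2 ?_)
  · rintro w ⟨U, X, Y, hU, hxU, hX, hY, hm, rfl⟩
    have hUn := (hU.inter hO).mem_nhds ⟨hxU, hq⟩
    obtain ⟨u, hu, h1⟩ := fderiv_section hΩ hf hq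
      ((hX.contDiffAt (hU.mem_nhds hxU)).differentiableAt (by simp))
      (Filter.mem_of_superset hUn fun y hy => (hm y hy).1) (Y q)
    obtain ⟨u', hu', h2⟩ := fderiv_section hΩ hf hq
      ((hY.contDiffAt (hU.mem_nhds hxU)).differentiableAt (by simp))
      (Filter.mem_of_superset hUn fun y hy => (hm y hy).2) (X q)
    rw [SetLike.mem_coe, lieBracket_apply, h1, h2]
    have e1 := eq_of_mem_lagrDist (hm q ⟨hxU, hq⟩).1
    have e2 := eq_of_mem_lagrDist (hm q ⟨hxU, hq⟩).2
    have e1' := congrArg (fderiv ℝ (X1 f) q) e1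
    have e2' := congrArg (fderiv ℝ (X1 f) q) e2
    simp only [map_add, map_smul, fderiv_X1_X2 hΩ hf hq] at e1' e2'
    rw [e1', e2']
    have : (Y q).1.1 • ((X q).1.1 • fderiv ℝ (X1 f) q (X1 f q) +
        (X q).1.2 (Fin.last n) • X3 f q) + u' -
        ((X q).1.1 • ((Y q).1.1 • fderiv ℝ (X1 f) q (X1 f q) +
        (Y q).1.2 (Fin.last n) • X3 f q) + u) =
        ((Y q).1.1 * (X q).1.2 (Fin.last n) - (X q).1.1 * (Y q).1.2 (Fin.last n)) • X3 f q +
          u' - u := by module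
    rw [this]
    exact sub_mem (add_mem (Submodule.smul_mem _ _ (hmem 2)) (hle hu')) (hle hu)
  · rintro v ⟨i, rfl⟩
    fin_cases i
    · exact Submodule.mem_sup_left (X1_mem q)
    · exact Submodule.mem_sup_left (X2_mem q)
    · refine Submodule.mem_sup_right ?_
      have := mem_bracketDist (N := domZ Ω) (A := lagrDist f) (B := lagrDist f) hO hq
        (contDiffOn_frame hΩ hf 1) (contDiffOn_frame hΩ hf 0)
        (fun y _ => ⟨X2_mem y, X1_mem y⟩)
      rw [lieBracket_apply] at this
      simpa [frame, fderiv_X2, fderiv_X1_X2 hΩ hf hq] using this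

theorem D2perp_eq (hΩ : IsOpen Ω) (hf : ContDiffOn ℝ ∞ f Ω) :
    D2perp (domZ Ω) (lagrDist f) =
      {l : Cotangent (JetZ n) | l.1 ∈ domZ Ω ∧ ∀ i, quasiImpulse (frame f i) l = 0} := by
  ext l
  refine and_congr_right fun hl => ?_
  rw [derivedFlag_two hΩ hf hl]
  constructor
  · exact fun h i => h _ (Submodule.subset_span ⟨i, rfl⟩)
  · intro h v hv
    induction hv using Submodule.span_induction with
    | mem v hv => obtain ⟨i, rfl⟩ := hv; exact h i
    | zero => simp
    | add a b _ _ ha hb => simp [ha, hb]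
    | smul c a _ ha => simp [ha]

theorem mem_tangent_D2perp (hn : 0 < n) (hΩ : IsOpen Ω) (hf : ContDiffOn ℝ ∞ f Ω)
    {l : Cotangent (JetZ n)} (hl : l ∈ D2perp (domZ Ω) (lagrDist f)) (v : Cotangent (JetZ n)) :
    v ∈ tangent (D2perp (domZ Ω) (lagrDist f)) l ↔
      ∀ i, fderiv ℝ (quasiImpulse (frame f i)) l v = 0 := by
  rw [D2perp_eq hΩ hf] at hl ⊢
  exact mem_tangent_zeros_iff (isOpen_domZ hΩ) (contDiffOn_frame hΩ hf)
    (fun i => (contDiff_coframe hn i).contDiffOn) (fun q _ => coframe_frame hn q) hl.1 hl.2 v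

/-- The points of `(D^2)^⊥` off the hyperplane `ν = 0`. -/
theorem mem_regPart (hΩ : IsOpen Ω) (hf : ContDiffOn ℝ ∞ f Ω)
    (hnd : ∀ j ∈ Ω, pderiv (pderiv f (Fin.last n)) (Fin.last n) j ≠ 0)
    {l : Cotangent (JetZ n)} (hl : l ∈ D2perp (domZ Ω) (lagrDist f)) (hν : l.2 eZ ≠ 0) :
    l ∈ regPart (domZ Ω) (lagrDist f) := by
  refine ⟨hl, fun h3 => ?_⟩
  have hO := isOpen_domZ hΩ
  have hq : l.1 ∈ domZ Ω := hl.1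
  -- The bracket `[X_2, X_3] = f_{y_n y_n} ∂_z` lies in `D^3`, and a covector with `ν ≠ 0` does not
  -- annihilate it.
  have h := h3.2 (VectorField.lieBracket ℝ X2 (X3 f) l.1) (Submodule.mem_sup_right
    (mem_bracketDist hO hq (contDiffOn_frame hΩ hf 1) (contDiffOn_frame hΩ hf 2)
      fun y hy => ⟨X2_mem y, by
        rw [derivedFlag_two hΩ hf hy.2]
        exact Submodule.subset_span ⟨2, rfl⟩⟩))
  rw [lieBracket_apply, fderiv_X2, fderiv_X3 hΩ hf hq, sub_zero] at h
  have h2 : ((0, fderiv ℝ (pderiv f (Fin.last n)) l.1.1 (X2 l.1).1) : JetZ n) =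
      pderiv (pderiv f (Fin.last n)) (Fin.last n) l.1.1 • eZ := by
    simp [eZ, pderiv, X2]
  rw [h2, map_smul, smul_eq_mul] at h
  exact (mul_ne_zero (hnd _ hq) hν) h

end Fields

/-! ### Equations for the characteristic line and for the nonnegative part of the Jacobi flag. -/

section Jacobi

variable {n : ℕ} {Ω : Set (Jet n)} {f : Jet n → ℝ}

/-! ### The characteristic distribution -/

theorem sigma_hamVec_frame (hΩ : IsOpen Ω) (hf : ContDiffOn ℝ ∞ f Ω)
    {l : Cotangent (JetZ n)} (hl : l ∈ D2perp (domZ Ω) (lagrDist f)) (i : Fin 3)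
    (w : Cotangent (JetZ n)) :
    sigma (hamVec (frame f i) l) w = -fderiv ℝ (quasiImpulse (frame f i)) l w := by
  rw [sigma_swap, sigma_hamVec (differentiableAt_frame hΩ hf i hl.1)]

theorem apply_frame (hΩ : IsOpen Ω) (hf : ContDiffOn ℝ ∞ f Ω)
    {l : Cotangent (JetZ n)} (hl : l ∈ D2perp (domZ Ω) (lagrDist f)) (i : Fin 3) :
    l.2 (frame f i l.1) = 0 := by
  rw [D2perp_eq hΩ hf] at hl
  exact hl.2 i

/-- The quasi-impulse of `[X_2, X_3] = f_{y_n y_n} ∂_z`. -/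
theorem apply_fderiv_X3_X2 (hΩ : IsOpen Ω) (hf : ContDiffOn ℝ ∞ f Ω) {l : Cotangent (JetZ n)}
    (hl : l.1 ∈ domZ Ω) :
    l.2 (fderiv ℝ (X3 f) l.1 (X2 l.1)) =
      pderiv (pderiv f (Fin.last n)) (Fin.last n) l.1.1 * l.2 eZ := by
  rw [fderiv_X3 hΩ hf hl]
  have h2 : ((0, fderiv ℝ (pderiv f (Fin.last n)) l.1.1 (X2 l.1).1) : JetZ n) =
      pderiv (pderiv f (Fin.last n)) (Fin.last n) l.1.1 • eZ := by
    simp [eZ, pderiv, X2]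
  rw [h2, map_smul, smul_eq_mul]

theorem fderiv_quasiImpulse_hamVec (hΩ : IsOpen Ω) (hf : ContDiffOn ℝ ∞ f Ω)
    {l : Cotangent (JetZ n)} (hl : l.1 ∈ domZ Ω) (i j : Fin 3) :
    fderiv ℝ (quasiImpulse (frame f j)) l (hamVec (frame f i) l) =
      l.2 (fderiv ℝ (frame f j) l.1 (frame f i l.1)) -
        l.2 (fderiv ℝ (frame f i) l.1 (frame f j l.1)) := by
  rw [fderiv_quasiImpulse (differentiableAt_frame hΩ hf j hl)]
  simp [hamVec]; ring

/-- The skew complement of the tangent space is spanned by the three Hamiltonian vectors of the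
frame. Tangency to `H_{X_2} = 0` removes the third one, since its coefficient is multiplied by `-
f_{y_n y_n} ν ≠ 0`. -/
theorem mem_charDist_iff (hn : 0 < n) (hΩ : IsOpen Ω) (hf : ContDiffOn ℝ ∞ f Ω)
    (hnd : ∀ j ∈ Ω, pderiv (pderiv f (Fin.last n)) (Fin.last n) j ≠ 0)
    {l : Cotangent (JetZ n)} (hl : l ∈ D2perp (domZ Ω) (lagrDist f)) (hν : l.2 eZ ≠ 0)
    (v : Cotangent (JetZ n)) :
    v ∈ charDist (domZ Ω) (lagrDist f) l ↔
      (∀ i, fderiv ℝ (quasiImpulse (frame f i)) l v = 0) ∧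
        ∃ a b : ℝ, v = a • hamVec (X1 f) l + b • hamVec X2 l := by
  have hs := sigma_hamVec_frame hΩ hf hl
  constructor
  · rintro ⟨hv, hv'⟩
    rw [mem_tangent_D2perp hn hΩ hf hl] at hv
    refine ⟨hv, ?_⟩
    have hsp : v ∈ Submodule.span ℝ (range fun i => hamVec (frame f i) l) := by
      refine mem_span_of_sigma_eq_zero fun w hw => hv' w ?_
      rw [mem_tangent_D2perp hn hΩ hf hl]
      exact fun i => by simpa [hs] using hw i
    obtain ⟨c, rfl⟩ := (Submodule.mem_span_range_iff_exists_fun ℝ).1 hsp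
    have h1 := hv 1
    simp only [Fin.sum_univ_three, map_add, map_smul,
      fderiv_quasiImpulse_hamVec hΩ hf hl.1] at h1
    simp only [frame, Matrix.cons_val_zero, Matrix.cons_val_one, Matrix.cons_val,
      fderiv_X1_X2 hΩ hf hl.1, fderiv_X2, apply_fderiv_X3_X2 hΩ hf hl.1] at h1
    have h3 : l.2 (X3 f l.1) = 0 := apply_frame hΩ hf hl 2
    simp only [h3, map_zero, sub_self, mul_zero, zero_add, zero_sub, mul_neg, neg_eq_zero,
      smul_eq_mul, mul_eq_zero, hnd _ hl.1, hν, or_false] at h1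
    exact ⟨c 0, c 1, by simp [Fin.sum_univ_three, h1, frame]⟩
  · rintro ⟨hv, a, b, hab⟩
    refine ⟨(mem_tangent_D2perp hn hΩ hf hl v).2 hv, fun w hw => ?_⟩
    rw [mem_tangent_D2perp hn hΩ hf hl] at hw
    have h0 := hs 0 w
    have h1 := hs 1 w
    rw [hw] at h0 h1
    have h0' : sigma (hamVec (X1 f) l) w = 0 := by simpa [frame] using h0
    have h1' : sigma (hamVec X2 l) w = 0 := by simpa [frame] using h1
    rw [hab, sigma_add_left, sigma_smul_left, sigma_smul_left, h0', h1']
    simp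

theorem hamVec_fst (X : JetZ n → JetZ n) (l : Cotangent (JetZ n)) : (hamVec X l).1 = X l.1 := rfl

/-- The `x`-component is the coefficient of `hamVec X_1`; when it is zero, tangency to `H_{X_3} = 0`
also kills the coefficient of `hamVec X_2`. So a characteristic vector is determined by its
`x`-component. -/
theorem eq_zero_of_mem_charDist (hn : 0 < n) (hΩ : IsOpen Ω) (hf : ContDiffOn ℝ ∞ f Ω)
    (hnd : ∀ j ∈ Ω, pderiv (pderiv f (Fin.last n)) (Fin.last n) j ≠ 0)
    {l : Cotangent (JetZ n)} (hl : l ∈ D2perp (domZ Ω) (lagrDist f)) (hν : l.2 eZ ≠ 0)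
    {v : Cotangent (JetZ n)} (hv : v ∈ charDist (domZ Ω) (lagrDist f) l) (hx : v.1.1.1 = 0) :
    v = 0 := by
  obtain ⟨hd, a, b, rfl⟩ := (mem_charDist_iff hn hΩ hf hnd hl hν v).1 hv
  have ha : a = 0 := by
    simpa [hamVec, X1, X2, jetShift] using hx
  subst ha
  have h1 := hd 2
  rw [zero_smul, zero_add, map_smul] at h1
  have h2 := fderiv_quasiImpulse_hamVec hΩ hf hl.1 1 2
  simp only [frame, Matrix.cons_val_one, Matrix.cons_val, Matrix.cons_val_zero,
    apply_fderiv_X3_X2 hΩ hf hl.1, fderiv_X2, map_zero, sub_zero] at h2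
  simp only [frame, Matrix.cons_val, h2, smul_eq_mul, mul_eq_zero, hnd _ hl.1, hν, or_false] at h1
  simp [h1]

/-- A nonvanishing section of the characteristic distribution. -/
def charVec (f : Jet n → ℝ) (l : Cotangent (JetZ n)) : Cotangent (JetZ n) :=
  fderiv ℝ (quasiImpulse (frame f 2)) l (hamVec (frame f 1) l) • hamVec (frame f 0) l -
    fderiv ℝ (quasiImpulse (frame f 2)) l (hamVec (frame f 0) l) • hamVec (frame f 1) l

theorem charVec_x (hΩ : IsOpen Ω) (hf : ContDiffOn ℝ ∞ f Ω) {l : Cotangent (JetZ n)}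
    (hl : l.1 ∈ domZ Ω) :
    (charVec f l).1.1.1 = pderiv (pderiv f (Fin.last n)) (Fin.last n) l.1.1 * l.2 eZ := by
  have h2 := fderiv_quasiImpulse_hamVec hΩ hf hl 1 2
  rw [charVec, h2]
  simpa [frame, fderiv_X2, hamVec, X1, X2, jetShift] using apply_fderiv_X3_X2 hΩ hf hl

/-- The two coefficients are chosen so that the derivative of `H_{X_3}` cancels. The derivatives of
`H_{X_1}` and `H_{X_2}` are multiples of `H_{X_3}`, which is zero here. -/
theorem charVec_mem (hn : 0 < n) (hΩ : IsOpen Ω) (hf : ContDiffOn ℝ ∞ f Ω)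
    (hnd : ∀ j ∈ Ω, pderiv (pderiv f (Fin.last n)) (Fin.last n) j ≠ 0)
    {l : Cotangent (JetZ n)} (hl : l ∈ D2perp (domZ Ω) (lagrDist f)) (hν : l.2 eZ ≠ 0) :
    charVec f l ∈ charDist (domZ Ω) (lagrDist f) l := by
  rw [mem_charDist_iff hn hΩ hf hnd hl hν]
  refine ⟨fun i => ?_, fderiv ℝ (quasiImpulse (frame f 2)) l (hamVec (frame f 1) l),
    -fderiv ℝ (quasiImpulse (frame f 2)) l (hamVec (frame f 0) l), by
      have : charVec f l =
        fderiv ℝ (quasiImpulse (frame f 2)) l (hamVec (frame f 1) l) • hamVec (X1 f) l -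
        fderiv ℝ (quasiImpulse (frame f 2)) l (hamVec (frame f 0) l) • hamVec X2 l := rfl
      rw [this]; module⟩
  have h3 : l.2 (X3 f l.1) = 0 := apply_frame hΩ hf hl 2
  rw [charVec, map_sub, map_smul, map_smul, smul_eq_mul, smul_eq_mul]
  fin_cases i
  · simp only [Fin.zero_eta, fderiv_quasiImpulse_hamVec hΩ hf hl.1]
    simp [frame, fderiv_X2, fderiv_X1_X2 hΩ hf hl.1, h3]
  · simp only [Fin.mk_one, fderiv_quasiImpulse_hamVec hΩ hf hl.1]
    simp [frame, fderiv_X2, fderiv_X1_X2 hΩ hf hl.1, h3]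
  · simp only [Fin.reduceFinMk]; ring

/-! ### The Jacobi flag -/

theorem charDist_props (hn : 0 < n) (hΩ : IsOpen Ω) (hf : ContDiffOn ℝ ∞ f Ω)
    (hnd : ∀ j ∈ Ω, pderiv (pderiv f (Fin.last n)) (Fin.last n) j ≠ 0)
    {l : Cotangent (JetZ n)} (hl : l ∈ D2perp (domZ Ω) (lagrDist f)) (hν : l.2 eZ ≠ 0)
    {v : Cotangent (JetZ n)} (hv : v ∈ charDist (domZ Ω) (lagrDist f) l) :
    l.2 v.1 = 0 ∧ ∀ j, theta j l.1 v.1 = 0 := by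
  obtain ⟨-, a, b, rfl⟩ := (mem_charDist_iff hn hΩ hf hnd hl hν v).1 hv
  have h1 : l.2 (X1 f l.1) = 0 := apply_frame hΩ hf hl 0
  have h2 : l.2 (X2 l.1) = 0 := apply_frame hΩ hf hl 1
  refine ⟨by simp [hamVec_fst, h1, h2], fun j => ?_⟩
  simp only [Prod.fst_add, Prod.smul_fst, hamVec_fst, map_add, map_smul, theta_X1, theta_X2]
  simp

/-- The forms `θ_j` cut out `D ⊕ ⟨∂_z⟩`, and the covector itself, which kills `D` but not `∂_z`,
removes `∂_z`. Membership thus becomes a system of one-forms, to which Cartan's formula applies. -/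
theorem mem_jacobiZero_iff (hΩ : IsOpen Ω) (hf : ContDiffOn ℝ ∞ f Ω)
    {l : Cotangent (JetZ n)} (hl : l ∈ D2perp (domZ Ω) (lagrDist f)) (hν : l.2 eZ ≠ 0)
    (v : Cotangent (JetZ n)) :
    v ∈ jacobiZero (domZ Ω) (lagrDist f) l ↔
      v ∈ tangent (D2perp (domZ Ω) (lagrDist f)) l ∧ l.2 v.1 = 0 ∧
        ∀ j, theta j l.1 v.1 = 0 := by
  have h1 : l.2 (X1 f l.1) = 0 := apply_frame hΩ hf hl 0
  have h2 : l.2 (X2 l.1) = 0 := apply_frame hΩ hf hl 1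
  refine and_congr_right fun _ => ?_
  change v.1 ∈ lagrDist f l.1 ↔ _
  constructor
  · intro h
    rw [eq_of_mem_lagrDist h]
    refine ⟨by simp [h1, h2], fun j => ?_⟩
    simp only [map_add, map_smul, theta_X1, theta_X2]
    simp
  · rintro ⟨hs, hθ⟩
    have hu : v.1 - v.1.1.1 • X1 f l.1 - v.1.1.2 (Fin.last n) • X2 l.1 =
        (v.1.2 - v.1.1.1 * f l.1.1) • eZ := by
      refine Prod.ext (Prod.ext ?_ (funext fun i => ?_)) ?_
      · simp [X1, X2, eZ, jetShift]
      · refine Fin.lastCases ?_ (fun i => ?_) i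
        · simp [X1, X2, eZ, jetShift_last]
        · have := hθ i
          rw [theta_apply] at this
          have hne : Fin.castSucc i ≠ Fin.last n := (Fin.castSucc_lt_last i).ne
          simp only [X1, X2, eZ, Prod.fst_sub, Prod.snd_sub, Prod.smul_mk, Prod.smul_snd,
            Pi.sub_apply, Pi.smul_apply, jetShift_castSucc, Pi.single_apply, hne, if_false,
            smul_eq_mul, Prod.snd_zero, Pi.zero_apply]
          linarith
      · simp [X1, X2, eZ]
    have hz := congrArg l.2 hu
    simp only [map_sub, map_smul, hs, h1, h2, mul_zero, sub_zero, smul_eq_mul] at hz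
    have hz' := (mul_eq_zero.1 hz.symm).resolve_right hν
    rw [hz', zero_smul, sub_sub, sub_eq_zero] at hu
    rw [hu]
    exact add_mem (Submodule.smul_mem _ _ (X1_mem _)) (Submodule.smul_mem _ _ (X2_mem _))

/-- The lift of `ν ∂_{y_m} - ξ_m ∂_z` to a vector field tangent to `(D^2)^⊥`. -/
def liftVec (hn : 0 < n) (f : Jet n → ℝ) (m : Fin (n + 1)) (l : Cotangent (JetZ n)) :
    Cotangent (JetZ n) :=
  (l.2 eZ • eY m - l.2 (eY m) • eZ,
    -∑ k, fderiv ℝ (quasiImpulse (frame f k)) l (l.2 eZ • eY m - l.2 (eY m) • eZ, 0) •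
      coframe hn k l.1)

theorem contDiffAt_frame (hΩ : IsOpen Ω) (hf : ContDiffOn ℝ ∞ f Ω) (i : Fin 3) {q : JetZ n}
    (hq : q ∈ domZ Ω) : ContDiffAt ℝ ∞ (frame f i) q :=
  (contDiffOn_frame hΩ hf i).contDiffAt ((isOpen_domZ hΩ).mem_nhds hq)

theorem contDiffAt_charVec (hΩ : IsOpen Ω) (hf : ContDiffOn ℝ ∞ f Ω) {l : Cotangent (JetZ n)}
    (hl : l.1 ∈ domZ Ω) : ContDiffAt ℝ ∞ (charVec f) l := by
  have hF := fun i => contDiffAt_frame hΩ hf i hl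
  have h1 := fun i => contDiffAt_hamVec (hF i)
  have h2 := fun i => (contDiffAt_quasiImpulse (hF i)).fderiv_right (m := ∞) (by simp)
  exact (((h2 2).clm_apply (h1 1)).smul (h1 0)).sub (((h2 2).clm_apply (h1 0)).smul (h1 1))

theorem contDiffAt_liftVec (hn : 0 < n) (hΩ : IsOpen Ω) (hf : ContDiffOn ℝ ∞ f Ω)
    (m : Fin (n + 1)) {l : Cotangent (JetZ n)}
    (hl : l.1 ∈ domZ Ω) : ContDiffAt ℝ ∞ (liftVec hn f m) l := by
  have hF := fun i => contDiffAt_frame hΩ hf i hl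
  have h2 := fun i => (contDiffAt_quasiImpulse (hF i)).fderiv_right (m := ∞) (by simp)
  have h3 : ContDiffAt ℝ ∞ (fun l : Cotangent (JetZ n) => l.2 eZ • eY m - l.2 (eY m) • eZ) l := by
    fun_prop
  refine h3.prodMk (ContDiffAt.neg (ContDiffAt.sum fun k _ => ?_))
  exact ((h2 k).clm_apply (h3.prodMk contDiffAt_const)).smul
    (((contDiff_coframe hn k).contDiffAt).comp l contDiffAt_fst)

theorem liftVec_mem_tangent (hn : 0 < n) (hΩ : IsOpen Ω) (hf : ContDiffOn ℝ ∞ f Ω)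
    (m : Fin (n + 1)) {l : Cotangent (JetZ n)} (hl : l ∈ D2perp (domZ Ω) (lagrDist f)) :
    liftVec hn f m l ∈ tangent (D2perp (domZ Ω) (lagrDist f)) l := by
  rw [mem_tangent_D2perp hn hΩ hf hl]
  intro i
  have hd := differentiableAt_frame hΩ hf i hl.1
  rw [fderiv_quasiImpulse hd]
  simp only [liftVec, neg_apply, sum_apply, smul_apply, coframe_frame, smul_eq_mul, mul_ite,
    mul_one, mul_zero, Finset.sum_ite_eq', Finset.mem_univ, if_true]
  rw [fderiv_quasiImpulse hd]
  simp

theorem theta_eY (j : Fin n) (m : Fin (n + 1)) (q : JetZ n) :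
    theta j q (eY m) = if m = j.castSucc then 1 else 0 := by
  simp [theta_apply, eY, Pi.single_apply, eq_comm]

theorem theta_eZ (j : Fin n) (q : JetZ n) : theta j q eZ = 0 := by
  simp [theta_apply, eZ]

theorem hasFDerivAt_theta (j : Fin n) (q : JetZ n) :
    HasFDerivAt (theta j) (-(dyForm j.succ).smulRight (dxForm (n := n))) q := by
  have h1 : HasFDerivAt (fun q : JetZ n => dyForm j.succ q) (dyForm j.succ) q :=
    (dyForm j.succ).hasFDerivAt
  exact (h1.smul_const (dxForm (n := n))).const_sub (dyForm j.castSucc)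

/-- Each bracket with `𝓒` drops the contact form of highest remaining index. By Cartan's formula
`θ_j([X, Y])` only involves the `dx` and `dy_{j+1}` components, because `dθ_j = dx ∧ dy_{j+1}`; it
vanishes as soon as `θ_{j+1}` kills both fields. Conversely one explicit bracket leaves the old
space, which has codimension one in the new one. -/
theorem mem_jacobiPos_iff (hn : 0 < n) (hΩ : IsOpen Ω) (hf : ContDiffOn ℝ ∞ f Ω)
    (hnd : ∀ j ∈ Ω, pderiv (pderiv f (Fin.last n)) (Fin.last n) j ≠ 0) (i : ℕ) (hi : i < n)
    {l : Cotangent (JetZ n)} (hl : l ∈ D2perp (domZ Ω) (lagrDist f)) (hν : l.2 eZ ≠ 0)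
    (v : Cotangent (JetZ n)) :
    v ∈ jacobiPos (domZ Ω) (lagrDist f) i l ↔
      v ∈ tangent (D2perp (domZ Ω) (lagrDist f)) l ∧ l.2 v.1 = 0 ∧
        ∀ j : Fin n, (j : ℕ) + i < n → theta j l.1 v.1 = 0 := by
  induction i generalizing l v with
  | zero =>
    rw [jacobiPos, mem_jacobiZero_iff hΩ hf hl hν]
    simp
  | succ i ih =>
    have hi' : i < n := by omega
    have hνev : ∀ᶠ y : Cotangent (JetZ n) in 𝓝 l, y.2 eZ ≠ 0 := by
      have : ContinuousAt (fun y : Cotangent (JetZ n) => y.2 eZ) l := by fun_prop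
      exact this.eventually_ne hν
    -- the brackets of sections satisfy the equations of the next space
    have hbr : ∀ {U : Set (Cotangent (JetZ n))} {X Y : Cotangent (JetZ n) → Cotangent (JetZ n)},
        IsOpen U → l ∈ U → ContDiffOn ℝ ∞ X U → ContDiffOn ℝ ∞ Y U →
        (∀ y ∈ U ∩ regPart (domZ Ω) (lagrDist f), X y ∈ charDist (domZ Ω) (lagrDist f) y ∧
          Y y ∈ jacobiPos (domZ Ω) (lagrDist f) i y) →
        VectorField.lieBracket ℝ X Y l ∈ tangent (D2perp (domZ Ω) (lagrDist f)) l ∧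
        l.2 (VectorField.lieBracket ℝ X Y l).1 = 0 ∧
        ∀ j : Fin n, (j : ℕ) + i < n → theta j l.1 (VectorField.lieBracket ℝ X Y l).1 =
          (X l).1.1.2 j.succ * (Y l).1.1.1 - (Y l).1.1.2 j.succ * (X l).1.1.1 := by
      intro U X Y hU hlU hX hY hm
      have hX' := (hX.contDiffAt (hU.mem_nhds hlU)).differentiableAt (by simp)
      have hY' := (hY.contDiffAt (hU.mem_nhds hlU)).differentiableAt (by simp)
      have hm' : ∀ᶠ y in 𝓝 l, y ∈ D2perp (domZ Ω) (lagrDist f) → y.2 eZ ≠ 0 ∧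
          X y ∈ charDist (domZ Ω) (lagrDist f) y ∧
          Y y ∈ jacobiPos (domZ Ω) (lagrDist f) i y := by
        filter_upwards [hνev, hU.mem_nhds hlU] with y h1 h2 h3
        exact ⟨h1, hm y ⟨h2, mem_regPart hΩ hf hnd h3 h1⟩⟩
      have hl' := hm'.self_of_nhds hl
      have hXS : X l ∈ tangent (D2perp (domZ Ω) (lagrDist f)) l := hl'.2.1.1
      have hYS := ((ih hi' hl hν _).1 hl'.2.2).1
      refine ⟨?_, ?_, fun j hj => ?_⟩
      · rw [mem_tangent_D2perp hn hΩ hf hl]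
        intro k
        have hq := contDiffAt_quasiImpulse (contDiffAt_frame hΩ hf k hl.1)
        have hα := (hq.fderiv_right (m := ∞) (by simp)).differentiableAt (by simp)
        rw [apply_lieBracket hX' hY' hα hXS hYS
          (hm'.mono fun y h hy =>
            (mem_tangent_D2perp hn hΩ hf hy _).1 (h hy).2.1.1 k)
          (hm'.mono fun y h hy =>
            (mem_tangent_D2perp hn hΩ hf hy _).1 ((ih hi' hy (h hy).1 _).1 (h hy).2.2).1 k)]
        exact sub_eq_zero.2 (((contDiffAt_infty.1 hq 2).isSymmSndFDerivAt (by simp)).eq _ _)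
      -- Brackets with `𝓒` stay in `ker 𝔰` because `𝓒` is `σ`-orthogonal to every tangent vector.
      · rw [liouville_lieBracket hX' hY' hXS hYS
          (hm'.mono fun y h hy => (charDist_props hn hΩ hf hnd hy (h hy).1 (h hy).2.1).1)
          (hm'.mono fun y h hy => ((ih hi' hy (h hy).1 _).1 (h hy).2.2).2.1),
          sigma_swap, hl'.2.1.2 _ hYS, neg_zero]
      · have hα := hasFDerivAt_theta j l.1
        rw [apply_lieBracket_fst hX' hY' hα.differentiableAt hXS hYS
          (hm'.mono fun y h hy => (charDist_props hn hΩ hf hnd hy (h hy).1 (h hy).2.1).2 j)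
          (hm'.mono fun y h hy => ((ih hi' hy (h hy).1 _).1 (h hy).2.2).2.2 j hj), hα.fderiv]
        simp only [neg_apply, ContinuousLinearMap.smulRight_apply, smul_apply, dyForm_apply,
          dxForm_apply, smul_eq_mul]
        ring
    have hfwd : ∀ w, w ∈ jacobiPos (domZ Ω) (lagrDist f) i l ⊔
        bracketDist (regPart (domZ Ω) (lagrDist f)) (charDist (domZ Ω) (lagrDist f))
          (jacobiPos (domZ Ω) (lagrDist f) i) l →
        w ∈ tangent (D2perp (domZ Ω) (lagrDist f)) l ∧ l.2 w.1 = 0 ∧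
        ∀ j : Fin n, (j : ℕ) + (i + 1) < n → theta j l.1 w.1 = 0 := by
      let W : Submodule ℝ (Cotangent (JetZ n)) :=
        { carrier := {w | w ∈ tangent (D2perp (domZ Ω) (lagrDist f)) l ∧ l.2 w.1 = 0 ∧
            ∀ j : Fin n, (j : ℕ) + (i + 1) < n → theta j l.1 w.1 = 0}
          zero_mem' := ⟨zero_mem _, by simp, by simp⟩
          add_mem' := fun {a b} ha hb => ⟨add_mem ha.1 hb.1, by simp [ha.2.1, hb.2.1],
            fun j hj => by simp [ha.2.2 j hj, hb.2.2 j hj]⟩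
          smul_mem' := fun c a ha => ⟨Submodule.smul_mem _ c ha.1, by simp [ha.2.1],
            fun j hj => by simp [ha.2.2 j hj]⟩ }
      change _ ≤ W
      refine sup_le (fun w hw => ?_) (Submodule.span_le.2 ?_)
      · have := (ih hi' hl hν w).1 hw
        exact ⟨this.1, this.2.1, fun j hj => this.2.2 j (by omega)⟩
      · rintro w ⟨U, X, Y, hU, hlU, hX, hY, hm, rfl⟩
        obtain ⟨h1, h2, h3⟩ := hbr hU hlU hX hY hm
        refine ⟨h1, h2, fun j hj => ?_⟩
        rw [h3 j (by omega)]
        have hr := hm l ⟨hlU, mem_regPart hΩ hf hnd hl hν⟩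
        -- Since `θ_{j+1}` kills `X` and `Y`, each `dy_{j+1}` component is the same multiple
        -- `y_{j+2}` of the `dx` component, and the determinant vanishes.
        have hXθ := (charDist_props hn hΩ hf hnd hl hν hr.1).2 ⟨j + 1, by omega⟩
        have hYθ := ((ih hi' hl hν _).1 hr.2).2.2 ⟨j + 1, by omega⟩ (by simp; omega)
        rw [theta_apply, sub_eq_zero] at hXθ hYθ
        have hjs : (⟨j + 1, by omega⟩ : Fin n).castSucc = j.succ := rfl
        rw [hjs] at hXθ hYθ
        rw [hXθ, hYθ]; ring
    refine ⟨hfwd v, fun hv => ?_⟩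
    -- a bracket on which the next contact form does not vanish
    let U : Set (Cotangent (JetZ n)) := {y | y.1 ∈ domZ Ω} ∩ {y | y.2 eZ ≠ 0}
    have hU : IsOpen U := by
      refine ((isOpen_domZ hΩ).preimage continuous_fst).inter ?_
      exact isOpen_ne.preimage (by fun_prop : Continuous fun y : Cotangent (JetZ n) => y.2 eZ)
    -- The direction `∂_{y_{n-i}}` is killed by every `θ_k` with `k + i < n`, while `dθ_{n-1-i}`
    -- detects it against the `x`-component of `𝓒`.
    let m : Fin (n + 1) := ⟨n - i, by omega⟩
    let j : Fin n := ⟨n - 1 - i, by omega⟩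
    have hjm : j.succ = m := by ext; simp [j, m]; omega
    have hmem : ∀ y ∈ U ∩ regPart (domZ Ω) (lagrDist f),
        charVec f y ∈ charDist (domZ Ω) (lagrDist f) y ∧
        liftVec hn f m y ∈ jacobiPos (domZ Ω) (lagrDist f) i y := by
      rintro y ⟨⟨hy1, hy2⟩, hy3⟩
      refine ⟨charVec_mem hn hΩ hf hnd hy3.1 hy2, (ih hi' hy3.1 hy2 _).2
        ⟨liftVec_mem_tangent hn hΩ hf m hy3.1, ?_, fun k hk => ?_⟩⟩
      · simp [liftVec]; ring
      · have : m ≠ k.castSucc := by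
          intro h
          have := congrArg Fin.val h
          simp [m] at this
          omega
        simp [liftVec, theta_eY, theta_eZ, this]
    have hX : ContDiffOn ℝ ∞ (charVec f) U := fun y hy =>
      (contDiffAt_charVec hΩ hf hy.1).contDiffWithinAt
    have hY : ContDiffOn ℝ ∞ (liftVec hn f m) U := fun y hy =>
      (contDiffAt_liftVec hn hΩ hf m hy.1).contDiffWithinAt
    have hb := mem_bracketDist hU (⟨hl.1, hν⟩ : l ∈ U) hX hY hmem
    have hθ := (hbr hU ⟨hl.1, hν⟩ hX hY hmem).2.2 j (by simp [j]; omega)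
    have hθ' : theta j l.1 (VectorField.lieBracket ℝ (charVec f) (liftVec hn f m) l).1 ≠ 0 := by
      rw [hθ, charVec_x hΩ hf hl.1, hjm]
      have : (liftVec hn f m l).1.1.1 = 0 := by simp [liftVec, eY, eZ]
      have h2 : (liftVec hn f m l).1.1.2 m = l.2 eZ := by simp [liftVec, eY, eZ]
      rw [this, h2, mul_zero, zero_sub, neg_ne_zero]
      exact mul_ne_zero hν (mul_ne_zero (hnd _ hl.1) hν)
    set w := VectorField.lieBracket ℝ (charVec f) (liftVec hn f m) l with hw
    have hwf := hfwd w (Submodule.mem_sup_right hb)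
    set c := theta j l.1 v.1 / theta j l.1 w.1 with hc
    have hsub : v - c • w ∈ jacobiPos (domZ Ω) (lagrDist f) i l := by
      refine (ih hi' hl hν _).2 ⟨sub_mem hv.1 (Submodule.smul_mem _ _ hwf.1), ?_, fun k hk => ?_⟩
      · simp [hv.2.1, hwf.2.1]
      · by_cases hkj : k = j
        · subst hkj
          simp only [Prod.fst_sub, Prod.smul_fst, map_sub, map_smul, smul_eq_mul, hc]
          field_simp
          ring
        · have : (k : ℕ) + (i + 1) < n := by
            have : (k : ℕ) ≠ n - 1 - i := fun h => hkj (Fin.ext h)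
            omega
          simp [hv.2.2 k this, hwf.2.2 k this]
    have : v = (v - c • w) + c • w := by abel
    rw [this]
    exact add_mem (Submodule.mem_sup_left hsub)
      (Submodule.mem_sup_right (Submodule.smul_mem _ _ hb))

end Jacobi

/-! ### The space `J^(1-n)` by duality. -/

section JacobiEnd

variable {n : ℕ} {Ω : Set (Jet n)} {f : Jet n → ℝ}

theorem euler_mem_tangent (hn : 0 < n) (hΩ : IsOpen Ω) (hf : ContDiffOn ℝ ∞ f Ω)
    {l : Cotangent (JetZ n)} (hl : l ∈ D2perp (domZ Ω) (lagrDist f)) :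
    ((0, l.2) : Cotangent (JetZ n)) ∈ tangent (D2perp (domZ Ω) (lagrDist f)) l := by
  rw [mem_tangent_D2perp hn hΩ hf hl]
  intro i
  rw [fderiv_quasiImpulse (differentiableAt_frame hΩ hf i hl.1)]
  simp [apply_frame hΩ hf hl i]

theorem theta_zero_mem_tangent (hn : 2 ≤ n) (hΩ : IsOpen Ω) (hf : ContDiffOn ℝ ∞ f Ω)
    {l : Cotangent (JetZ n)} (hl : l ∈ D2perp (domZ Ω) (lagrDist f)) :
    ((0, theta ⟨0, by omega⟩ l.1) : Cotangent (JetZ n)) ∈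
      tangent (D2perp (domZ Ω) (lagrDist f)) l := by
  rw [mem_tangent_D2perp (by omega) hΩ hf hl]
  intro i
  rw [fderiv_quasiImpulse (differentiableAt_frame hΩ hf i hl.1)]
  have h3 : ¬ (0 : ℕ) = n - 1 := by omega
  fin_cases i
  · simp [frame, theta_X1]
  · simp [frame, theta_X2]
  · simp [frame, theta_X3 (show 0 < n by omega), h3]

/-- The last space of the flag is spanned by the characteristic and Euler directions and by
the covector `θ_0`. -/
theorem mem_jacobiFlag_iff (hn : 2 ≤ n) (hΩ : IsOpen Ω) (hf : ContDiffOn ℝ ∞ f Ω)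
    (hnd : ∀ j ∈ Ω, pderiv (pderiv f (Fin.last n)) (Fin.last n) j ≠ 0)
    {l : Cotangent (JetZ n)} (hl : l ∈ D2perp (domZ Ω) (lagrDist f)) (hν : l.2 eZ ≠ 0)
    (v : Cotangent (JetZ n)) :
    v ∈ jacobiFlag (domZ Ω) (lagrDist f) (1 - (n : ℤ)) l ↔
      ∃ u ∈ charDist (domZ Ω) (lagrDist f) l, ∃ a b : ℝ,
        v = u + a • ((0, l.2) : Cotangent (JetZ n)) + b • ((0, theta ⟨0, by omega⟩ l.1) :
          Cotangent (JetZ n)) := by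
  have hn0 : 0 < n := by omega
  -- `Int.negSucc k` stands for `-(k + 1)`, so the complement is taken of `J^(n - 2 + 1) = J^(n-1)`,
  -- where `θ_0` is the only contact form left.
  have hidx : (1 - (n : ℤ)) = Int.negSucc (n - 2) := by omega
  have hmem : ∀ w : Cotangent (JetZ n), w ∈ jacobiPos (domZ Ω) (lagrDist f) (n - 2 + 1) l ↔
      (∀ i, fderiv ℝ (quasiImpulse (frame f i)) l w = 0) ∧ l.2 w.1 = 0 ∧
        theta ⟨0, hn0⟩ l.1 w.1 = 0 := by
    intro w
    rw [mem_jacobiPos_iff hn0 hΩ hf hnd (n - 2 + 1) (by omega) hl hν,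
      mem_tangent_D2perp hn0 hΩ hf hl]
    refine and_congr_right fun _ => and_congr_right fun _ => ⟨fun h => h _ (by simp; omega), ?_⟩
    intro h j hj
    have : j = ⟨0, hn0⟩ := Fin.ext (by simp; omega)
    rw [this]; exact h
  have hsE : ∀ w : Cotangent (JetZ n), sigma ((0, l.2) : Cotangent (JetZ n)) w = l.2 w.1 := by
    intro w; simp [sigma]
  have hsT : ∀ w : Cotangent (JetZ n),
      sigma ((0, theta ⟨0, hn0⟩ l.1) : Cotangent (JetZ n)) w = theta ⟨0, hn0⟩ l.1 w.1 := by
    intro w; simp [sigma]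
  have hE := euler_mem_tangent hn0 hΩ hf hl
  have hT := theta_zero_mem_tangent hn hΩ hf hl
  rw [hidx]
  change (v ∈ evenContact (domZ Ω) (lagrDist f) l ∧ _) ↔ _
  constructor
  · rintro ⟨⟨hv, -⟩, hv'⟩
    -- The `σ`-orthogonal complement of these five vectors is exactly `J^(n-1)`: three give
    -- tangency, the last two pair with `w` as the Liouville form and `θ_0`. Hence the complement of
    -- `J^(n-1)` lies in their span.
    let U : Fin 3 ⊕ Fin 2 → Cotangent (JetZ n) := Sum.elim (fun i => hamVec (frame f i) l)
      ![(0, l.2), (0, theta ⟨0, hn0⟩ l.1)]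
    have hsp : v ∈ Submodule.span ℝ (range U) := by
      refine mem_span_of_sigma_eq_zero fun w hw => hv' w ((hmem w).2 ⟨fun i => ?_, ?_, ?_⟩)
      · have := hw (Sum.inl i)
        simpa [U, sigma_hamVec_frame hΩ hf hl] using this
      · rw [← hsE]; exact hw (Sum.inr 0)
      · rw [← hsT]; exact hw (Sum.inr 1)
    obtain ⟨c, hc⟩ := (Submodule.mem_span_range_iff_exists_fun ℝ).1 hsp
    rw [Fintype.sum_sum_type, Fin.sum_univ_two] at hc
    have hc' : v = (∑ i, c (Sum.inl i) • hamVec (frame f i) l) +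
        c (Sum.inr 0) • ((0, l.2) : Cotangent (JetZ n)) +
        c (Sum.inr 1) • ((0, theta ⟨0, hn0⟩ l.1) : Cotangent (JetZ n)) := by
      rw [← hc, add_assoc]; rfl
    refine ⟨∑ i, c (Sum.inl i) • hamVec (frame f i) l, ⟨?_, ?_⟩, _, _, hc'⟩
    -- The Hamiltonian part is characteristic: it is tangent as a difference of tangent vectors, and
    -- orthogonal to all tangent vectors as a combination of Hamiltonian ones.
    · have : (∑ i, c (Sum.inl i) • hamVec (frame f i) l) =
          v - c (Sum.inr 0) • ((0, l.2) : Cotangent (JetZ n)) -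
          c (Sum.inr 1) • ((0, theta ⟨0, hn0⟩ l.1) : Cotangent (JetZ n)) := by
        rw [hc']; abel
      rw [this]
      exact sub_mem (sub_mem hv (Submodule.smul_mem _ _ hE)) (Submodule.smul_mem _ _ hT)
    · intro w hw
      rw [mem_tangent_D2perp hn0 hΩ hf hl] at hw
      rw [← sigmaForm_apply, map_sum, LinearMap.sum_apply]
      refine Finset.sum_eq_zero fun i _ => ?_
      rw [map_smul, LinearMap.smul_apply, sigmaForm_apply, sigma_hamVec_frame hΩ hf hl, hw,
        neg_zero, smul_zero]
  · rintro ⟨u, hu, a, b, rfl⟩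
    have hu' := charDist_props hn0 hΩ hf hnd hl hν hu
    refine ⟨⟨add_mem (add_mem hu.1 (Submodule.smul_mem _ _ hE)) (Submodule.smul_mem _ _ hT), ?_⟩,
      fun w hw => ?_⟩
    · rw [SetLike.mem_coe, LinearMap.mem_ker]
      simp [hu'.1]
    · obtain ⟨h1, h2, h3⟩ := (hmem w).1 hw
      rw [sigma_add_left, sigma_add_left, sigma_smul_left, sigma_smul_left, hsE, hsT, h2, h3,
        hu.2 w ((mem_tangent_D2perp hn0 hΩ hf hl w).2 h1)]
      simp

/-- Replaces `∂_x` by `X_1` in the basis: the covectors compared later have values on `X_1` that are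
known from tangency or membership, while their `dx` coefficients would need a computation. -/
theorem covector_ext_X1 {q : JetZ n} {p p' : JetZ n →L[ℝ] ℝ} (hx : p (X1 f q) = p' (X1 f q))
    (hy : ∀ i, p (eY i) = p' (eY i)) (hz : p eZ = p' eZ) : p = p' := by
  refine covector_ext ?_ hy hz
  have h1 : (X1 f q).1.1 = 1 := rfl
  have h2 := eq_sum_basis (X1 f q)
  rw [h1, one_smul] at h2
  have h3 : eX = X1 f q - ∑ i, (X1 f q).1.2 i • eY i - (X1 f q).2 • eZ := by
    rw [sub_sub, eq_sub_iff_add_eq, ← add_assoc]; exact h2.symm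
  rw [h3]
  simp [hx, hy, hz]

end JacobiEnd

/-! ### Total derivatives -/

section Total

variable {k : ℕ} {O : Set (Jet k)}

/-- The vector `∂_{y_i}` of `J^k`. -/
def dY (i : Fin (k + 1)) : Jet k := (0, Pi.single i 1)

theorem pderiv_eq (g : Jet k → ℝ) (i : Fin (k + 1)) (e : Jet k) :
    pderiv g i e = fderiv ℝ g e (dY i) := rfl

theorem jet_eq_sum (w : Jet k) : w = w.1 • ((1, 0) : Jet k) + ∑ i, w.2 i • dY i := by
  refine Prod.ext ?_ ?_
  · simp [dY, Prod.fst_sum]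
  · simpa [dY, Prod.snd_sum] using sum_smul_single w.2

/-- `g` is smooth on `O`, depends only on `x, y_0, …, y_m`, and `∂g/∂y_m = c`. -/
structure HasTop (O : Set (Jet k)) (g : Jet k → ℝ) (m : ℕ) (c : Jet k → ℝ) : Prop where
  smooth : ContDiffOn ℝ ∞ g O
  zero : ∀ e ∈ O, ∀ i : Fin (k + 1), m < i → pderiv g i e = 0
  top : ∀ e ∈ O, ∀ i : Fin (k + 1), (i : ℕ) = m → pderiv g i e = c e

theorem HasTop.differentiableAt {g c : Jet k → ℝ} {m : ℕ} (h : HasTop O g m c) (hO : IsOpen O)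
    {e : Jet k} (he : e ∈ O) : DifferentiableAt ℝ g e :=
  (h.smooth.contDiffAt (hO.mem_nhds he)).differentiableAt (by simp)

theorem contDiff_jetShift : ContDiff ℝ ∞ (jetShift (k := k)) := by
  have : (jetShift (k := k)) = fun j => (1, 0) + shiftL j := funext jetShift_eq
  rw [this]; fun_prop

theorem contDiffOn_totalDeriv (hO : IsOpen O) {g : Jet k → ℝ} (hg : ContDiffOn ℝ ∞ g O) :
    ContDiffOn ℝ ∞ (totalDeriv g) O :=
  (hg.fderiv_of_isOpen hO (m := ∞) (by simp)).clm_apply contDiff_jetShift.contDiffOn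

theorem pderiv_totalDeriv (hO : IsOpen O) {g : Jet k → ℝ} (hg : ContDiffOn ℝ ∞ g O)
    (i : Fin (k + 1)) {e : Jet k} (he : e ∈ O) :
    pderiv (totalDeriv g) i e = totalDeriv (pderiv g i) e + fderiv ℝ g e (shiftL (dY i)) := by
  have hge := hg.contDiffAt (hO.mem_nhds he)
  have h1 : DifferentiableAt ℝ (fderiv ℝ g) e :=
    (hge.fderiv_right (m := ∞) (by simp)).differentiableAt (by simp)
  have h2 := (h1.hasFDerivAt.clm_apply (hasFDerivAt_jetShift e)).fderiv
  have h3 := (h1.hasFDerivAt.clm_apply (hasFDerivAt_const (dY i) e)).fderiv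
  have hsym := ((contDiffAt_infty.1 hge 2).isSymmSndFDerivAt (by simp)).eq (dY i) (jetShift e)
  have e1 : pderiv (totalDeriv g) i e = fderiv ℝ (fun y => fderiv ℝ g y (jetShift y)) e (dY i) :=
    rfl
  have e2 : totalDeriv (pderiv g i) e =
    fderiv ℝ (fun y => fderiv ℝ g y (dY i)) e (jetShift e) := rfl
  rw [e1, e2, h2, h3]
  simp [hsym]
  ring

/-- The commutator of `∂_{y_{i+1}}` with `d/dx` is `∂_{y_i}`. So `d/dx` raises the order by one and
leaves the leading coefficient unchanged. -/
theorem HasTop.totalDeriv (hO : IsOpen O) {g c : Jet k → ℝ} {m : ℕ} (h : HasTop O g m c) :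
    HasTop O (totalDeriv g) (m + 1) c := by
  have hz : ∀ e ∈ O, ∀ i : Fin (k + 1), m < i → VarLin.totalDeriv (pderiv g i) e = 0 := by
    intro e he i hi
    have : pderiv g i =ᶠ[𝓝 e] fun _ => (0 : ℝ) :=
      Filter.mem_of_superset (hO.mem_nhds he) fun y hy => h.zero y hy i hi
    rw [VarLin.totalDeriv, this.fderiv_eq]; simp
  have key : ∀ e ∈ O, ∀ i : Fin (k + 1), m < i → ∃ i' : Fin (k + 1), (i' : ℕ) + 1 = i ∧
      pderiv (VarLin.totalDeriv g) i e = pderiv g i' e := by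
    intro e he i hi
    rw [pderiv_totalDeriv hO h.smooth i he, hz e he i hi, zero_add]
    obtain ⟨i', rfl⟩ := Fin.exists_succ_eq_of_ne_zero (x := i) (by
      rintro rfl; simp at hi)
    exact ⟨i'.castSucc, by simp, by rw [dY, shiftL_single_succ]; rfl⟩
  refine ⟨contDiffOn_totalDeriv hO h.smooth, fun e he i hi => ?_, fun e he i hi => ?_⟩
  · obtain ⟨i', h1, h2⟩ := key e he i (by omega)
    rw [h2, h.zero e he i' (by omega)]
  · obtain ⟨i', h1, h2⟩ := key e he i (by omega)
    rw [h2, h.top e he i' (by omega)]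

theorem HasTop.mono {g c : Jet k → ℝ} {m m' : ℕ} (h : HasTop O g m c) (hm : m < m') :
    HasTop O g m' 0 :=
  ⟨h.smooth, fun e he i hi => h.zero e he i (by omega), fun e he i hi =>
    h.zero e he i (by omega)⟩

theorem HasTop.zero_fun (m : ℕ) : HasTop O (fun _ => 0) m 0 :=
  ⟨contDiffOn_const, fun e _ i _ => by simp [pderiv], fun e _ i _ => by simp [pderiv]⟩

theorem HasTop.const_mul (hO : IsOpen O) {g c : Jet k → ℝ} {m : ℕ} (h : HasTop O g m c) (a : ℝ) :
    HasTop O (fun e => a * g e) m (fun e => a * c e) := by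
  have hd : ∀ e ∈ O, ∀ i, pderiv (fun e => a * g e) i e = a * pderiv g i e := by
    intro e he i
    rw [pderiv, fderiv_const_mul (h.differentiableAt hO he)]; rfl
  exact ⟨contDiffOn_const.mul h.smooth, fun e he i hi => by rw [hd e he, h.zero e he i hi, mul_zero],
    fun e he i hi => by rw [hd e he, h.top e he i hi]⟩

theorem HasTop.sum (hO : IsOpen O) {ι : Type*} [Fintype ι] {g c : ι → Jet k → ℝ} {m : ℕ}
    (h : ∀ j, HasTop O (g j) m (c j)) :
    HasTop O (fun e => ∑ j, g j e) m (fun e => ∑ j, c j e) := by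
  have hd : ∀ e ∈ O, ∀ i, pderiv (fun e => ∑ j, g j e) i e = ∑ j, pderiv (g j) i e := by
    intro e he i
    rw [pderiv, fderiv_fun_sum fun j _ => (h j).differentiableAt hO he, sum_apply]; rfl
  exact ⟨ContDiffOn.sum fun j _ => (h j).smooth,
    fun e he i hi => by
      rw [hd e he]; exact Finset.sum_eq_zero fun j _ => (h j).zero e he i hi,
    fun e he i hi => by
      rw [hd e he]; exact Finset.sum_congr rfl fun j _ => (h j).top e he i hi⟩

/-- The triangularity used to invert the Legendre map: once the lower components are zero, only the
leading term is seen. -/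
theorem HasTop.fderiv_apply {g c : Jet k → ℝ} {m : ℕ} (h : HasTop O g m c) {e : Jet k}
    (he : e ∈ O) {w : Jet k} (hx : w.1 = 0) (hm : m < k + 1)
    (hw : ∀ i : Fin (k + 1), (i : ℕ) < m → w.2 i = 0) :
    fderiv ℝ g e w = w.2 ⟨m, hm⟩ * c e := by
  conv_lhs => rw [jet_eq_sum w]
  rw [hx, zero_smul, zero_add, map_sum, Finset.sum_eq_single ⟨m, hm⟩]
  · rw [map_smul, ← pderiv_eq, h.top e he _ rfl, smul_eq_mul]
  · intro i _ hi
    rw [map_smul, ← pderiv_eq]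
    rcases lt_trichotomy (i : ℕ) m with h1 | h1 | h1
    · rw [hw i h1, zero_smul]
    · exact absurd (Fin.ext h1) hi
    · rw [h.zero e he i h1, smul_zero]
  · simp

end Total

/-! ### Orders and leading coefficients of the momenta and of the Euler–Lagrange expression. -/

section EulerLagrange

variable {n : ℕ} {Ω : Set (Jet n)} {f : Jet n → ℝ}

/-- The projection `J^{2n} → J^n`. -/
def projL : Jet (2 * n) →L[ℝ] Jet n :=
  LinearMap.toContinuousLinearMap (jetProj (by omega : n ≤ 2 * n))

theorem projL_apply (e : Jet (2 * n)) : projL e = jetProj (by omega : n ≤ 2 * n) e := rfl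

/-- The jets of order `2n` over `Ω`. -/
def jetDom (Ω : Set (Jet n)) : Set (Jet (2 * n)) := {e | projL e ∈ Ω}

theorem isOpen_jetDom (hΩ : IsOpen Ω) : IsOpen (jetDom Ω) := hΩ.preimage projL.continuous

theorem projL_dY (i : Fin (2 * n + 1)) :
    projL (dY i) = if h : (i : ℕ) < n + 1 then dY ⟨i, h⟩ else (0 : Jet n) := by
  rw [projL_apply, jetProj]
  split_ifs with h
  · refine Prod.ext rfl (funext fun j => ?_)
    simp [dY, Pi.single_apply, Fin.ext_iff]
  · refine Prod.ext rfl (funext fun j => ?_)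
    have : (j : ℕ) ≠ i := by omega
    simp [dY, Pi.single_apply, Fin.ext_iff, this]

/-- `f_{y_n y_n}` on `J^{2n}`. -/
def hess (f : Jet n → ℝ) (e : Jet (2 * n)) : ℝ :=
  pderiv (pderiv f (Fin.last n)) (Fin.last n) (projL e)

theorem hasTop_comp_projL (hΩ : IsOpen Ω) {g : Jet n → ℝ} (hg : ContDiffOn ℝ ∞ g Ω) :
    HasTop (jetDom Ω) (fun e => g (projL e)) n (fun e => pderiv g (Fin.last n) (projL e)) := by
  have hd : ∀ e ∈ jetDom Ω, ∀ i, pderiv (fun e => g (projL e)) i e =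
      fderiv ℝ g (projL e) (projL (dY i)) := by
    intro e he i
    have h1 : HasFDerivAt g (fderiv ℝ g (projL e)) (projL e) :=
      ((hg.contDiffAt (hΩ.mem_nhds he)).differentiableAt (by simp)).hasFDerivAt
    have h2 : HasFDerivAt (fun e => g (projL e)) _ e := h1.comp e projL.hasFDerivAt
    rw [pderiv, h2.fderiv]; rfl
  refine ⟨hg.comp projL.contDiff.contDiffOn fun e he => he, fun e he i hi => ?_,
    fun e he i hi => ?_⟩
  · rw [hd e he, projL_dY, dif_neg (by omega), map_zero]
  · rw [hd e he, projL_dY, dif_pos (by omega)]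
    have : (⟨i, by omega⟩ : Fin (n + 1)) = Fin.last n := Fin.ext (by simp [hi])
    rw [this]; rfl

theorem hasTop_totalDerivPartial (hΩ : IsOpen Ω) (hf : ContDiffOn ℝ ∞ f Ω) (m : ℕ)
    (i : Fin (n + 1)) :
    HasTop (jetDom Ω) (totalDerivPartial f m i) (n + m)
      (fun e => pderiv (pderiv f i) (Fin.last n) (projL e)) := by
  induction m with
  | zero => exact hasTop_comp_projL hΩ (contDiffOn_pderiv hΩ hf i)
  | succ m ih =>
    have : totalDerivPartial f (m + 1) i = totalDeriv (totalDerivPartial f m i) := by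
      rw [totalDerivPartial, Function.iterate_succ_apply']; rfl
    rw [this]
    exact ih.totalDeriv (isOpen_jetDom hΩ)

/-- The sums `∑_{k ≥ j} (-1)^{k-j} d^{k-j}/dx^{k-j} f_{y_k}`: the Euler-Lagrange expression
for `j = 0` and the momenta `ξ_{j-1}` for `j ≥ 1`. -/
def elTail (f : Jet n → ℝ) (j : ℕ) (e : Jet (2 * n)) : ℝ :=
  ∑ k : Fin (n + 1), if j ≤ (k : ℕ) then
    (-1) ^ ((k : ℕ) - j) * totalDerivPartial f ((k : ℕ) - j) k e else 0

theorem elTail_zero (e : Jet (2 * n)) : elTail f 0 e = eulerLagrange f e := by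
  simp [elTail, eulerLagrange]

/-- The `k`-th summand has order at most `n + k - j`, so only `k = n` reaches `2n - j`, with leading
coefficient `(-1)^(n-j) f_{y_n y_n}`. -/
theorem hasTop_elTail (hΩ : IsOpen Ω) (hf : ContDiffOn ℝ ∞ f Ω) (j : ℕ) (hj : j ≤ n) :
    HasTop (jetDom Ω) (elTail f j) (2 * n - j) (fun e => (-1) ^ (n - j) * hess f e) := by
  have hO := isOpen_jetDom hΩ
  have h1 : ∀ k : Fin (n + 1), HasTop (jetDom Ω) (fun e => if j ≤ (k : ℕ) then
      (-1) ^ ((k : ℕ) - j) * totalDerivPartial f ((k : ℕ) - j) k e else 0) (2 * n - j)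
      (fun e => if k = Fin.last n then (-1) ^ (n - j) * hess f e else 0) := by
    intro k
    by_cases hk : k = Fin.last n
    · subst hk
      simp only [Fin.val_last, hj, if_true]
      have := (hasTop_totalDerivPartial hΩ hf (n - j) (Fin.last n)).const_mul hO ((-1) ^ (n - j))
      rwa [show n + (n - j) = 2 * n - j by omega] at this
    · have hk' : (k : ℕ) < n := Fin.val_lt_last hk
      simp only [hk, if_false]
      by_cases hjk : j ≤ (k : ℕ)
      · simp only [hjk, if_true]
        exact ((hasTop_totalDerivPartial hΩ hf (k - j) k).const_mul hO _).mono (by omega)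
      · simp only [hjk, if_false]
        exact HasTop.zero_fun _
  have h2 := HasTop.sum hO h1
  simp only [Finset.sum_ite_eq', Finset.mem_univ, if_true] at h2
  exact h2

/-- Horner's scheme for the alternating sum; this recursion is the source of Hamilton's equations
for the momenta. -/
theorem elTail_eq (hΩ : IsOpen Ω) (hf : ContDiffOn ℝ ∞ f Ω) (j : Fin (n + 1)) {e : Jet (2 * n)}
    (he : e ∈ jetDom Ω) :
    elTail f j e = pderiv f j (projL e) - totalDeriv (elTail f (j + 1)) e := by
  have hd : totalDeriv (elTail f (j + 1)) e = ∑ k : Fin (n + 1), if (j : ℕ) + 1 ≤ (k : ℕ) then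
      (-1) ^ ((k : ℕ) - (j + 1)) * totalDerivPartial f ((k : ℕ) - j) k e else 0 := by
    have hdk : ∀ k : Fin (n + 1), HasFDerivAt (fun e => if (j : ℕ) + 1 ≤ (k : ℕ) then
        (-1) ^ ((k : ℕ) - (j + 1)) * totalDerivPartial f ((k : ℕ) - (j + 1)) k e else 0)
        (if (j : ℕ) + 1 ≤ (k : ℕ) then ((-1 : ℝ) ^ ((k : ℕ) - (j + 1))) •
          fderiv ℝ (totalDerivPartial f ((k : ℕ) - (j + 1)) k) e else 0) e := by
      intro k
      split_ifs
      · exact ((hasTop_totalDerivPartial hΩ hf _ k).differentiableAt (isOpen_jetDom hΩ)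
          he).hasFDerivAt.const_mul _
      · exact hasFDerivAt_const _ _
    have h1 : HasFDerivAt (elTail f (j + 1)) _ e := HasFDerivAt.fun_sum fun k _ => hdk k
    rw [totalDeriv, h1.fderiv, sum_apply]
    refine Finset.sum_congr rfl fun k _ => ?_
    split_ifs with hk
    · have : totalDerivPartial f ((k : ℕ) - j) k =
          totalDeriv (totalDerivPartial f ((k : ℕ) - (j + 1)) k) := by
        rw [show (k : ℕ) - j = (k - (j + 1)) + 1 by omega, totalDerivPartial,
          Function.iterate_succ_apply']; rfl
      rw [this]; rfl
    · rfl
  rw [hd, elTail, eq_sub_iff_add_eq, ← Finset.sum_add_distrib, Finset.sum_eq_single j]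
  · simp [totalDerivPartial, projL_apply]
  · intro k _ hk
    have hk' : (k : ℕ) ≠ j := fun h => hk (Fin.ext h)
    by_cases h : (j : ℕ) + 1 ≤ k
    · rw [if_pos (by omega), if_pos h, show (k : ℕ) - j = (k - (j + 1)) + 1 by omega, pow_succ]
      ring
    · rw [if_neg (by omega), if_neg h, add_zero]
  · simp

theorem elTail_last (hΩ : IsOpen Ω) (hf : ContDiffOn ℝ ∞ f Ω) {e : Jet (2 * n)}
    (he : e ∈ jetDom Ω) : elTail f n e = pderiv f (Fin.last n) (projL e) := by
  have h := elTail_eq hΩ hf (Fin.last n) he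
  have h0 : elTail f (n + 1) = fun _ => (0 : ℝ) := by
    ext e
    refine Finset.sum_eq_zero fun k _ => if_neg (by omega)
  rw [Fin.val_last, h0] at h
  simpa [totalDeriv] using h

end EulerLagrange

/-! ### The Euler–Lagrange equation as a graph, and its distributions in terms of `retr`. -/

section Retraction

variable {n : ℕ} {Ω : Set (Jet n)} {f : Jet n → ℝ}

/-- The vector `∂_{y_{2n}}`. -/
def topVec (n : ℕ) : Jet (2 * n) := dY (Fin.last (2 * n))

theorem projL_topVec (hn : 0 < n) : projL (topVec n) = 0 := by
  rw [topVec, projL_dY, dif_neg (by simp; omega)]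

theorem projL_add_topVec (hn : 0 < n) (e : Jet (2 * n)) (s : ℝ) :
    projL (e + s • topVec n) = projL e := by
  rw [map_add, map_smul, projL_topVec hn, smul_zero, add_zero]

/-- A constant derivative along `∂_{y_{2n}}` makes `g` affine on the whole line, which stays in the
domain because `Ω` restricts only the coordinates up to `y_n`. -/
theorem apply_add_topVec (hn : 0 < n) (hΩ : IsOpen Ω) {g : Jet (2 * n) → ℝ}
    (hg : ContDiffOn ℝ ∞ g (jetDom Ω)) {e : Jet (2 * n)} (he : e ∈ jetDom Ω) {d : ℝ}
    (hd : ∀ t : ℝ, pderiv g (Fin.last (2 * n)) (e + t • topVec n) = d) (s : ℝ) :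
    g (e + s • topVec n) = g e + s * d := by
  have hmem : ∀ t : ℝ, e + t • topVec n ∈ jetDom Ω := fun t => by
    change projL _ ∈ Ω
    rw [projL_add_topVec hn]; exact he
  have h1 : ∀ t : ℝ, HasDerivAt (fun t : ℝ => g (e + t • topVec n) - t * d) 0 t := by
    intro t
    have hgt : HasFDerivAt g (fderiv ℝ g (e + t • topVec n)) (e + t • topVec n) :=
      ((hg.contDiffAt ((isOpen_jetDom hΩ).mem_nhds (hmem t))).differentiableAt
        (by simp)).hasFDerivAt
    have hl : HasDerivAt (fun t : ℝ => e + t • topVec n) (topVec n) t := by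
      simpa using ((hasDerivAt_id t).smul_const (topVec n)).const_add e
    have h2 := (hgt.comp_hasDerivAt t hl).sub ((hasDerivAt_id t).mul_const d)
    refine h2.congr_deriv ?_
    rw [one_mul, sub_eq_zero]
    exact hd t
  have h3 := is_const_of_deriv_eq_zero (fun t => (h1 t).differentiableAt) (fun t => (h1 t).deriv)
    s 0
  simp only [zero_smul, add_zero, zero_mul, sub_zero] at h3
  linarith

theorem hess_add_topVec (hn : 0 < n) (e : Jet (2 * n)) (s : ℝ) :
    hess f (e + s • topVec n) = hess f e := by
  rw [hess, projL_add_topVec hn]; rfl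

theorem add_topVec_mem (hn : 0 < n) {e : Jet (2 * n)} (he : e ∈ jetDom Ω) (s : ℝ) :
    e + s • topVec n ∈ jetDom Ω := by
  change projL _ ∈ Ω
  rw [projL_add_topVec hn]; exact he

/-- Being affine in `y_{2n}` with nonzero slope, the equation is solved for `y_{2n}` explicitly and
globally, with no implicit function theorem; this gives `corr`. -/
theorem elTail_zero_add_topVec (hn : 0 < n) (hΩ : IsOpen Ω) (hf : ContDiffOn ℝ ∞ f Ω)
    {e : Jet (2 * n)} (he : e ∈ jetDom Ω) (s : ℝ) :
    elTail f 0 (e + s • topVec n) = elTail f 0 e + s * ((-1) ^ n * hess f e) := by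
  have h := hasTop_elTail hΩ hf 0 (by omega)
  refine apply_add_topVec hn hΩ h.smooth he (fun t => ?_) s
  rw [h.top _ (add_topVec_mem hn he t) _ (by simp), hess_add_topVec hn, Nat.sub_zero]

theorem elTail_succ_add_topVec (hn : 0 < n) (hΩ : IsOpen Ω) (hf : ContDiffOn ℝ ∞ f Ω)
    {j : ℕ} (hj : j < n) {e : Jet (2 * n)} (he : e ∈ jetDom Ω) (s : ℝ) :
    elTail f (j + 1) (e + s • topVec n) = elTail f (j + 1) e := by
  have h := hasTop_elTail hΩ hf (j + 1) (by omega)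
  rw [apply_add_topVec hn hΩ h.smooth he (fun t => ?_) s, mul_zero, add_zero]
  exact h.zero _ (add_topVec_mem hn he t) _ (by simp; omega)

/-- The correction of the top coordinate that solves the Euler-Lagrange equation. -/
def corr (f : Jet n → ℝ) (e : Jet (2 * n)) : ℝ := (-1) ^ n * elTail f 0 e / hess f e

/-- The projection of `J^{2n}` onto the Euler-Lagrange equation along `∂_{y_{2n}}`. -/
def retr (f : Jet n → ℝ) (e : Jet (2 * n)) : Jet (2 * n) := e - corr f e • topVec n

theorem contDiffOn_hess (hΩ : IsOpen Ω) (hf : ContDiffOn ℝ ∞ f Ω) :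
    ContDiffOn ℝ ∞ (hess f) (jetDom Ω) :=
  (contDiffOn_pderiv hΩ (contDiffOn_pderiv hΩ hf _) _).comp projL.contDiff.contDiffOn
    fun _ he => he

theorem contDiffOn_retr (hΩ : IsOpen Ω) (hf : ContDiffOn ℝ ∞ f Ω)
    (hnd : ∀ j ∈ Ω, pderiv (pderiv f (Fin.last n)) (Fin.last n) j ≠ 0) :
    ContDiffOn ℝ ∞ (retr f) (jetDom Ω) := by
  have hc : ContDiffOn ℝ ∞ (corr f) (jetDom Ω) :=
    (contDiffOn_const.mul (hasTop_elTail hΩ hf 0 (by omega)).smooth).div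
      (contDiffOn_hess hΩ hf) fun e he => hnd _ he
  exact contDiffOn_id.sub (hc.smul (contDiffOn_const (c := topVec n)))

theorem retr_eq_add (e : Jet (2 * n)) : retr f e = e + (-corr f e) • topVec n := by
  rw [retr, neg_smul, sub_eq_add_neg]

theorem projL_retr (hn : 0 < n) (e : Jet (2 * n)) : projL (retr f e) = projL e := by
  rw [retr_eq_add, projL_add_topVec hn]

theorem retr_mem_jetDom (hn : 0 < n) {e : Jet (2 * n)} (he : e ∈ jetDom Ω) :
    retr f e ∈ jetDom Ω := by
  change projL _ ∈ Ω
  rw [projL_retr hn]; exact he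

theorem neg_one_pow_sq (n : ℕ) : ((-1 : ℝ) ^ n) * (-1) ^ n = 1 := by
  rw [← mul_pow]; simp

theorem mem_ELset_iff {e : Jet (2 * n)} : e ∈ ELset Ω f ↔ e ∈ jetDom Ω ∧ elTail f 0 e = 0 := by
  rw [elTail_zero]; rfl

theorem retr_mem (hn : 0 < n) (hΩ : IsOpen Ω) (hf : ContDiffOn ℝ ∞ f Ω)
    (hnd : ∀ j ∈ Ω, pderiv (pderiv f (Fin.last n)) (Fin.last n) j ≠ 0)
    {e : Jet (2 * n)} (he : e ∈ jetDom Ω) : retr f e ∈ ELset Ω f := by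
  refine mem_ELset_iff.2 ⟨retr_mem_jetDom hn he, ?_⟩
  have h0 : hess f e ≠ 0 := hnd _ he
  rw [retr_eq_add, elTail_zero_add_topVec hn hΩ hf he, corr]
  field_simp
  linear_combination (-elTail f 0 e) * neg_one_pow_sq n

theorem retr_of_mem {e : Jet (2 * n)} (he : e ∈ ELset Ω f) : retr f e = e := by
  rw [retr, corr, (mem_ELset_iff.1 he).2]; simp

theorem retr_add_topVec (hn : 0 < n) (hΩ : IsOpen Ω) (hf : ContDiffOn ℝ ∞ f Ω)
    (hnd : ∀ j ∈ Ω, pderiv (pderiv f (Fin.last n)) (Fin.last n) j ≠ 0)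
    {e : Jet (2 * n)} (he : e ∈ jetDom Ω) (s : ℝ) :
    retr f (e + s • topVec n) = retr f e := by
  have h0 : hess f e ≠ 0 := hnd _ he
  have : corr f (e + s • topVec n) = corr f e + s := by
    rw [corr, corr, elTail_zero_add_topVec hn hΩ hf he, hess_add_topVec hn]
    field_simp
    linear_combination (s * hess f e) * neg_one_pow_sq n
  rw [retr, retr, this]
  module

theorem contDiffAt_retr (hΩ : IsOpen Ω) (hf : ContDiffOn ℝ ∞ f Ω)
    (hnd : ∀ j ∈ Ω, pderiv (pderiv f (Fin.last n)) (Fin.last n) j ≠ 0)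
    {e : Jet (2 * n)} (he : e ∈ jetDom Ω) : ContDiffAt ℝ ∞ (retr f) e :=
  (contDiffOn_retr hΩ hf hnd).contDiffAt ((isOpen_jetDom hΩ).mem_nhds he)

theorem fderiv_retr (hΩ : IsOpen Ω) (hf : ContDiffOn ℝ ∞ f Ω)
    (hnd : ∀ j ∈ Ω, pderiv (pderiv f (Fin.last n)) (Fin.last n) j ≠ 0)
    {e : Jet (2 * n)} (he : e ∈ jetDom Ω) (w : Jet (2 * n)) :
    ∃ c : ℝ, fderiv ℝ (retr f) e w = w - c • topVec n := by
  have hc : ContDiffOn ℝ ∞ (corr f) (jetDom Ω) :=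
    (contDiffOn_const.mul (hasTop_elTail hΩ hf 0 (by omega)).smooth).div
      (contDiffOn_hess hΩ hf) fun e he => hnd _ he
  have h1 := ((hc.contDiffAt ((isOpen_jetDom hΩ).mem_nhds he)).differentiableAt
    (by simp)).hasFDerivAt
  have h2 : HasFDerivAt (retr f) _ e := (hasFDerivAt_id e).sub (h1.smul_const (topVec n))
  exact ⟨fderiv ℝ (corr f) e w, by rw [h2.fderiv]; simp⟩

theorem fderiv_retr_topVec (hn : 0 < n) (hΩ : IsOpen Ω) (hf : ContDiffOn ℝ ∞ f Ω)
    (hnd : ∀ j ∈ Ω, pderiv (pderiv f (Fin.last n)) (Fin.last n) j ≠ 0)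
    {e : Jet (2 * n)} (he : e ∈ jetDom Ω) : fderiv ℝ (retr f) e (topVec n) = 0 := by
  have h1 : HasFDerivAt (retr f) (fderiv ℝ (retr f) e) (e + (0 : ℝ) • topVec n) := by
    simpa using ((contDiffAt_retr hΩ hf hnd he).differentiableAt (by simp)).hasFDerivAt
  have hl : HasDerivAt (fun t : ℝ => e + t • topVec n) (topVec n) 0 := by
    simpa using ((hasDerivAt_id (0 : ℝ)).smul_const (topVec n)).const_add e
  have h2 := h1.comp_hasDerivAt (0 : ℝ) hl
  have h3 : (retr f ∘ fun t : ℝ => e + t • topVec n) = fun _ => retr f e :=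
    funext fun t => retr_add_topVec hn hΩ hf hnd he t
  rw [h3] at h2
  exact h2.unique (hasDerivAt_const _ _)

/-- `retr f e` is a translate of `e` along `∂_{y_{2n}}`, and `retr` is invariant under such
translations. Tangent spaces at points of `𝓔` can then be computed at any `e` above them. -/
theorem fderiv_retr_retr (hn : 0 < n) (hΩ : IsOpen Ω) (hf : ContDiffOn ℝ ∞ f Ω)
    (hnd : ∀ j ∈ Ω, pderiv (pderiv f (Fin.last n)) (Fin.last n) j ≠ 0)
    {e : Jet (2 * n)} (he : e ∈ jetDom Ω) :
    fderiv ℝ (retr f) (retr f e) = fderiv ℝ (retr f) e := by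
  rw [retr_eq_add, ← fderiv_comp_add_right]
  refine Filter.EventuallyEq.fderiv_eq ?_
  exact Filter.mem_of_superset ((isOpen_jetDom hΩ).mem_nhds he) fun y hy =>
    retr_add_topVec hn hΩ hf hnd hy _

/-- The tangent space of the Euler-Lagrange equation. -/
theorem mem_tangent_ELset (hn : 0 < n) (hΩ : IsOpen Ω) (hf : ContDiffOn ℝ ∞ f Ω)
    (hnd : ∀ j ∈ Ω, pderiv (pderiv f (Fin.last n)) (Fin.last n) j ≠ 0)
    {e : Jet (2 * n)} (he : e ∈ jetDom Ω) (v : Jet (2 * n)) :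
    v ∈ tangent (ELset Ω f) (retr f e) ↔ fderiv ℝ (retr f) e v = v := by
  have hm := retr_mem hn hΩ hf hnd he
  rw [mem_tangent_iff_of_retraction (retr_of_mem hm)
    (contDiffAt_retr hΩ hf hnd (mem_ELset_iff.1 hm).1) _
    (Eventually.of_forall fun y hy => retr_of_mem hy), fderiv_retr_retr hn hΩ hf hnd he]
  exact Filter.mem_of_superset ((isOpen_jetDom hΩ).mem_nhds (mem_ELset_iff.1 hm).1) fun y hy =>
    retr_mem hn hΩ hf hnd hy

theorem fderiv_retr_mem_tangent (hn : 0 < n) (hΩ : IsOpen Ω) (hf : ContDiffOn ℝ ∞ f Ω)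
    (hnd : ∀ j ∈ Ω, pderiv (pderiv f (Fin.last n)) (Fin.last n) j ≠ 0)
    {e : Jet (2 * n)} (he : e ∈ jetDom Ω) (w : Jet (2 * n)) :
    fderiv ℝ (retr f) e w ∈ tangent (ELset Ω f) (retr f e) := by
  rw [mem_tangent_ELset hn hΩ hf hnd he]
  obtain ⟨c, hc⟩ := fderiv_retr hΩ hf hnd he w
  conv_lhs => rw [hc, map_sub, map_smul, fderiv_retr_topVec hn hΩ hf hnd he, smul_zero, sub_zero]

/-- The total derivative field of the equation, in the coordinates `x, y_0, …, y_{2n-1}`. -/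
def flowVec (f : Jet n → ℝ) (e : Jet (2 * n)) : Jet (2 * n) := jetShift (retr f e)

theorem flowVec_x (e : Jet (2 * n)) : (flowVec f e).1 = 1 := rfl

theorem sub_smul_topVec_snd (w : Jet (2 * n)) (c : ℝ) (i : Fin (2 * n)) :
    (w - c • topVec n).2 i.castSucc = w.2 i.castSucc := by
  have : Fin.castSucc i ≠ Fin.last (2 * n) := (Fin.castSucc_lt_last i).ne
  simp [topVec, dY, this]

theorem sub_smul_topVec_fst (w : Jet (2 * n)) (c : ℝ) : (w - c • topVec n).1 = w.1 := by
  simp [topVec, dY]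

theorem eq_smul_topVec {w : Jet (2 * n)} (hx : w.1 = 0)
    (h : ∀ i : Fin (2 * n), w.2 i.castSucc = 0) : w = w.2 (Fin.last _) • topVec n := by
  refine Prod.ext (by simp [hx, topVec, dY]) (funext fun i => ?_)
  refine Fin.lastCases ?_ (fun i => ?_) i
  · simp [topVec, dY]
  · rw [h]
    have : Fin.castSucc i ≠ Fin.last (2 * n) := (Fin.castSucc_lt_last i).ne
    simp [topVec, dY, this]

theorem mem_cartan_iff {k : ℕ} (j v : Jet k) :
    v ∈ cartan j ↔ ∀ i : Fin k, v.2 i.castSucc = j.2 i.succ * v.1 := by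
  simp [cartan, Submodule.mem_iInf, sub_eq_zero]

/-- The contact forms determine a vector from its `x`-component up to a multiple of `∂_{y_{2n}}`,
and applying `d(retr)`, which kills that multiple and fixes tangent vectors, removes the ambiguity.
-/
theorem mem_solDist_iff (hn : 0 < n) (hΩ : IsOpen Ω) (hf : ContDiffOn ℝ ∞ f Ω)
    (hnd : ∀ j ∈ Ω, pderiv (pderiv f (Fin.last n)) (Fin.last n) j ≠ 0)
    {e : Jet (2 * n)} (he : e ∈ jetDom Ω) (v : Jet (2 * n)) :
    v ∈ solDist (ELset Ω f) (retr f e) ↔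
      ∃ c : ℝ, v = c • fderiv ℝ (retr f) e (flowVec f e) := by
  constructor
  · rintro ⟨h1, h2⟩
    have h1 := (mem_cartan_iff _ _).1 h1
    have h2 := (mem_tangent_ELset hn hΩ hf hnd he v).1 h2
    refine ⟨v.1, ?_⟩
    have h3 := eq_smul_topVec (w := v - v.1 • flowVec f e) (by simp [flowVec_x]) (fun i => by
      simp [h1, flowVec, jetShift_castSucc, mul_comm])
    have h4 := congrArg (fderiv ℝ (retr f) e) h3
    rwa [map_sub, h2, map_smul, map_smul, fderiv_retr_topVec hn hΩ hf hnd he, smul_zero,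
      sub_eq_zero] at h4
  · rintro ⟨c, rfl⟩
    refine Submodule.smul_mem _ _ ⟨?_, fderiv_retr_mem_tangent hn hΩ hf hnd he _⟩
    obtain ⟨c, hc⟩ := fderiv_retr hΩ hf hnd he (flowVec f e)
    refine (mem_cartan_iff _ _).2 fun i => ?_
    rw [hc, sub_smul_topVec_snd, sub_smul_topVec_fst, flowVec, jetShift_castSucc]
    simp [jetShift]

/-- The vector `∂_{y_{2n-1}}`. -/
def subTopVec (n : ℕ) : Jet (2 * n) := dY ⟨2 * n - 1, by omega⟩

/-- With `k = 2n` and `i = 1` the projection goes to `J^{2n-2}`, so only the directions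
`∂_{y_{2n-1}}` and `∂_{y_{2n}}` remain, and `d(retr)` kills the second. -/
theorem mem_vertDist_iff (hn : 0 < n) (hΩ : IsOpen Ω) (hf : ContDiffOn ℝ ∞ f Ω)
    (hnd : ∀ j ∈ Ω, pderiv (pderiv f (Fin.last n)) (Fin.last n) j ≠ 0)
    {e : Jet (2 * n)} (he : e ∈ jetDom Ω) (v : Jet (2 * n)) :
    v ∈ vertDist (ELset Ω f) 1 (retr f e) ↔
      ∃ c : ℝ, v = c • fderiv ℝ (retr f) e (subTopVec n) := by
  constructor
  · rintro ⟨h1, h2⟩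
    have h2 := (mem_tangent_ELset hn hΩ hf hnd he v).1 h2
    have hx : v.1 = 0 := congrArg Prod.fst h1
    have hy : ∀ i : Fin (2 * n + 1), (i : ℕ) < 2 * n - 1 → v.2 i = 0 := fun i hi =>
      congrFun (congrArg Prod.snd h1) ⟨i, by omega⟩
    refine ⟨v.2 ⟨2 * n - 1, by omega⟩, ?_⟩
    have h3 := eq_smul_topVec (w := v - v.2 ⟨2 * n - 1, by omega⟩ • subTopVec n)
      (by simp [subTopVec, dY, hx]) (fun i => by
        by_cases hi : i.castSucc = ⟨2 * n - 1, by omega⟩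
        · rw [hi]; simp [subTopVec, dY]
        · have := hy i.castSucc (by
            have : (i : ℕ) ≠ 2 * n - 1 := fun h => hi (Fin.ext h)
            simp; omega)
          simp [subTopVec, dY, hi, this])
    have h4 := congrArg (fderiv ℝ (retr f) e) h3
    rwa [map_sub, h2, map_smul, map_smul, fderiv_retr_topVec hn hΩ hf hnd he, smul_zero,
      sub_eq_zero] at h4
  · rintro ⟨c, rfl⟩
    refine Submodule.smul_mem _ _ ⟨?_, fderiv_retr_mem_tangent hn hΩ hf hnd he _⟩
    obtain ⟨c, hc⟩ := fderiv_retr hΩ hf hnd he (subTopVec n)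
    rw [SetLike.mem_coe, LinearMap.mem_ker, hc]
    refine Prod.ext (by simp [subTopVec, topVec, dY, jetProj]) (funext fun i => ?_)
    have h1 : (i : ℕ) ≠ 2 * n := by omega
    have h2 : (i : ℕ) ≠ 2 * n - 1 := by omega
    simp [subTopVec, topVec, dY, jetProj, Pi.single_apply, Fin.ext_iff, h1, h2]

end Retraction

/-! ### The Legendre map with action coordinate and its differential. -/

section Legendre

variable {n : ℕ} {Ω : Set (Jet n)} {f : Jet n → ℝ}

/-- The covector `-(dz - f dx) + ∑ ξ_j θ_j` with the momenta `ξ_j` of the Legendre transform. -/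
def mom (f : Jet n → ℝ) (e : Jet (2 * n)) : JetZ n →L[ℝ] ℝ :=
  f (projL e) • dxForm - dzForm + ∑ j : Fin n, elTail f (j + 1) e • theta j (projL e, 0)

/-- The parametrization of `𝓗` by the jets of solutions and the coordinate `z`. -/
def legMap (f : Jet n → ℝ) (y : Jet (2 * n) × ℝ) : Cotangent (JetZ n) :=
  ((projL y.1, y.2), mom f y.1)

theorem mom_apply (e : Jet (2 * n)) (v : JetZ n) :
    mom f e v = f (projL e) * v.1.1 - v.2 +
      ∑ j : Fin n, elTail f (j + 1) e * theta j (projL e, 0) v := by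
  simp [mom, sum_apply]

theorem mom_eZ (e : Jet (2 * n)) : mom f e eZ = -1 := by
  rw [mom_apply, Finset.sum_eq_zero]
  · simp [eZ]
  · intro i _
    rw [theta_eZ, mul_zero]

theorem mom_eY_castSucc (e : Jet (2 * n)) (j : Fin n) :
    mom f e (eY j.castSucc) = elTail f (j + 1) e := by
  rw [mom_apply, Finset.sum_eq_single j]
  · rw [theta_eY]; simp [eY]
  · intro i _ hi
    rw [theta_eY, if_neg (fun h => hi (Fin.castSucc_injective n h).symm), mul_zero]
  · simp

theorem mom_eY_last (e : Jet (2 * n)) : mom f e (eY (Fin.last n)) = 0 := by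
  rw [mom_apply, Finset.sum_eq_zero]
  · simp [eY]
  · intro i _
    rw [theta_eY, if_neg (Fin.castSucc_lt_last i).ne', mul_zero]

theorem mom_X1 (e : Jet (2 * n)) (z : ℝ) : mom f e (X1 f (projL e, z)) = 0 := by
  have h : ∀ j : Fin n, theta j (projL e, 0) (X1 f (projL e, z)) = 0 := fun j =>
    theta_X1 (f := f) j (projL e, z)
  simp only [mom_apply, h, mul_zero, Finset.sum_const_zero, add_zero]
  simp [X1, jetShift]

theorem mom_X2 (e : Jet (2 * n)) (q : JetZ n) : mom f e (X2 q) = 0 := mom_eY_last e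

/-- This is the identity `ξ_{n-1} = f_{y_n}`: the last momentum is not free, which is why `Reduced`
stops at `ξ_{n-2}`. -/
theorem mom_X3 (hn : 0 < n) (hΩ : IsOpen Ω) (hf : ContDiffOn ℝ ∞ f Ω) {e : Jet (2 * n)}
    (he : e ∈ jetDom Ω) (z : ℝ) : mom f e (X3 f (projL e, z)) = 0 := by
  have hX : X3 f (projL e, z) = eY (Fin.castSucc ⟨n - 1, by omega⟩) +
      pderiv f (Fin.last n) (projL e) • eZ := by
    rw [X3_eq hn]; simp [eY, eZ]
  rw [hX, map_add, map_smul, mom_eZ, mom_eY_castSucc]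
  simp only [show n - 1 + 1 = n by omega, elTail_last hΩ hf he]
  simp

theorem legMap_mem (hn : 0 < n) (hΩ : IsOpen Ω) (hf : ContDiffOn ℝ ∞ f Ω) {y : Jet (2 * n) × ℝ}
    (hy : y.1 ∈ jetDom Ω) : legMap f y ∈ D2perp (domZ Ω) (lagrDist f) := by
  rw [D2perp_eq hΩ hf]
  refine ⟨hy, fun i => ?_⟩
  fin_cases i
  · exact mom_X1 y.1 y.2
  · exact mom_X2 y.1 0
  · exact mom_X3 hn hΩ hf hy y.2

theorem contDiffOn_mom (hΩ : IsOpen Ω) (hf : ContDiffOn ℝ ∞ f Ω) :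
    ContDiffOn ℝ ∞ (mom f) (jetDom Ω) := by
  have h1 : ContDiffOn ℝ ∞ (fun e => f (projL e)) (jetDom Ω) :=
    hf.comp projL.contDiff.contDiffOn fun _ he => he
  refine ((h1.smul contDiffOn_const).sub contDiffOn_const).add (ContDiffOn.sum fun j _ => ?_)
  refine (hasTop_elTail hΩ hf (j + 1) (by omega)).smooth.smul ?_
  exact ((contDiff_theta j).comp (projL.contDiff.prodMk contDiff_const)).contDiffOn

theorem hasFDerivAt_mom (hΩ : IsOpen Ω) (hf : ContDiffOn ℝ ∞ f Ω) {e : Jet (2 * n)}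
    (he : e ∈ jetDom Ω) : HasFDerivAt (mom f) (fderiv ℝ (mom f) e) e :=
  (((contDiffOn_mom hΩ hf).contDiffAt ((isOpen_jetDom hΩ).mem_nhds he)).differentiableAt
    (by simp)).hasFDerivAt

theorem fderiv_mom_apply (hΩ : IsOpen Ω) (hf : ContDiffOn ℝ ∞ f Ω) {e : Jet (2 * n)}
    (he : e ∈ jetDom Ω) (w : Jet (2 * n)) (v : JetZ n) :
    fderiv ℝ (mom f) e w v = fderiv ℝ (fun e => mom f e v) e w := by
  have := ((hasFDerivAt_mom hΩ hf he).clm_apply (hasFDerivAt_const v e)).fderiv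
  rw [this]; simp

theorem fderiv_mom_eZ (hΩ : IsOpen Ω) (hf : ContDiffOn ℝ ∞ f Ω) {e : Jet (2 * n)}
    (he : e ∈ jetDom Ω) (w : Jet (2 * n)) : fderiv ℝ (mom f) e w eZ = 0 := by
  rw [fderiv_mom_apply hΩ hf he]; simp [mom_eZ]

theorem fderiv_mom_eY_last (hΩ : IsOpen Ω) (hf : ContDiffOn ℝ ∞ f Ω) {e : Jet (2 * n)}
    (he : e ∈ jetDom Ω) (w : Jet (2 * n)) : fderiv ℝ (mom f) e w (eY (Fin.last n)) = 0 := by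
  rw [fderiv_mom_apply hΩ hf he]; simp [mom_eY_last]

theorem fderiv_mom_eY (hΩ : IsOpen Ω) (hf : ContDiffOn ℝ ∞ f Ω) {e : Jet (2 * n)}
    (he : e ∈ jetDom Ω) (w : Jet (2 * n)) (j : Fin n) :
    fderiv ℝ (mom f) e w (eY j.castSucc) = fderiv ℝ (elTail f (j + 1)) e w := by
  rw [fderiv_mom_apply hΩ hf he]; simp only [mom_eY_castSucc]

theorem hasFDerivAt_legMap (hΩ : IsOpen Ω) (hf : ContDiffOn ℝ ∞ f Ω) {y : Jet (2 * n) × ℝ}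
    (hy : y.1 ∈ jetDom Ω) :
    HasFDerivAt (legMap f) ((projL.prodMap (ContinuousLinearMap.id ℝ ℝ)).prod
      ((fderiv ℝ (mom f) y.1).comp (ContinuousLinearMap.fst ℝ _ ℝ))) y :=
  HasFDerivAt.prodMk (f₁ := fun y : Jet (2 * n) × ℝ => (projL y.1, y.2))
    ((projL.prodMap (ContinuousLinearMap.id ℝ ℝ)).hasFDerivAt)
    (HasFDerivAt.comp y (g := mom f) (hasFDerivAt_mom hΩ hf hy) hasFDerivAt_fst)

theorem fderiv_legMap (hΩ : IsOpen Ω) (hf : ContDiffOn ℝ ∞ f Ω) {y : Jet (2 * n) × ℝ}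
    (hy : y.1 ∈ jetDom Ω) (w : Jet (2 * n) × ℝ) :
    fderiv ℝ (legMap f) y w = ((projL w.1, w.2), fderiv ℝ (mom f) y.1 w.1) := by
  rw [(hasFDerivAt_legMap hΩ hf hy).fderiv]; rfl

theorem contDiffAt_legMap (hΩ : IsOpen Ω) (hf : ContDiffOn ℝ ∞ f Ω) {y : Jet (2 * n) × ℝ}
    (hy : y.1 ∈ jetDom Ω) : ContDiffAt ℝ ∞ (legMap f) y := by
  have h1 : ContDiffAt ℝ ∞ (mom f) y.1 :=
    (contDiffOn_mom hΩ hf).contDiffAt ((isOpen_jetDom hΩ).mem_nhds hy)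
  exact ContDiffAt.prodMk (by fun_prop) (h1.comp y contDiffAt_fst)

theorem fderiv_legMap_mem_tangent (hn : 0 < n) (hΩ : IsOpen Ω) (hf : ContDiffOn ℝ ∞ f Ω)
    {y : Jet (2 * n) × ℝ} (hy : y.1 ∈ jetDom Ω) (w : Jet (2 * n) × ℝ) :
    fderiv ℝ (legMap f) y w ∈ tangent (D2perp (domZ Ω) (lagrDist f)) (legMap f y) := by
  have hl := legMap_mem hn hΩ hf hy
  rw [mem_tangent_D2perp hn hΩ hf hl]
  intro i
  have h1 := (hasFDerivAt_quasiImpulse (differentiableAt_frame hΩ hf i hl.1)).differentiableAt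
  have h2 := (h1.hasFDerivAt.comp y (hasFDerivAt_legMap hΩ hf hy)).fderiv
  have h3 : quasiImpulse (frame f i) ∘ legMap f =ᶠ[𝓝 y] fun _ => (0 : ℝ) := by
    have : {y : Jet (2 * n) × ℝ | y.1 ∈ jetDom Ω} ∈ 𝓝 y :=
      ((isOpen_jetDom hΩ).preimage continuous_fst).mem_nhds hy
    refine Filter.mem_of_superset this fun y' hy' => ?_
    have := legMap_mem hn hΩ hf hy'
    rw [D2perp_eq hΩ hf] at this
    exact this.2 i
  rw [h3.fderiv_eq] at h2
  have h4 := congrArg (fun L => L w) h2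
  rw [(hasFDerivAt_legMap hΩ hf hy).fderiv]
  simpa using h4.symm

/-- Hamilton's equations for the momenta along the flow of the Euler-Lagrange equation. -/
theorem fderiv_elTail_flowVec (hn : 2 ≤ n) (hΩ : IsOpen Ω) (hf : ContDiffOn ℝ ∞ f Ω)
    (hnd : ∀ j ∈ Ω, pderiv (pderiv f (Fin.last n)) (Fin.last n) j ≠ 0)
    {e : Jet (2 * n)} (he : e ∈ jetDom Ω) (j : Fin n) :
    fderiv ℝ (elTail f (j + 1)) e (flowVec f e) =
      pderiv f j.castSucc (projL e) - if (j : ℕ) = 0 then 0 else elTail f j e := by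
  -- Correcting `y_{2n}` changes the total derivative only in the direction `∂_{y_{2n-1}}`. Among
  -- the momenta only `ξ_0` feels this, and there the change cancels the Euler–Lagrange expression.
  have hT : flowVec f e = jetShift e - corr f e • subTopVec n := by
    have h1 : shiftL (topVec n) = subTopVec n := by
      have h2 : Fin.last (2 * n) = (⟨2 * n - 1, by omega⟩ : Fin (2 * n)).succ := by
        ext; simp; omega
      rw [topVec, h2, dY, shiftL_single_succ]; rfl
    rw [flowVec, jetShift_eq, jetShift_eq, retr, map_sub, map_smul, h1, add_sub_assoc]
  have h := hasTop_elTail hΩ hf (j + 1) (by omega)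
  have h1 := elTail_eq hΩ hf j.castSucc he
  rw [hT, map_sub, map_smul, subTopVec, ← pderiv_eq]
  rw [Fin.val_castSucc] at h1
  change totalDeriv (elTail f (j + 1)) e - _ = _
  split_ifs with h0
  · have h0' : hess f e ≠ 0 := hnd _ he
    rw [h0] at h h1 ⊢
    rw [h.top e he _ (by simp)]
    have hp : ((-1 : ℝ)) ^ n = (-1) ^ (n - 1) * (-1) := by
      rw [← pow_succ, Nat.sub_add_cancel (by omega)]
    have hp2 := neg_one_pow_sq (n - 1)
    rw [corr, hp, smul_eq_mul, zero_add]
    rw [zero_add] at h1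
    field_simp
    linear_combination h1 + elTail f 0 e * hp2
  · rw [h.zero e he _ (by simp; omega)]
    simp
    linarith

/-- The `y_{n+1}`-component of the flow. -/
def flowU (f : Jet n → ℝ) (e : Jet (2 * n)) : ℝ := (projL (flowVec f e)).2 (Fin.last n)

theorem projL_flowVec (hn : 2 ≤ n) (e : Jet (2 * n)) (z : ℝ) :
    ((projL (flowVec f e), f (projL e)) : JetZ n) =
      X1 f (projL e, z) + flowU f e • X2 (projL e, z) := by
  refine Prod.ext (Prod.ext ?_ (funext fun i => ?_)) ?_
  · simp [X1, X2, projL_apply, jetProj, flowVec, jetShift]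
  · refine Fin.lastCases ?_ (fun i => ?_) i
    · simp [X1, X2, jetShift_last, flowU]
    · have hne : Fin.castSucc i ≠ Fin.last n := (Fin.castSucc_lt_last i).ne
      have h1 : (projL (flowVec f e)).2 i.castSucc = (projL (retr f e)).2 i.succ := by
        have := jetShift_castSucc (retr f e) ⟨i, by omega⟩
        exact this
      rw [projL_retr (by omega)] at h1
      simp [X1, X2, h1, jetShift_castSucc, hne]
  · simp [X1, X2]

/-- The covector part of Hamilton's equations; `X_2` is constant and contributes nothing. The value
on `X_1` comes from tangency to `H_{X_1} = 0`, the others from `fderiv_elTail_flowVec`. -/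
theorem fderiv_mom_flowVec (hn : 2 ≤ n) (hΩ : IsOpen Ω) (hf : ContDiffOn ℝ ∞ f Ω)
    (hnd : ∀ j ∈ Ω, pderiv (pderiv f (Fin.last n)) (Fin.last n) j ≠ 0)
    {e : Jet (2 * n)} (he : e ∈ jetDom Ω) (z : ℝ) :
    fderiv ℝ (mom f) e (flowVec f e) =
      -((mom f e).comp (fderiv ℝ (X1 f) (projL e, z))) := by
  have hn0 : 0 < n := by omega
  have hq : ((projL e, z) : JetZ n) ∈ domZ Ω := he
  refine covector_ext_X1 (f := f) (q := (projL e, z)) ?_ (fun i => ?_) ?_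
  · have h1 := (mem_tangent_D2perp hn0 hΩ hf (legMap_mem hn0 hΩ hf (y := (e, z)) he) _).1
      (fderiv_legMap_mem_tangent hn0 hΩ hf (y := (e, z)) he (flowVec f e, f (projL e))) 0
    rw [fderiv_quasiImpulse (differentiableAt_frame hΩ hf 0 hq), fderiv_legMap hΩ hf he] at h1
    rw [projL_flowVec hn e z] at h1
    have h2 : fderiv ℝ (frame f 0) (legMap f (e, z)).1
        (X1 f (projL e, z) + flowU f e • X2 (projL e, z)) =
        fderiv ℝ (X1 f) (projL e, z) (X1 f (projL e, z)) + flowU f e • X3 f (projL e, z) := by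
      rw [map_add, map_smul]
      exact congrArg₂ _ rfl (congrArg _ (fderiv_X1_X2 hΩ hf hq))
    rw [h2] at h1
    have h3 : (legMap f (e, z)).2 = mom f e := rfl
    rw [h3, map_add, map_smul, mom_X3 hn0 hΩ hf he, smul_zero, add_zero] at h1
    exact eq_neg_of_add_eq_zero_left h1
  · rw [neg_apply, ContinuousLinearMap.comp_apply]
    refine Fin.lastCases ?_ (fun j => ?_) i
    · rw [fderiv_mom_eY_last hΩ hf he]
      have : fderiv ℝ (X1 f) (projL e, z) (eY (Fin.last n)) = X3 f (projL e, z) :=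
        fderiv_X1_X2 hΩ hf hq
      rw [this, mom_X3 hn0 hΩ hf he, neg_zero]
    · rw [fderiv_mom_eY hΩ hf he, fderiv_elTail_flowVec hn hΩ hf hnd he, fderiv_X1 hΩ hf hq]
      have hsplit : ((shiftL (eY j.castSucc : JetZ n).1, fderiv ℝ f (projL e)
          (eY j.castSucc : JetZ n).1) : JetZ n) =
          (shiftL (eY j.castSucc : JetZ n).1, 0) + pderiv f j.castSucc (projL e) • eZ := by
        simp [eZ, pderiv, eY]
      rw [hsplit, map_add, map_smul, mom_eZ]
      obtain ⟨j, hj⟩ := j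
      cases j with
      | zero =>
        have : shiftL (eY (Fin.castSucc ⟨0, hj⟩) : JetZ n).1 = 0 := shiftL_single_zero
        rw [this]
        have h0 : ((((0 : Jet n), (0 : ℝ)) : JetZ n)) = 0 := rfl
        rw [h0, map_zero]
        simp
      | succ j =>
        have : ((shiftL (eY (Fin.castSucc ⟨j + 1, hj⟩) : JetZ n).1, 0) : JetZ n) =
            eY (Fin.castSucc ⟨j, by omega⟩) := by
          have := shiftL_single_succ (⟨j, by omega⟩ : Fin n)
          exact Prod.ext this rfl
        rw [this, mom_eY_castSucc]
        simp
        ring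
  · rw [fderiv_mom_eZ hΩ hf he, neg_apply, ContinuousLinearMap.comp_apply, fderiv_X1 hΩ hf hq]
    have h0 : ((shiftL (eZ : JetZ n).1, fderiv ℝ f (projL e) (eZ : JetZ n).1) : JetZ n) = 0 := by
      simp [eZ]
    rw [h0, map_zero, neg_zero]

theorem legMap_eZ (y : Jet (2 * n) × ℝ) : (legMap f y).2 eZ ≠ 0 := by
  change mom f y.1 eZ ≠ 0
  rw [mom_eZ]; norm_num

/-- The Legendre transform maps the flow to the characteristic distribution. -/
theorem fderiv_legMap_flowVec_mem (hn : 2 ≤ n) (hΩ : IsOpen Ω) (hf : ContDiffOn ℝ ∞ f Ω)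
    (hnd : ∀ j ∈ Ω, pderiv (pderiv f (Fin.last n)) (Fin.last n) j ≠ 0)
    {y : Jet (2 * n) × ℝ} (hy : y.1 ∈ jetDom Ω) :
    fderiv ℝ (legMap f) y (flowVec f y.1, f (projL y.1)) ∈
      charDist (domZ Ω) (lagrDist f) (legMap f y) := by
  have hn0 : 0 < n := by omega
  have hl := legMap_mem hn0 hΩ hf hy
  rw [mem_charDist_iff hn0 hΩ hf hnd hl (legMap_eZ y)]
  refine ⟨(mem_tangent_D2perp hn0 hΩ hf hl _).1 (fderiv_legMap_mem_tangent hn0 hΩ hf hy _),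
    1, flowU f y.1, ?_⟩
  rw [fderiv_legMap hΩ hf hy]
  refine Prod.ext ?_ ?_
  · simp only [one_smul, Prod.fst_add, Prod.smul_fst, hamVec_fst]
    exact projL_flowVec hn y.1 y.2
  · have hX2 : (hamVec X2 (legMap f y)).2 = 0 := by
      exact ContinuousLinearMap.ext fun v => by simp [hamVec, fderiv_X2]
    rw [one_smul, Prod.snd_add, Prod.smul_snd, hX2, smul_zero, add_zero]
    exact fderiv_mom_flowVec hn hΩ hf hnd hy y.2

/-- The momenta `ξ_{n-2}, …, ξ_0` have orders `n+1, …, 2n-1` with invertible leading coefficients.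
This triangular system kills one further component of `w` at a time. -/
theorem eq_zero_of_fderiv_legMap (hn : 2 ≤ n) (hΩ : IsOpen Ω) (hf : ContDiffOn ℝ ∞ f Ω)
    (hnd : ∀ j ∈ Ω, pderiv (pderiv f (Fin.last n)) (Fin.last n) j ≠ 0)
    {e : Jet (2 * n)} (he : e ∈ jetDom Ω) {w : Jet (2 * n)} (hw : projL w = 0)
    (hξ : ∀ j : Fin (n - 1), fderiv ℝ (elTail f (j + 1)) e w = 0) :
    w = w.2 (Fin.last _) • topVec n := by
  have h0 : hess f e ≠ 0 := hnd _ he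
  have hx : w.1 = 0 := congrArg Prod.fst hw
  have key : ∀ t : ℕ, t ≤ n - 1 → ∀ i : Fin (2 * n + 1), (i : ℕ) ≤ n + t → w.2 i = 0 := by
    intro t
    induction t with
    | zero =>
      intro _ i hi
      exact congrFun (congrArg Prod.snd hw) ⟨i, by omega⟩
    | succ t ih =>
      intro ht i hi
      rcases Nat.lt_or_ge (n + t) i with h | h
      -- The tail with index `n - t - 1` has order `n + t + 1`, the first component not yet known to
      -- vanish.
      · have h1 := (hasTop_elTail hΩ hf (n - t - 2 + 1) (by omega)).fderiv_apply he hx (by omega)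
          (fun i' hi' => ih (by omega) i' (by omega))
        rw [hξ ⟨n - t - 2, by omega⟩] at h1
        have h2 : (⟨2 * n - (n - t - 2 + 1), by omega⟩ : Fin (2 * n + 1)) = i :=
          Fin.ext (by simp; omega)
        rw [h2] at h1
        have h3 : ((-1 : ℝ)) ^ (n - (n - t - 2 + 1)) * hess f e ≠ 0 :=
          mul_ne_zero (pow_ne_zero _ (by norm_num)) h0
        exact (mul_eq_zero.1 h1.symm).resolve_right h3
      · exact ih (by omega) i h
  exact eq_smul_topVec hx fun i => key (n - 1) le_rfl _ (by simp; omega)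

/-- Dimension count: the freely prescribable data of a tangent vector with `dν = 0` are its base
part and the components `ξ_0, …, ξ_{n-2}`. Tangency to the three frame conditions determines the
rest. -/
theorem exists_fderiv_legMap_eq (hn : 2 ≤ n) (hΩ : IsOpen Ω) (hf : ContDiffOn ℝ ∞ f Ω)
    (hnd : ∀ j ∈ Ω, pderiv (pderiv f (Fin.last n)) (Fin.last n) j ≠ 0)
    {y : Jet (2 * n) × ℝ} (hy : y.1 ∈ jetDom Ω) {v : Cotangent (JetZ n)}
    (hv : v ∈ tangent (D2perp (domZ Ω) (lagrDist f)) (legMap f y)) (hz : v.2 eZ = 0) :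
    ∃ w : Jet (2 * n), v = fderiv ℝ (legMap f) y (w, v.1.2) := by
  have hn0 : 0 < n := by omega
  -- The last factor records `y_{2n}`, the only direction lost by the Legendre map; both sides then
  -- have dimension `2n + 2`.
  let ℓ : Jet (2 * n) →ₗ[ℝ] Jet n × (Fin (n - 1) → ℝ) × ℝ :=
    (projL (n := n)).toLinearMap.prod
      ((LinearMap.pi fun j : Fin (n - 1) =>
        (fderiv ℝ (elTail f (j + 1)) y.1 : Jet (2 * n) →ₗ[ℝ] ℝ)).prod
        ((LinearMap.proj (Fin.last (2 * n))).comp (LinearMap.snd ℝ ℝ _)))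
  have hℓ : Function.Injective ℓ := by
    rw [← LinearMap.ker_eq_bot, LinearMap.ker_eq_bot']
    intro w hw
    have h1 : projL w = 0 := congrArg Prod.fst hw
    have h2 : ∀ j : Fin (n - 1), fderiv ℝ (elTail f (j + 1)) y.1 w = 0 := fun j =>
      congrFun (congrArg (fun p => p.2.1) hw) j
    have h3 : w.2 (Fin.last _) = 0 := congrArg (fun p => p.2.2) hw
    have := eq_zero_of_fderiv_legMap hn hΩ hf hnd hy h1 h2
    rwa [h3, zero_smul] at this
  have hfr : Module.finrank ℝ (Jet (2 * n)) =
      Module.finrank ℝ (Jet n × (Fin (n - 1) → ℝ) × ℝ) := by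
    simp [Module.finrank_prod]
    omega
  have hs := (LinearMap.injective_iff_surjective_of_finrank_eq_finrank hfr).1 hℓ
  obtain ⟨w, hw⟩ := hs (v.1.1, fun j => v.2 (eY (Fin.castLE (by omega) j)), 0)
  have h1 : projL w = v.1.1 := congrArg Prod.fst hw
  have h2 : ∀ j : Fin (n - 1), fderiv ℝ (elTail f (j + 1)) y.1 w =
      v.2 (eY (Fin.castLE (by omega) j)) := fun j => congrFun (congrArg (fun p => p.2.1) hw) j
  refine ⟨w, ?_⟩
  have hl := legMap_mem hn0 hΩ hf hy
  have hd := sub_mem hv (fderiv_legMap_mem_tangent hn0 hΩ hf hy (w, v.1.2))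
  rw [mem_tangent_D2perp hn0 hΩ hf hl] at hd
  have hfst : (v - fderiv ℝ (legMap f) y (w, v.1.2)).1 = 0 := by
    rw [fderiv_legMap hΩ hf hy]
    simp [h1]
  have hd' : ∀ i, (v - fderiv ℝ (legMap f) y (w, v.1.2)).2 (frame f i (projL y.1, y.2)) = 0 := by
    intro i
    have := hd i
    rw [fderiv_quasiImpulse (differentiableAt_frame hΩ hf i hl.1), hfst] at this
    simp only [map_zero, add_zero] at this
    exact this
  rw [← sub_eq_zero]
  have hsnd : (v - fderiv ℝ (legMap f) y (w, v.1.2)).2 = v.2 - fderiv ℝ (mom f) y.1 w := by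
    rw [fderiv_legMap hΩ hf hy]; rfl
  have hsz : (v - fderiv ℝ (legMap f) y (w, v.1.2)).2 eZ = 0 := by
    rw [hsnd, sub_apply, hz, fderiv_mom_eZ hΩ hf hy, sub_zero]
  refine Prod.ext hfst (covector_ext_X1 (f := f) (q := (projL y.1, y.2)) ?_ (fun i => ?_) ?_)
  · exact (hd' 0).trans (by simp)
  · rw [Prod.snd_zero, zero_apply]
    refine Fin.lastCases (hd' 1) (fun j => ?_) i
    by_cases hj : (j : ℕ) = n - 1
    · have h3 := hd' 2
      have hX : frame f 2 (projL y.1, y.2) = eY (Fin.castSucc j) +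
          pderiv f (Fin.last n) (projL y.1) • eZ := by
        have hj' : j = ⟨n - 1, by omega⟩ := Fin.ext hj
        change X3 f (projL y.1, y.2) = _
        rw [X3_eq hn0, hj']; simp [eY, eZ]
      rwa [hX, map_add, map_smul, hsz, smul_zero, add_zero] at h3
    · have := h2 ⟨j, by omega⟩
      rw [hsnd, sub_apply, fderiv_mom_eY hΩ hf hy]
      rw [sub_eq_zero]
      exact this.symm
  · rw [hsz]; simp

theorem fderiv_mom_topVec (hn : 2 ≤ n) (hΩ : IsOpen Ω) (hf : ContDiffOn ℝ ∞ f Ω)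
    {y : Jet (2 * n) × ℝ} (hy : y.1 ∈ jetDom Ω) :
    fderiv ℝ (legMap f) y (topVec n, 0) = 0 := by
  have hn0 : 0 < n := by omega
  have hd := (mem_tangent_D2perp hn0 hΩ hf (legMap_mem hn0 hΩ hf hy) _).1
    (fderiv_legMap_mem_tangent hn0 hΩ hf hy (topVec n, 0)) 0
  have hl := legMap_mem hn0 hΩ hf hy
  rw [fderiv_quasiImpulse (differentiableAt_frame hΩ hf 0 hl.1), fderiv_legMap hΩ hf hy,
    projL_topVec hn0] at hd
  rw [fderiv_legMap hΩ hf hy, projL_topVec hn0]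
  refine Prod.ext rfl (covector_ext_X1 (f := f) (q := (projL y.1, y.2)) ?_ (fun i => ?_) ?_)
  · have h0 : ((((0 : Jet n), (0 : ℝ)) : JetZ n)) = 0 := rfl
    simp only [h0, map_zero, add_zero] at hd
    exact hd.trans (by simp)
  · rw [Prod.snd_zero, zero_apply]
    refine Fin.lastCases (fderiv_mom_eY_last hΩ hf hy _) (fun j => ?_) i
    rw [fderiv_mom_eY hΩ hf hy]
    exact (hasTop_elTail hΩ hf (j + 1) (by omega)).zero _ hy _ (by simp; omega)
  · simp [fderiv_mom_eZ hΩ hf hy]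

/-- The image of `∂_{y_{2n-1}}` is the covector `± f_{y_n y_n} θ_0`. -/
theorem fderiv_legMap_subTopVec (hn : 2 ≤ n) (hΩ : IsOpen Ω) (hf : ContDiffOn ℝ ∞ f Ω)
    {y : Jet (2 * n) × ℝ} (hy : y.1 ∈ jetDom Ω) :
    fderiv ℝ (legMap f) y (subTopVec n, 0) =
      ((-1) ^ (n - 1) * hess f y.1) •
        ((0, theta ⟨0, by omega⟩ (legMap f y).1) : Cotangent (JetZ n)) := by
  have hn0 : 0 < n := by omega
  have hp : projL (subTopVec n) = 0 := by
    rw [subTopVec, projL_dY, dif_neg (by simp; omega)]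
  have hl := legMap_mem hn0 hΩ hf hy
  have hd := (mem_tangent_D2perp hn0 hΩ hf hl _).1
    (fderiv_legMap_mem_tangent hn0 hΩ hf hy (subTopVec n, 0)) 0
  rw [fderiv_quasiImpulse (differentiableAt_frame hΩ hf 0 hl.1), fderiv_legMap hΩ hf hy,
    hp] at hd
  rw [fderiv_legMap hΩ hf hy, hp]
  refine Prod.ext (by simp)
    (covector_ext_X1 (f := f) (q := (projL y.1, y.2)) ?_ (fun i => ?_) ?_)
  · have h0 : ((((0 : Jet n), (0 : ℝ)) : JetZ n)) = 0 := rfl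
    simp only [h0, map_zero, add_zero] at hd
    refine hd.trans ?_
    rw [Prod.smul_snd, smul_apply]
    have : theta ⟨0, hn0⟩ (legMap f y).1 (X1 f (projL y.1, y.2)) = 0 := theta_X1 _ _
    rw [this, smul_zero]
  · rw [Prod.smul_snd, smul_apply, theta_eY]
    refine Fin.lastCases ?_ (fun j => ?_) i
    · rw [fderiv_mom_eY_last hΩ hf hy, if_neg (Fin.castSucc_lt_last _).ne', smul_zero]
    · rw [fderiv_mom_eY hΩ hf hy]
      have h := hasTop_elTail hΩ hf (j + 1) (by omega)
      -- The momentum `ξ_j` has order `2n - 1 - j`, so `∂_{y_{2n-1}}` moves `ξ_0` only.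
      by_cases hj : (j : ℕ) = 0
      · have hj' : j = ⟨0, hn0⟩ := Fin.ext hj
        rw [if_pos (by rw [hj']), smul_eq_mul, mul_one]
        have := h.top _ hy ⟨2 * n - 1, by omega⟩ (by simp [hj])
        rw [hj] at this ⊢
        exact this
      · rw [if_neg (fun h => hj (by
          have := congrArg Fin.val h
          simpa using this)), smul_zero]
        exact h.zero _ hy _ (by simp; omega)
  · simp [fderiv_mom_eZ hΩ hf hy, theta_eZ]

end Legendre

/-! ### Both linearizations as images of the same vector of `J^{2n}`. -/

section Linearizations

variable {n : ℕ} {Ω : Set (Jet n)} {f : Jet n → ℝ}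
variable {Q : Type*} [NormedAddCommGroup Q] [NormedSpace ℝ Q]

/-! ### The space of solutions -/

theorem hasFDerivAt_comp_retr (hΩ : IsOpen Ω) (hf : ContDiffOn ℝ ∞ f Ω)
    (hnd : ∀ j ∈ Ω, pderiv (pderiv f (Fin.last n)) (Fin.last n) j ≠ 0)
    {U : Set (Jet (2 * n))} {pr : Jet (2 * n) → Q}
    (hpr : IsLeafProjection (ELset Ω f) (solDist (ELset Ω f)) U pr)
    {e : Jet (2 * n)} (he : e ∈ jetDom Ω) (hU : retr f e ∈ U) :
    HasFDerivAt (fun e => pr (retr f e))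
      ((fderiv ℝ pr (retr f e)).comp (fderiv ℝ (retr f) e)) e :=
  HasFDerivAt.comp e (g := pr)
    (((hpr.smooth.contDiffAt (hpr.isOpen.mem_nhds hU)).differentiableAt (by simp)).hasFDerivAt)
    ((contDiffAt_retr hΩ hf hnd he).differentiableAt (by simp)).hasFDerivAt

theorem fderiv_comp_retr_flowVec (hn : 0 < n) (hΩ : IsOpen Ω) (hf : ContDiffOn ℝ ∞ f Ω)
    (hnd : ∀ j ∈ Ω, pderiv (pderiv f (Fin.last n)) (Fin.last n) j ≠ 0)
    {U : Set (Jet (2 * n))} {pr : Jet (2 * n) → Q}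
    (hpr : IsLeafProjection (ELset Ω f) (solDist (ELset Ω f)) U pr)
    {e : Jet (2 * n)} (he : e ∈ jetDom Ω) (hU : retr f e ∈ U) :
    fderiv ℝ (fun e => pr (retr f e)) e (flowVec f e) = 0 := by
  rw [(hasFDerivAt_comp_retr hΩ hf hnd hpr he hU).fderiv]
  exact (hpr.ker _ ⟨retr_mem hn hΩ hf hnd he, hU⟩ _
    (fderiv_retr_mem_tangent hn hΩ hf hnd he _)).2
    ((mem_solDist_iff hn hΩ hf hnd he _).2 ⟨1, (one_smul _ _).symm⟩)

/-- Besides the leaf direction the kernel contains `∂_{y_{2n}}`, since the leaf projection is pulled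
back from `𝓔` to `J^{2n}`. It is the same kernel as in `abnLin_eq_zero_iff`. -/
theorem fderiv_comp_retr_eq_zero_iff (hn : 0 < n) (hΩ : IsOpen Ω) (hf : ContDiffOn ℝ ∞ f Ω)
    (hnd : ∀ j ∈ Ω, pderiv (pderiv f (Fin.last n)) (Fin.last n) j ≠ 0)
    {U : Set (Jet (2 * n))} {pr : Jet (2 * n) → Q}
    (hpr : IsLeafProjection (ELset Ω f) (solDist (ELset Ω f)) U pr)
    {e : Jet (2 * n)} (he : e ∈ jetDom Ω) (hU : retr f e ∈ U) (w : Jet (2 * n)) :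
    fderiv ℝ (fun e => pr (retr f e)) e w = 0 ↔
      ∃ c s : ℝ, w = c • flowVec f e + s • topVec n := by
  have h0 := fderiv_comp_retr_flowVec hn hΩ hf hnd hpr he hU
  have h := (hasFDerivAt_comp_retr hΩ hf hnd hpr he hU).fderiv
  constructor
  · intro hw
    rw [h] at hw
    obtain ⟨c, hc⟩ := (mem_solDist_iff hn hΩ hf hnd he _).1
      ((hpr.ker _ ⟨retr_mem hn hΩ hf hnd he, hU⟩ _
        (fderiv_retr_mem_tangent hn hΩ hf hnd he w)).1 hw)
    obtain ⟨s, hs⟩ := fderiv_retr hΩ hf hnd he (w - c • flowVec f e)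
    rw [map_sub, map_smul, hc, sub_self, eq_comm, sub_eq_zero] at hs
    exact ⟨c, s, by rw [← hs]; abel⟩
  · rintro ⟨c, s, rfl⟩
    rw [map_add, map_smul, map_smul, h0, h, ContinuousLinearMap.comp_apply,
      fderiv_retr_topVec hn hΩ hf hnd he]
    simp

theorem fderiv_comp_retr_surjective (hn : 0 < n) (hΩ : IsOpen Ω) (hf : ContDiffOn ℝ ∞ f Ω)
    (hnd : ∀ j ∈ Ω, pderiv (pderiv f (Fin.last n)) (Fin.last n) j ≠ 0)
    {U : Set (Jet (2 * n))} {pr : Jet (2 * n) → Q}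
    (hpr : IsLeafProjection (ELset Ω f) (solDist (ELset Ω f)) U pr)
    {e : Jet (2 * n)} (he : e ∈ jetDom Ω) (hU : retr f e ∈ U) :
    Function.Surjective (fderiv ℝ (fun e => pr (retr f e)) e) := by
  intro q
  have hq : q ∈ (tangent (ELset Ω f) (retr f e)).map
      (fderiv ℝ pr (retr f e) : Jet (2 * n) →ₗ[ℝ] Q) := by
    rw [hpr.surj _ ⟨retr_mem hn hΩ hf hnd he, hU⟩]; trivial
  obtain ⟨v, hv, rfl⟩ := hq
  refine ⟨v, ?_⟩
  rw [(hasFDerivAt_comp_retr hΩ hf hnd hpr he hU).fderiv, ContinuousLinearMap.comp_apply,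
    (mem_tangent_ELset hn hΩ hf hnd he v).1 hv]
  rfl

theorem linearization_vertDist (hn : 0 < n) (hΩ : IsOpen Ω) (hf : ContDiffOn ℝ ∞ f Ω)
    (hnd : ∀ j ∈ Ω, pderiv (pderiv f (Fin.last n)) (Fin.last n) j ≠ 0)
    {U : Set (Jet (2 * n))} {pr : Jet (2 * n) → Q}
    (hpr : IsLeafProjection (ELset Ω f) (solDist (ELset Ω f)) U pr)
    {e : Jet (2 * n)} (he : e ∈ jetDom Ω) (hU : retr f e ∈ U) :
    linearization pr (vertDist (ELset Ω f) 1) (retr f e) =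
      Submodule.span ℝ {fderiv ℝ (fun e => pr (retr f e)) e (subTopVec n)} := by
  have h := (hasFDerivAt_comp_retr hΩ hf hnd hpr he hU).fderiv
  ext q
  rw [Submodule.mem_span_singleton, h]
  constructor
  · rintro ⟨v, hv, rfl⟩
    obtain ⟨c, rfl⟩ := (mem_vertDist_iff hn hΩ hf hnd he v).1 hv
    exact ⟨c, by simp⟩
  · rintro ⟨c, rfl⟩
    exact ⟨c • fderiv ℝ (retr f) e (subTopVec n),
      (mem_vertDist_iff hn hΩ hf hnd he _).2 ⟨c, rfl⟩, by simp⟩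

/-! ### The space of abnormal extremals -/

/-- The pull-back of `λ_0 dx + ∑ ξ_i dy_i` to the space of jets. -/
def legForm (f : Jet n → ℝ) (e : Jet (2 * n)) : Jet (2 * n) →L[ℝ] ℝ :=
  (mom f e).comp ((ContinuousLinearMap.inl ℝ (Jet n) ℝ).comp projL)

theorem legForm_apply (e w : Jet (2 * n)) : legForm f e w = mom f e (projL w, 0) := rfl

theorem mom_apply_pair (e w : Jet (2 * n)) (c : ℝ) :
    mom f e (projL w, c) = legForm f e w - c := by
  have : ((projL w, c) : JetZ n) = (projL w, 0) + c • eZ := by simp [eZ]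
  rw [this, map_add, map_smul, mom_eZ, legForm_apply]; simp; ring

theorem mom_flowVec (hn : 2 ≤ n) (e : Jet (2 * n)) :
    mom f e (projL (flowVec f e), f (projL e)) = 0 := by
  rw [projL_flowVec hn e 0, map_add, map_smul, mom_X1, mom_X2]; simp

theorem legForm_flowVec (hn : 2 ≤ n) (e : Jet (2 * n)) :
    legForm f e (flowVec f e) = f (projL e) := by
  have := mom_flowVec (f := f) hn e
  rw [mom_apply_pair] at this
  linarith

theorem contDiffOn_flowVec (hΩ : IsOpen Ω) (hf : ContDiffOn ℝ ∞ f Ω)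
    (hnd : ∀ j ∈ Ω, pderiv (pderiv f (Fin.last n)) (Fin.last n) j ≠ 0) :
    ContDiffOn ℝ ∞ (flowVec f) (jetDom Ω) :=
  contDiff_jetShift.comp_contDiffOn (contDiffOn_retr hΩ hf hnd)

/-- The Lie derivative of the Legendre form along the flow is `df`. -/
theorem fderiv_legForm (hn : 2 ≤ n) (hΩ : IsOpen Ω) (hf : ContDiffOn ℝ ∞ f Ω)
    (hnd : ∀ j ∈ Ω, pderiv (pderiv f (Fin.last n)) (Fin.last n) j ≠ 0)
    {e : Jet (2 * n)} (he : e ∈ jetDom Ω) (w : Jet (2 * n)) :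
    DifferentiableAt ℝ (legForm f) e ∧
    fderiv ℝ (legForm f) e (flowVec f e) w + legForm f e (fderiv ℝ (flowVec f) e w) =
      fderiv ℝ (fun e => f (projL e)) e w := by
  have hn0 : 0 < n := by omega
  let c := (ContinuousLinearMap.compL ℝ (Jet (2 * n)) (JetZ n) ℝ).flip
    ((ContinuousLinearMap.inl ℝ (Jet n) ℝ).comp projL)
  have hm := hasFDerivAt_mom hΩ hf he
  have h1 : HasFDerivAt (legForm f) (c.comp (fderiv ℝ (mom f) e)) e :=
    HasFDerivAt.comp e (g := c) c.hasFDerivAt hm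
  refine ⟨h1.differentiableAt, ?_⟩
  have h2 : fderiv ℝ (legForm f) e (flowVec f e) w =
      fderiv ℝ (mom f) e (flowVec f e) (projL w, 0) := by
    rw [h1.fderiv]; rfl
  have hT : HasFDerivAt (flowVec f) (fderiv ℝ (flowVec f) e) e :=
    (((contDiffOn_flowVec hΩ hf hnd).contDiffAt
      ((isOpen_jetDom hΩ).mem_nhds he)).differentiableAt (by simp)).hasFDerivAt
  have hF : HasFDerivAt (fun e => f (projL e)) (fderiv ℝ (fun e => f (projL e)) e) e :=
    ((hasTop_comp_projL hΩ hf).differentiableAt (isOpen_jetDom hΩ) he).hasFDerivAt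
  have hX : HasFDerivAt (fun e => ((projL (flowVec f e), f (projL e)) : JetZ n))
      ((projL.comp (fderiv ℝ (flowVec f) e)).prod (fderiv ℝ (fun e => f (projL e)) e)) e :=
    (projL.hasFDerivAt.comp e hT).prodMk hF
  have h3 := hm.clm_apply hX
  have h4 : (fun e => mom f e ((projL (flowVec f e), f (projL e)) : JetZ n)) = fun _ => 0 :=
    funext fun e => mom_flowVec hn e
  rw [h4] at h3
  have h5 := congrArg (fun L => L w) (h3.unique (hasFDerivAt_const _ _))
  simp only [add_apply, ContinuousLinearMap.comp_apply, ContinuousLinearMap.flip_apply,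
    ContinuousLinearMap.prod_apply, zero_apply] at h5
  rw [mom_apply_pair] at h5
  -- The image of `T + f ∂_z` is characteristic, hence `σ`-orthogonal to the image of `(w, 0)`.
  -- Combined with the derivative of the identity `mom(T, f) = 0`, this is the claimed formula.
  have hchar := (fderiv_legMap_flowVec_mem hn hΩ hf hnd (y := (e, 0)) he).2 _
    (fderiv_legMap_mem_tangent hn0 hΩ hf (y := (e, 0)) he (w, 0))
  rw [fderiv_legMap hΩ hf he, fderiv_legMap hΩ hf he, sigma] at hchar
  dsimp only at hchar
  linarith

/-- Where `ν ≠ 0`, every point of `(D^2)^⊥` is regular, so the two sets agree locally. -/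
theorem tangent_regPart (hΩ : IsOpen Ω) (hf : ContDiffOn ℝ ∞ f Ω)
    (hnd : ∀ j ∈ Ω, pderiv (pderiv f (Fin.last n)) (Fin.last n) j ≠ 0)
    {l : Cotangent (JetZ n)} (hν : l.2 eZ ≠ 0) :
    tangent (regPart (domZ Ω) (lagrDist f)) l = tangent (D2perp (domZ Ω) (lagrDist f)) l := by
  have hνev : ∀ᶠ y : Cotangent (JetZ n) in 𝓝 l, y.2 eZ ≠ 0 := by
    have : ContinuousAt (fun y : Cotangent (JetZ n) => y.2 eZ) l := by fun_prop
    exact this.eventually_ne hν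
  exact tangent_congr (hνev.mono fun y hy => ⟨fun h => h.1, fun h => mem_regPart hΩ hf hnd h hy⟩)

/-- `X_1` and `X_2` do not depend on `z`, so `ν` is preserved along `𝓒`, whereas dilations change
it. -/
theorem charDist_eZ (hn : 0 < n) (hΩ : IsOpen Ω) (hf : ContDiffOn ℝ ∞ f Ω)
    (hnd : ∀ j ∈ Ω, pderiv (pderiv f (Fin.last n)) (Fin.last n) j ≠ 0)
    {l : Cotangent (JetZ n)} (hl : l ∈ D2perp (domZ Ω) (lagrDist f)) (hν : l.2 eZ ≠ 0)
    {v : Cotangent (JetZ n)} (hv : v ∈ charDist (domZ Ω) (lagrDist f) l) : v.2 eZ = 0 := by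
  obtain ⟨-, a, b, rfl⟩ := (mem_charDist_iff hn hΩ hf hnd hl hν v).1 hv
  have h1 : fderiv ℝ (X1 f) l.1 eZ = 0 := by
    rw [fderiv_X1 hΩ hf hl.1]; simp [eZ]
  simp [hamVec, h1, fderiv_X2]

theorem ker_iff_of_isAbnProjection (hΩ : IsOpen Ω) (hf : ContDiffOn ℝ ∞ f Ω)
    (hnd : ∀ j ∈ Ω, pderiv (pderiv f (Fin.last n)) (Fin.last n) j ≠ 0)
    {U : Set (Cotangent (JetZ n))} {pr : Cotangent (JetZ n) → Q}
    (hpr : IsAbnProjection (domZ Ω) (lagrDist f) U pr)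
    {l : Cotangent (JetZ n)} (hl : l ∈ D2perp (domZ Ω) (lagrDist f)) (hν : l.2 eZ ≠ 0)
    (hU : l ∈ U) {v : Cotangent (JetZ n)}
    (hv : v ∈ tangent (D2perp (domZ Ω) (lagrDist f)) l) :
    fderiv ℝ pr l v = 0 ↔ v ∈ charDist (domZ Ω) (lagrDist f) l ⊔ euler l :=
  hpr.leaf.ker l ⟨mem_regPart hΩ hf hnd hl hν, hU⟩ v (by rwa [tangent_regPart hΩ hf hnd hν])

theorem fderiv_euler (hn : 0 < n) (hΩ : IsOpen Ω) (hf : ContDiffOn ℝ ∞ f Ω)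
    (hnd : ∀ j ∈ Ω, pderiv (pderiv f (Fin.last n)) (Fin.last n) j ≠ 0)
    {U : Set (Cotangent (JetZ n))} {pr : Cotangent (JetZ n) → Q}
    (hpr : IsAbnProjection (domZ Ω) (lagrDist f) U pr)
    {l : Cotangent (JetZ n)} (hl : l ∈ D2perp (domZ Ω) (lagrDist f)) (hν : l.2 eZ ≠ 0)
    (hU : l ∈ U) : fderiv ℝ pr l ((0, l.2) : Cotangent (JetZ n)) = 0 :=
  (ker_iff_of_isAbnProjection hΩ hf hnd hpr hl hν hU (euler_mem_tangent hn hΩ hf hl)).2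
    (Submodule.mem_sup_right (Submodule.subset_span rfl))

theorem fderiv_charDist (hΩ : IsOpen Ω) (hf : ContDiffOn ℝ ∞ f Ω)
    (hnd : ∀ j ∈ Ω, pderiv (pderiv f (Fin.last n)) (Fin.last n) j ≠ 0)
    {U : Set (Cotangent (JetZ n))} {pr : Cotangent (JetZ n) → Q}
    (hpr : IsAbnProjection (domZ Ω) (lagrDist f) U pr)
    {l : Cotangent (JetZ n)} (hl : l ∈ D2perp (domZ Ω) (lagrDist f)) (hν : l.2 eZ ≠ 0)
    (hU : l ∈ U) {v : Cotangent (JetZ n)} (hv : v ∈ charDist (domZ Ω) (lagrDist f) l) :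
    fderiv ℝ pr l v = 0 :=
  (ker_iff_of_isAbnProjection hΩ hf hnd hpr hl hν hU hv.1).2 (Submodule.mem_sup_left hv)

theorem hasFDerivAt_comp_legMap (hΩ : IsOpen Ω) (hf : ContDiffOn ℝ ∞ f Ω)
    {U : Set (Cotangent (JetZ n))} {pr : Cotangent (JetZ n) → Q}
    (hpr : IsAbnProjection (domZ Ω) (lagrDist f) U pr)
    {y : Jet (2 * n) × ℝ} (hy : y.1 ∈ jetDom Ω) (hU : legMap f y ∈ U) :
    HasFDerivAt (fun y => pr (legMap f y))
      ((fderiv ℝ pr (legMap f y)).comp (fderiv ℝ (legMap f) y)) y :=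
  HasFDerivAt.comp y (g := pr)
    (((hpr.leaf.smooth.contDiffAt (hpr.leaf.isOpen.mem_nhds hU)).differentiableAt
      (by simp)).hasFDerivAt)
    ((contDiffAt_legMap hΩ hf hy).differentiableAt (by simp)).hasFDerivAt

theorem fderiv_comp_legMap_flowVec (hn : 2 ≤ n) (hΩ : IsOpen Ω) (hf : ContDiffOn ℝ ∞ f Ω)
    (hnd : ∀ j ∈ Ω, pderiv (pderiv f (Fin.last n)) (Fin.last n) j ≠ 0)
    {U : Set (Cotangent (JetZ n))} {pr : Cotangent (JetZ n) → Q}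
    (hpr : IsAbnProjection (domZ Ω) (lagrDist f) U pr)
    {y : Jet (2 * n) × ℝ} (hy : y.1 ∈ jetDom Ω) (hU : legMap f y ∈ U) :
    fderiv ℝ (fun y => pr (legMap f y)) y (flowVec f y.1, f (projL y.1)) = 0 := by
  rw [(hasFDerivAt_comp_legMap hΩ hf hpr hy hU).fderiv]
  exact fderiv_charDist hΩ hf hnd hpr (legMap_mem (by omega) hΩ hf hy) (legMap_eZ y) hU
    (fderiv_legMap_flowVec_mem hn hΩ hf hnd hy)

/-- The map from jets of infinitesimal deformations of solutions to deformations of abnormal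
extremals tangent to `Δ`. -/
def abnLin (f : Jet n → ℝ) (pr : Cotangent (JetZ n) → Q) (y : Jet (2 * n) × ℝ) :
    Jet (2 * n) →L[ℝ] Q :=
  (fderiv ℝ (fun y => pr (legMap f y)) y).comp
    ((ContinuousLinearMap.id ℝ (Jet (2 * n))).prod (legForm f y.1))

theorem abnLin_apply (hΩ : IsOpen Ω) (hf : ContDiffOn ℝ ∞ f Ω)
    {U : Set (Cotangent (JetZ n))} {pr : Cotangent (JetZ n) → Q}
    (hpr : IsAbnProjection (domZ Ω) (lagrDist f) U pr)
    {y : Jet (2 * n) × ℝ} (hy : y.1 ∈ jetDom Ω) (hU : legMap f y ∈ U) (w : Jet (2 * n)) :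
    abnLin f pr y w =
      fderiv ℝ pr (legMap f y) (fderiv ℝ (legMap f) y (w, legForm f y.1 w)) := by
  rw [abnLin, (hasFDerivAt_comp_legMap hΩ hf hpr hy hU).fderiv]; rfl

/-- The image of `w` lies in `{dν = 0}`, so if it belongs to `𝓒` plus the dilation direction it has
no dilation part. It is then `w.1` times the image of `T + f ∂_z`, and the Legendre map loses only
`∂_{y_{2n}}`. -/
theorem abnLin_eq_zero_iff (hn : 2 ≤ n) (hΩ : IsOpen Ω) (hf : ContDiffOn ℝ ∞ f Ω)
    (hnd : ∀ j ∈ Ω, pderiv (pderiv f (Fin.last n)) (Fin.last n) j ≠ 0)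
    {U : Set (Cotangent (JetZ n))} {pr : Cotangent (JetZ n) → Q}
    (hpr : IsAbnProjection (domZ Ω) (lagrDist f) U pr)
    {y : Jet (2 * n) × ℝ} (hy : y.1 ∈ jetDom Ω) (hU : legMap f y ∈ U) (w : Jet (2 * n)) :
    abnLin f pr y w = 0 ↔ ∃ c s : ℝ, w = c • flowVec f y.1 + s • topVec n := by
  have hn0 : 0 < n := by omega
  have hl := legMap_mem hn0 hΩ hf hy
  have hν := legMap_eZ (f := f) y
  constructor
  · intro hw
    rw [abnLin_apply hΩ hf hpr hy hU] at hw
    have hut := fderiv_legMap_mem_tangent hn0 hΩ hf hy (w, legForm f y.1 w)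
    set u := fderiv ℝ (legMap f) y (w, legForm f y.1 w) with hu
    have hue : u = ((projL w, legForm f y.1 w), fderiv ℝ (mom f) y.1 w) :=
      fderiv_legMap hΩ hf hy _
    obtain ⟨a, ha, b, hb, hab⟩ := Submodule.mem_sup.1
      ((ker_iff_of_isAbnProjection hΩ hf hnd hpr hl hν hU hut).1 hw)
    obtain ⟨r, rfl⟩ := Submodule.mem_span_singleton.1 hb
    have h1 : u.2 eZ = 0 := by rw [hue]; exact fderiv_mom_eZ hΩ hf hy w
    have h2 := charDist_eZ hn0 hΩ hf hnd hl hν ha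
    rw [← hab, Prod.snd_add, Prod.smul_snd, add_apply, h2, zero_add, smul_apply, smul_eq_mul,
      mul_eq_zero] at h1
    have hr := h1.resolve_right hν
    rw [hr, zero_smul, add_zero] at hab
    rw [hab] at ha
    have hT := fderiv_legMap_flowVec_mem hn hΩ hf hnd hy
    have h3 := eq_zero_of_mem_charDist hn0 hΩ hf hnd hl hν
      (sub_mem ha (Submodule.smul_mem _ w.1 hT)) (by
        rw [hue, fderiv_legMap hΩ hf hy]
        change w.1 - w.1 * (flowVec f y.1).1 = 0
        rw [flowVec_x]; ring)
    rw [hue, fderiv_legMap hΩ hf hy] at h3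
    have h4 : projL (w - w.1 • flowVec f y.1) = 0 := by
      rw [map_sub, map_smul]
      exact congrArg (fun p => p.1.1) h3
    have h5 : fderiv ℝ (mom f) y.1 (w - w.1 • flowVec f y.1) = 0 := by
      rw [map_sub, map_smul]
      exact congrArg Prod.snd h3
    have h6 := eq_zero_of_fderiv_legMap hn hΩ hf hnd hy h4 (fun j => by
      have := fderiv_mom_eY hΩ hf hy (w - w.1 • flowVec f y.1) ⟨j, by omega⟩
      rw [h5] at this
      exact this.symm)
    exact ⟨w.1, _, by rw [← h6]; abel⟩
  · rintro ⟨c, s, rfl⟩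
    have h1 : abnLin f pr y (flowVec f y.1) = 0 := by
      have := fderiv_comp_legMap_flowVec hn hΩ hf hnd hpr hy hU
      rw [← legForm_flowVec (f := f) hn y.1] at this
      exact this
    have h2 : abnLin f pr y (topVec n) = 0 := by
      rw [abnLin_apply hΩ hf hpr hy hU]
      have : legForm f y.1 (topVec n) = 0 := by
        rw [legForm_apply, projL_topVec hn0]; exact map_zero _
      rw [this, fderiv_mom_topVec hn hΩ hf hy, map_zero]
    rw [map_add, map_smul, map_smul, h1, h2]; simp

/-- A dilation, invisible to `pr₂`, moves any vector of `Δ` into `{dν = 0}`, hence into the image of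
the differential of `legMap`. Lying in `ker 𝔰` then forces the `z`-component to be `legForm`. -/
theorem linearization_evenContact (hn : 2 ≤ n) (hΩ : IsOpen Ω) (hf : ContDiffOn ℝ ∞ f Ω)
    (hnd : ∀ j ∈ Ω, pderiv (pderiv f (Fin.last n)) (Fin.last n) j ≠ 0)
    {U : Set (Cotangent (JetZ n))} {pr : Cotangent (JetZ n) → Q}
    (hpr : IsAbnProjection (domZ Ω) (lagrDist f) U pr)
    {y : Jet (2 * n) × ℝ} (hy : y.1 ∈ jetDom Ω) (hU : legMap f y ∈ U) :
    linearization pr (evenContact (domZ Ω) (lagrDist f)) (legMap f y) =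
      LinearMap.range (abnLin f pr y).toLinearMap := by
  have hn0 : 0 < n := by omega
  have hl := legMap_mem hn0 hΩ hf hy
  have hν := legMap_eZ (f := f) y
  have hpe : (legMap f y).2 = mom f y.1 := rfl
  ext q
  constructor
  · rintro ⟨v, ⟨hv, hv0⟩, rfl⟩
    have hv0 : (legMap f y).2 v.1 = 0 := hv0
    -- Since `ν = -1` here, adding this multiple of the dilation vector cancels the `dν` component.
    set v' := v + (v.2 eZ) • ((0, (legMap f y).2) : Cotangent (JetZ n)) with hv'
    have ht : v' ∈ tangent (D2perp (domZ Ω) (lagrDist f)) (legMap f y) :=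
      add_mem hv (Submodule.smul_mem _ _ (euler_mem_tangent hn0 hΩ hf hl))
    have hfst : v'.1 = v.1 := by simp [hv']
    obtain ⟨w, hw⟩ := exists_fderiv_legMap_eq hn hΩ hf hnd hy ht (by
      simp [hv', hpe, mom_eZ])
    refine ⟨w, ?_⟩
    have h1 : legForm f y.1 w = v'.1.2 := by
      have h2 : v'.1 = (projL w, v'.1.2) := by
        conv_lhs => rw [hw, fderiv_legMap hΩ hf hy]
      have h3 : mom f y.1 v'.1 = 0 := by rw [hfst]; exact hv0
      rw [h2, mom_apply_pair] at h3
      linarith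
    change abnLin f pr y w = fderiv ℝ pr (legMap f y) v
    rw [abnLin_apply hΩ hf hpr hy hU, h1, ← hw, hv', map_add, map_smul,
      fderiv_euler hn0 hΩ hf hnd hpr hl hν hU, smul_zero, add_zero]
  · rintro ⟨w, rfl⟩
    refine ⟨fderiv ℝ (legMap f) y (w, legForm f y.1 w),
      ⟨fderiv_legMap_mem_tangent hn0 hΩ hf hy _, ?_⟩, ?_⟩
    · rw [SetLike.mem_coe, LinearMap.mem_ker, fderiv_legMap hΩ hf hy]
      change mom f y.1 (projL w, legForm f y.1 w) = 0
      rw [mom_apply_pair, sub_self]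
    · exact (abnLin_apply hΩ hf hpr hy hU w).symm

theorem projL_subTopVec (hn : 2 ≤ n) : projL (subTopVec n) = 0 := by
  rw [subTopVec, projL_dY, dif_neg (by simp; omega)]

/-- `pr₂` kills the characteristic and dilation parts of `J^(1-n)` and leaves `θ_0`, a nonzero
multiple of the image of `∂_{y_{2n-1}}`; the form `legForm` vanishes on that vector. -/
theorem jacobiCurve_legMap (hn : 2 ≤ n) (hΩ : IsOpen Ω) (hf : ContDiffOn ℝ ∞ f Ω)
    (hnd : ∀ j ∈ Ω, pderiv (pderiv f (Fin.last n)) (Fin.last n) j ≠ 0)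
    {U : Set (Cotangent (JetZ n))} {pr : Cotangent (JetZ n) → Q}
    (hpr : IsAbnProjection (domZ Ω) (lagrDist f) U pr)
    {y : Jet (2 * n) × ℝ} (hy : y.1 ∈ jetDom Ω) (hU : legMap f y ∈ U) :
    jacobiCurve (domZ Ω) (lagrDist f) pr (1 - (n : ℤ)) (legMap f y) =
      Submodule.span ℝ {abnLin f pr y (subTopVec n)} := by
  have hn0 : 0 < n := by omega
  have hl := legMap_mem hn0 hΩ hf hy
  have hν := legMap_eZ (f := f) y
  have hκ : (-1 : ℝ) ^ (n - 1) * hess f y.1 ≠ 0 :=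
    mul_ne_zero (pow_ne_zero _ (by norm_num)) (hnd _ hy)
  have hK : abnLin f pr y (subTopVec n) = ((-1) ^ (n - 1) * hess f y.1) •
      fderiv ℝ pr (legMap f y)
        ((0, theta ⟨0, by omega⟩ (legMap f y).1) : Cotangent (JetZ n)) := by
    have : legForm f y.1 (subTopVec n) = 0 := by
      rw [legForm_apply, projL_subTopVec hn]; exact map_zero _
    rw [abnLin_apply hΩ hf hpr hy hU, this, fderiv_legMap_subTopVec hn hΩ hf hy, map_smul]
  rw [hK, Submodule.span_singleton_smul_eq (IsUnit.mk0 _ hκ)]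
  ext q
  rw [Submodule.mem_span_singleton]
  constructor
  · rintro ⟨v, hv, rfl⟩
    obtain ⟨u, hu, a, b, rfl⟩ := (mem_jacobiFlag_iff hn hΩ hf hnd hl hν v).1 hv
    refine ⟨b, ?_⟩
    change _ = fderiv ℝ pr (legMap f y) _
    rw [map_add, map_add, map_smul, map_smul, fderiv_charDist hΩ hf hnd hpr hl hν hU hu,
      fderiv_euler hn0 hΩ hf hnd hpr hl hν hU, smul_zero, zero_add, zero_add]
  · rintro ⟨b, rfl⟩
    refine ⟨b • ((0, theta ⟨0, by omega⟩ (legMap f y).1) : Cotangent (JetZ n)),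
      (mem_jacobiFlag_iff hn hΩ hf hnd hl hν _).2 ⟨0, zero_mem _, 0, b, by simp⟩, ?_⟩
    change fderiv ℝ pr (legMap f y) _ = _
    rw [map_smul]

end Linearizations

/-! ### Absolutely continuous curves -/

theorem absolutelyContinuousOnInterval_comp {X Y : Type*} [PseudoMetricSpace X]
    [PseudoMetricSpace Y] {g : X → Y} {s : Set X} {K : NNReal} (hg : LipschitzOnWith K g s)
    {γ : ℝ → X} {a b : ℝ} (hγ : AbsolutelyContinuousOnInterval γ a b)
    (hs : MapsTo γ (uIcc a b) s) : AbsolutelyContinuousOnInterval (fun t => g (γ t)) a b := by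
  rw [AbsolutelyContinuousOnInterval] at hγ ⊢
  refine squeeze_zero' (Eventually.of_forall fun E => Finset.sum_nonneg fun _ _ => dist_nonneg)
    ?_ (by simpa using hγ.const_mul (K : ℝ))
  refine Filter.mem_inf_of_right (Filter.mem_principal.2 fun E hE => ?_)
  change ∑ i ∈ Finset.range E.1, dist (g (γ (E.2 i).1)) (g (γ (E.2 i).2)) ≤
    K * ∑ i ∈ Finset.range E.1, dist (γ (E.2 i).1) (γ (E.2 i).2)
  rw [Finset.mul_sum]
  exact Finset.sum_le_sum fun i hi =>
    hg.dist_le_mul _ (hs (hE.1 i hi).1) _ (hs (hE.1 i hi).2)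

/-- A function of an absolutely continuous curve that satisfies `dζ = F(ξ) dξ` along it is a
primitive of `F` at `ξ`. -/
theorem sub_primitive_eq_of_absolutelyContinuous {E : Type*} [NormedAddCommGroup E]
    [NormedSpace ℝ E] {J : Set ℝ} {Z F : ℝ → ℝ} (hF : ContinuousOn F J)
    (hZ : ∀ x ∈ J, HasDerivAt Z (F x) x) {γ : ℝ → E} {a b : ℝ}
    (hγ : AbsolutelyContinuousOnInterval γ a b) (ξ ζ : E →L[ℝ] ℝ)
    (hJ : ∀ t ∈ uIcc a b, ξ (γ t) ∈ J)
    (hd : ∀ᵐ t : ℝ, t ∈ uIcc a b →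
      ∃ v, HasDerivAt γ v t ∧ ζ v = F (ξ (γ t)) * ξ v) :
    ζ (γ b) - Z (ξ (γ b)) = ζ (γ a) - Z (ξ (γ a)) := by
  have hξ : AbsolutelyContinuousOnInterval (fun t => ξ (γ t)) a b :=
    absolutelyContinuousOnInterval_comp (ξ.lipschitz.lipschitzOnWith (s := univ)) hγ
      fun _ _ => mem_univ _
  have hζ : AbsolutelyContinuousOnInterval (fun t => ζ (γ t)) a b :=
    absolutelyContinuousOnInterval_comp (ζ.lipschitz.lipschitzOnWith (s := univ)) hγ
      fun _ _ => mem_univ _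
  have hsub : (fun t => ξ (γ t)) '' uIcc a b ⊆ J := by
    rintro _ ⟨t, ht, rfl⟩; exact hJ t ht
  have hcomp : IsCompact ((fun t => ξ (γ t)) '' uIcc a b) :=
    isCompact_uIcc.image_of_continuousOn hξ.continuousOn
  have hconv : Convex ℝ ((fun t => ξ (γ t)) '' uIcc a b) :=
    (isPreconnected_uIcc.image _ hξ.continuousOn).ordConnected.convex
  obtain ⟨C, hC⟩ := hcomp.exists_bound_of_continuousOn (hF.mono hsub)
  -- `F` is bounded on the compact interval swept out by `ξ ∘ γ`, so `Z` is Lipschitz there and `Z ∘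
  -- ξ ∘ γ` is absolutely continuous. The difference has zero derivative almost everywhere and is
  -- therefore constant.
  have hLip : LipschitzOnWith C.toNNReal Z ((fun t => ξ (γ t)) '' uIcc a b) :=
    hconv.lipschitzOnWith_of_nnnorm_hasDerivWithin_le
      (fun x hx => (hZ x (hsub hx)).hasDerivWithinAt)
      fun x hx => NNReal.le_toNNReal_of_coe_le (hC x hx)
  have hAC := hζ.sub (absolutelyContinuousOnInterval_comp hLip hξ fun t ht => mem_image_of_mem _ ht)
  obtain ⟨c, hc⟩ := hAC.const_of_ae_hasDerivAt_zero (hd.mono fun t ht hm => by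
    obtain ⟨v, hv, hvv⟩ := ht hm
    have h1 := ζ.hasFDerivAt.comp_hasDerivAt t hv
    have h2 := (hZ _ (hJ t hm)).comp t (ξ.hasFDerivAt.comp_hasDerivAt t hv)
    refine (h1.sub h2).congr_deriv ?_
    rw [hvv, sub_self])
  exact (hc b right_mem_uIcc).trans (hc a left_mem_uIcc).symm

/-- The primitive of a continuous function on an open interval. -/
theorem exists_primitive {J : Set ℝ} (hJo : IsOpen J) (hJ : J.OrdConnected) {F : ℝ → ℝ}
    (hF : ContinuousOn F J) {x₀ : ℝ} (hx₀ : x₀ ∈ J) (z₀ : ℝ) :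
    ∃ Z : ℝ → ℝ, Z x₀ = z₀ ∧ ∀ x ∈ J, HasDerivAt Z (F x) x := by
  refine ⟨fun x => z₀ + ∫ t in x₀..x, F t, by simp, fun x hx => ?_⟩
  have h := intervalIntegral.integral_hasDerivAt_right
    ((hF.mono (hJ.uIcc_subset hx₀ hx)).intervalIntegrable)
    (hF.stronglyMeasurableAtFilter hJo x hx) (hF.continuousAt (hJo.mem_nhds hx))
  exact h.const_add z₀

/-! ### Solutions as integral curves, and points of `𝓗` over a solution. -/

section Curves

variable {n : ℕ} {Ω : Set (Jet n)} {f : Jet n → ℝ}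

/-! ### Prolonged solutions -/

/-- The prolongation of a function with the top derivative replaced by zero. -/
def cutProlong (n : ℕ) (y : ℝ → ℝ) (x : ℝ) : Jet (2 * n) :=
  (x, fun i => if (i : ℕ) = 2 * n then 0 else iteratedDeriv (i : ℕ) y x)

theorem prolong_eq_cutProlong (n : ℕ) (y : ℝ → ℝ) (x : ℝ) :
    prolong (2 * n) y x = cutProlong n y x + iteratedDeriv (2 * n) y x • topVec n := by
  refine Prod.ext (by simp [prolong, cutProlong, topVec, dY]) (funext fun i => ?_)
  refine Fin.lastCases ?_ (fun i => ?_) i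
  · simp [prolong, cutProlong, topVec, dY]
  · have h1 : Fin.castSucc i ≠ Fin.last (2 * n) := (Fin.castSucc_lt_last i).ne
    have h2 : (i : ℕ) ≠ 2 * n := i.2.ne
    simp [prolong, cutProlong, topVec, dY, h1, h2]

theorem cutProlong_mem_jetDom (hn : 0 < n) {y : ℝ → ℝ} {x : ℝ}
    (h : prolong (2 * n) y x ∈ ELset Ω f) : cutProlong n y x ∈ jetDom Ω := by
  have h1 : projL (prolong (2 * n) y x) ∈ Ω := (mem_ELset_iff.1 h).1
  rwa [prolong_eq_cutProlong, projL_add_topVec hn] at h1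

theorem retr_cutProlong (hn : 0 < n) (hΩ : IsOpen Ω) (hf : ContDiffOn ℝ ∞ f Ω)
    (hnd : ∀ j ∈ Ω, pderiv (pderiv f (Fin.last n)) (Fin.last n) j ≠ 0) {y : ℝ → ℝ} {x : ℝ}
    (h : prolong (2 * n) y x ∈ ELset Ω f) :
    retr f (cutProlong n y x) = prolong (2 * n) y x := by
  have h1 := retr_of_mem h
  rw [prolong_eq_cutProlong, retr_add_topVec hn hΩ hf hnd (cutProlong_mem_jetDom hn h)] at h1
  rw [h1, prolong_eq_cutProlong]

/-- A solution is only assumed `C^{2n}`, so its top derivative need not be differentiable. With that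
coordinate set to zero the curve is an integral curve of `flowVec`, and `retr` recovers the true
prolongation. -/
theorem hasDerivAt_cutProlong {J : Set ℝ} (hJo : IsOpen J) {y : ℝ → ℝ}
    (hy : ContDiffOn ℝ (2 * n : ℕ) y J) {x : ℝ} (hx : x ∈ J) :
    HasDerivAt (cutProlong n y) (jetShift (prolong (2 * n) y x)) x := by
  refine (hasDerivAt_id x).prodMk (hasDerivAt_pi.2 fun i => ?_)
  by_cases hi : (i : ℕ) = 2 * n
  · simp only [hi, if_true]
    rw [dif_neg (by omega)]
    exact hasDerivAt_const _ _
  · simp only [hi, if_false]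
    rw [dif_pos (by omega)]
    have h1 : DifferentiableAt ℝ (iteratedDerivWithin i y J) x :=
      ((hy.differentiableOn_iteratedDerivWithin (m := i) (by exact_mod_cast (by omega))
        hJo.uniqueDiffOn) x hx).differentiableAt (hJo.mem_nhds hx)
    have h2 : iteratedDerivWithin i y J =ᶠ[𝓝 x] iteratedDeriv i y :=
      Filter.mem_of_superset (hJo.mem_nhds hx) (iteratedDerivWithin_of_isOpen hJo)
    have h3 := (h2.differentiableAt_iff.1 h1).hasDerivAt
    rwa [← iteratedDeriv_succ] at h3

/-! ### Points over the same solution -/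

/-- On `𝓗` the coefficients not recorded by `phiZ` are fixed: `ν = -1`, and the three frame
conditions give `ξ_n`, `ξ_{n-1}` and `λ_0`. Only the base coordinate `z` stays free. -/
theorem eq_legMap_of_phiZ_eq (hn : 2 ≤ n) (hΩ : IsOpen Ω) (hf : ContDiffOn ℝ ∞ f Ω)
    {l : Cotangent (JetZ n)} (hl : l ∈ Hset Ω f) {e : Jet (2 * n)} (he : e ∈ jetDom Ω)
    (h : phiZ l = legendre f (retr f e)) : l = legMap f (e, l.1.2) := by
  have hn0 : 0 < n := by omega
  have hq1 : l.1.1 = projL e := by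
    rw [← projL_retr (f := f) hn0 e]
    have h1 : l.1.1.1 = (projL (retr f e)).1 := congrArg (fun p : Reduced n => p.1) h
    have h2 : l.1.1.2 = (projL (retr f e)).2 := congrArg (fun p : Reduced n => p.2.1) h
    exact Prod.ext h1 h2
  have hq : l.1 = (projL e, l.1.2) := Prod.ext hq1 rfl
  have hl2 := hl.1
  rw [D2perp_eq hΩ hf] at hl2
  have hX1 : l.2 (X1 f l.1) = 0 := hl2.2 0
  have hX2 : l.2 (eY (Fin.last n)) = 0 := hl2.2 1
  have hX3 : l.2 (X3 f l.1) = 0 := hl2.2 2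
  have hz : l.2 eZ = -1 := hl.2
  refine Prod.ext hq (covector_ext_X1 (f := f) (q := (projL e, l.1.2)) ?_ (fun i => ?_) ?_)
  · exact (hq ▸ hX1).trans (mom_X1 e _).symm
  · refine Fin.lastCases ?_ (fun i => ?_) i
    · exact hX2.trans (mom_eY_last e).symm
    · refine Eq.trans ?_ (mom_eY_castSucc e i).symm
      by_cases hi : (i : ℕ) + 1 = n
      · have hX : X3 f l.1 = eY i.castSucc + pderiv f (Fin.last n) l.1.1 • eZ := by
          have : i = ⟨n - 1, by omega⟩ := Fin.ext (by simp; omega)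
          rw [X3_eq hn0, this]; simp [eY, eZ]
        rw [hX, map_add, map_smul, hz, hq1] at hX3
        rw [hi, elTail_last hΩ hf he]
        simp only [smul_eq_mul] at hX3
        linarith
      · have h3 : l.2 (eY i.castSucc) = elTail f (i + 1) (retr f e) :=
          congrFun (congrArg (fun p => p.2.2) h) ⟨i, by omega⟩
        rw [h3, retr_eq_add, elTail_succ_add_topVec hn0 hΩ hf i.2 he]
  · exact hz.trans (mom_eZ e).symm

/-- Abnormal extremals are tangent to `dz = f dx`. -/
theorem dz_eq_of_mem_kerSigma {l v : Cotangent (JetZ n)} (hl : l ∈ annih (domZ Ω) (lagrDist f))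
    (hv : v ∈ kerSigma (annih (domZ Ω) (lagrDist f)) l) : v.1.2 = f l.1.1 * v.1.1.1 := by
  -- `η` annihilates `D`, so it is a vertical tangent direction of `D^⊥`; orthogonality of `v` to it
  -- reads `η(π_* v) = 0`.
  set η : JetZ n →L[ℝ] ℝ := dzForm - f l.1.1 • dxForm with hη
  have hη0 : ∀ u ∈ lagrDist f l.1, η u = 0 := by
    intro u hu
    have : lagrDist f l.1 ≤ LinearMap.ker η.toLinearMap := by
      rw [lagrDist, Submodule.span_le]
      rintro _ (rfl | rfl)
      · simp [hη, X1, jetShift]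
      · simp [hη, X2]
    exact this hu
  have ht : ((0, η) : Cotangent (JetZ n)) ∈ tangent (annih (domZ Ω) (lagrDist f)) l := by
    have hd : HasDerivAt (fun t : ℝ => l + t • ((0, η) : Cotangent (JetZ n))) (0, η) 0 := by
      simpa using ((hasDerivAt_id (0 : ℝ)).smul_const
        ((0, η) : Cotangent (JetZ n))).const_add l
    refine Submodule.subset_span ⟨_, by simp, by fun_prop, Eventually.of_forall fun t => ?_,
      hd.deriv⟩
    have h1 : (l + t • ((0, η) : Cotangent (JetZ n))).1 = l.1 := by simp
    refine ⟨by rw [h1]; exact hl.1, fun u hu => ?_⟩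
    rw [h1] at hu
    simp [hl.2 u hu, hη0 u hu]
  have h := hv.2 _ ht
  simp only [sigma, map_zero, zero_sub, neg_eq_zero, hη] at h
  simp at h
  linarith

/-- `∂_{y_{2n-1}}` is outside the common kernel of the two linearizations, so both spans are lines.
-/
theorem subTopVec_ne (hn : 0 < n) (e : Jet (2 * n)) :
    ¬ ∃ c s : ℝ, subTopVec n = c • flowVec f e + s • topVec n := by
  rintro ⟨c, s, h⟩
  have hc : c = 0 := by
    have := congrArg Prod.fst h
    simpa [subTopVec, topVec, dY, flowVec_x] using this.symm
  have hne : (⟨2 * n - 1, by omega⟩ : Fin (2 * n + 1)) ≠ Fin.last (2 * n) := by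
    intro h; have := congrArg Fin.val h; simp at this; omega
  have := congrArg (fun w : Jet (2 * n) => w.2 ⟨2 * n - 1, by omega⟩) h
  simp [subTopVec, topVec, dY, hc, hne] at this

end Curves

/-! ### Matching the abnormal extremal with the solution, and the constant intertwining map. -/

section Correspondence

variable {n : ℕ} {Ω : Set (Jet n)} {f : Jet n → ℝ}

/-- The abnormal extremal over a solution is determined by the Legendre transform and by a
primitive of the Lagrangian along the solution. -/
theorem exists_action (hn : 2 ≤ n) (hΩ : IsOpen Ω) (hf : ContDiffOn ℝ ∞ f Ω)
    (hnd : ∀ j ∈ Ω, pderiv (pderiv f (Fin.last n)) (Fin.last n) j ≠ 0)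
    {J : Set ℝ} (hJo : IsOpen J) (hJ : J.OrdConnected) {y : ℝ → ℝ}
    (hy : ContDiffOn ℝ (2 * n : ℕ) y J) (hE : ∀ x ∈ J, prolong (2 * n) y x ∈ ELset Ω f)
    {Υ : Set (Cotangent (JetZ n))} (hΥ : IsAbnormalExtremal (domZ Ω) (lagrDist f) Υ)
    (hΥH : Υ ⊆ Hset Ω f) (hne : Υ.Nonempty)
    (hcov : ∀ l ∈ Υ, ∃ x ∈ J, phiZ l = legendre f (prolong (2 * n) y x)) :
    ∃ Z : ℝ → ℝ, (∀ x ∈ J, HasDerivAt Z (f (projL (cutProlong n y x))) x) ∧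
      ∀ l ∈ Υ, ∀ x ∈ J, phiZ l = legendre f (prolong (2 * n) y x) →
        l = legMap f (cutProlong n y x, Z x) := by
  have hn0 : 0 < n := by omega
  have hdom : ∀ x ∈ J, cutProlong n y x ∈ jetDom Ω := fun x hx =>
    cutProlong_mem_jetDom hn0 (hE x hx)
  have hleg : ∀ l ∈ Υ, ∀ x ∈ J, phiZ l = legendre f (prolong (2 * n) y x) →
      l = legMap f (cutProlong n y x, l.1.2) := fun l hl x hx h =>
    eq_legMap_of_phiZ_eq hn hΩ hf (hΥH hl) (hdom x hx)
      (by rw [retr_cutProlong hn0 hΩ hf hnd (hE x hx)]; exact h)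
  have hx1 : ∀ (l : Cotangent (JetZ n)) (x : ℝ), phiZ l = legendre f (prolong (2 * n) y x) →
      l.1.1.1 = x := fun l x h => congrArg (fun p : Reduced n => p.1) h
  obtain ⟨I, γ, hI, hAC, hmem, hd, rfl⟩ := hΥ
  obtain ⟨_, t₀, ht₀, rfl⟩ := hne
  have hJγ : ∀ t ∈ I, (γ t).1.1.1 ∈ J := fun t ht => by
    obtain ⟨x, hx, h⟩ := hcov _ (mem_image_of_mem γ ht)
    rwa [hx1 _ _ h]
  have hF : ContinuousOn (fun x => f (projL (cutProlong n y x))) J := fun x hx => by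
    have h1 : ContinuousAt (cutProlong n y) x := (hasDerivAt_cutProlong hJo hy hx).continuousAt
    have h2 : ContinuousAt f (projL (cutProlong n y x)) :=
      hf.continuousOn.continuousAt (hΩ.mem_nhds (hdom x hx))
    exact (ContinuousAt.comp (f := fun x => projL (cutProlong n y x)) h2
      (projL.continuous.continuousAt.comp h1)).continuousWithinAt
  obtain ⟨Z, hZ0, hZ⟩ := exists_primitive hJo hJ hF (hJγ t₀ ht₀) (γ t₀).1.2
  refine ⟨Z, hZ, ?_⟩
  rintro _ ⟨t, ht, rfl⟩ x hx h
  have hsub : uIcc t₀ t ⊆ I := hI.uIcc_subset ht₀ ht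
  -- Time along the extremal need not be `x`, so `z` is compared with the primitive `Z` evaluated at
  -- the `x`-coordinate of the curve.
  have key := sub_primitive_eq_of_absolutelyContinuous hF hZ (hAC t₀ ht₀ t ht)
    (dxForm.comp (ContinuousLinearMap.fst ℝ (JetZ n) (JetZ n →L[ℝ] ℝ)))
    (dzForm.comp (ContinuousLinearMap.fst ℝ (JetZ n) (JetZ n →L[ℝ] ℝ)))
    (fun s hs => hJγ s (hsub hs)) (hd.mono fun s hs hm => by
      obtain ⟨v, hv, hγv⟩ := hs (hsub hm)
      refine ⟨v, hγv, (dz_eq_of_mem_kerSigma (hmem s (hsub hm)).1 hv).trans ?_⟩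
      obtain ⟨x', hx', h'⟩ := hcov _ (mem_image_of_mem γ (hsub hm))
      have h1 := hleg _ (mem_image_of_mem γ (hsub hm)) x' hx' h'
      have h2 : (γ s).1.1 = projL (cutProlong n y x') := congrArg (fun l => l.1.1) h1
      change _ = f (projL (cutProlong n y (γ s).1.1.1)) * v.1.1.1
      rw [hx1 _ _ h', h2])
  have hz : (γ t).1.2 = Z x := by
    change (γ t).1.2 - Z (γ t).1.1.1 = (γ t₀).1.2 - Z (γ t₀).1.1.1 at key
    rw [hx1 _ _ h, hZ0] at key
    linarith
  rw [← hz]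
  exact hleg _ (mem_image_of_mem γ ht) x hx h

/-- The linear map between the tangent spaces of the spaces of solutions and of abnormal
extremals that intertwines the linearizations. -/
theorem exists_intertwining (hn : 2 ≤ n) (hΩ : IsOpen Ω) (hf : ContDiffOn ℝ ∞ f Ω)
    (hnd : ∀ j ∈ Ω, pderiv (pderiv f (Fin.last n)) (Fin.last n) j ≠ 0)
    {Q₁ Q₂ : Type*} [NormedAddCommGroup Q₁] [NormedSpace ℝ Q₁]
    [NormedAddCommGroup Q₂] [NormedSpace ℝ Q₂]
    {U₁ : Set (Jet (2 * n))} {pr₁ : Jet (2 * n) → Q₁}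
    (hpr₁ : IsLeafProjection (ELset Ω f) (solDist (ELset Ω f)) U₁ pr₁)
    {U₂ : Set (Cotangent (JetZ n))} {pr₂ : Cotangent (JetZ n) → Q₂}
    (hpr₂ : IsAbnProjection (domZ Ω) (lagrDist f) U₂ pr₂)
    {J : Set ℝ} (hJ : J.OrdConnected) (hne : J.Nonempty) {c : ℝ → Jet (2 * n)} {Z : ℝ → ℝ}
    (hdom : ∀ x ∈ J, c x ∈ jetDom Ω) (hc : ∀ x ∈ J, HasDerivAt c (flowVec f (c x)) x)
    (hZ : ∀ x ∈ J, HasDerivAt Z (f (projL (c x))) x)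
    (h₁ : ∀ x ∈ J, retr f (c x) ∈ U₁) (h₂ : ∀ x ∈ J, legMap f (c x, Z x) ∈ U₂) :
    ∃ A : Q₁ →ₗ[ℝ] Q₂, Function.Injective A ∧ ∀ x ∈ J, ∀ w,
      A (fderiv ℝ (fun e => pr₁ (retr f e)) (c x) w) = abnLin f pr₂ (c x, Z x) w := by
  have hn0 : 0 < n := by omega
  have hTd : ∀ x ∈ J, ContDiffAt ℝ ∞ (flowVec f) (c x) := fun x hx =>
    (contDiffOn_flowVec hΩ hf hnd).contDiffAt ((isOpen_jetDom hΩ).mem_nhds (hdom x hx))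
  have hB : ContinuousOn (fun x => fderiv ℝ (flowVec f) (c x)) J := fun x hx =>
    (ContinuousAt.comp (f := c) (((hTd x hx).fderiv_right (m := 0) (by simp)).continuousAt)
      (hc x hx).continuousAt).continuousWithinAt
  have hdomev : ∀ x ∈ J, ∀ᶠ e in 𝓝 (c x), e ∈ jetDom Ω := fun x hx =>
    (isOpen_jetDom hΩ).mem_nhds (hdom x hx)
  have hL : ∀ x ∈ J, HasDerivAt (fun x => fderiv ℝ (fun e => pr₁ (retr f e)) (c x))
      (-(fderiv ℝ (fun e => pr₁ (retr f e)) (c x)).comp (fderiv ℝ (flowVec f) (c x))) x := by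
    intro x hx
    have hr := contDiffAt_retr hΩ hf hnd (hdom x hx)
    have hp : ContDiffAt ℝ ∞ (fun e => pr₁ (retr f e)) (c x) :=
      ContDiffAt.comp (c x) (hpr₁.smooth.contDiffAt (hpr₁.isOpen.mem_nhds (h₁ x hx))) hr
    refine hasDerivAt_fderiv_of_first_integral (by exact_mod_cast contDiffAt_infty.1 hp 2)
      ((hTd x hx).differentiableAt (by simp)) ?_ (hc x hx)
    filter_upwards [hdomev x hx, hr.continuousAt.eventually (hpr₁.isOpen.mem_nhds (h₁ x hx))]
      with e he hU
    exact fderiv_comp_retr_flowVec hn0 hΩ hf hnd hpr₁ he hU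
  have hK : ∀ x ∈ J, HasDerivAt (fun x => abnLin f pr₂ (c x, Z x))
      (-(abnLin f pr₂ (c x, Z x)).comp (fderiv ℝ (flowVec f) (c x))) x := by
    intro x hx
    have hl : ContDiffAt ℝ ∞ (legMap f) (c x, Z x) := contDiffAt_legMap hΩ hf (hdom x hx)
    have hp : ContDiffAt ℝ ∞ (fun y => pr₂ (legMap f y)) (c x, Z x) :=
      ContDiffAt.comp _
        (hpr₂.leaf.smooth.contDiffAt (hpr₂.leaf.isOpen.mem_nhds (h₂ x hx))) hl
    refine hasDerivAt_fderiv_comp_graph (f := fun e => f (projL e)) (β := legForm f)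
      (by exact_mod_cast contDiffAt_infty.1 hp 2) ((hTd x hx).differentiableAt (by simp))
      ((hasTop_comp_projL hΩ hf).differentiableAt (isOpen_jetDom hΩ) (hdom x hx))
      (fderiv_legForm hn hΩ hf hnd (hdom x hx) 0).1 ?_ (hc x hx) (hZ x hx)
      fun w => (fderiv_legForm hn hΩ hf hnd (hdom x hx) w).2
    filter_upwards [continuousAt_fst.eventually (hdomev x hx),
      hl.continuousAt.eventually (hpr₂.leaf.isOpen.mem_nhds (h₂ x hx))] with e he hU
    exact fderiv_comp_legMap_flowVec hn hΩ hf hnd hpr₂ he hU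
  obtain ⟨x₀, hx₀⟩ := hne
  have hk₁ := fderiv_comp_retr_eq_zero_iff hn0 hΩ hf hnd hpr₁ (hdom x₀ hx₀) (h₁ x₀ hx₀)
  have hk₂ := abnLin_eq_zero_iff hn hΩ hf hnd hpr₂ (y := (c x₀, Z x₀)) (hdom x₀ hx₀) (h₂ x₀ hx₀)
  have hs := fderiv_comp_retr_surjective hn0 hΩ hf hnd hpr₁ (hdom x₀ hx₀) (h₁ x₀ hx₀)
  -- Of the equality of kernels at the single point `x₀`, one inclusion produces `A` and the other
  -- makes it injective.
  obtain ⟨A, hA⟩ := exists_factorization hJ hB hL hK hx₀ hs fun w hw =>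
    (hk₂ w).2 ((hk₁ w).1 hw)
  refine ⟨A.toLinearMap, (injective_iff_map_eq_zero _).2 fun q hq => ?_, hA⟩
  obtain ⟨w, rfl⟩ := hs q
  exact (hk₁ w).2 ((hk₂ w).1 ((hA x₀ hx₀ w).symm.trans hq))

end Correspondence

end VarLin

end

/-! ### The projective equivalence of the two curves. -/

theorem mainTheorem7 (n : ℕ) (hn : 2 ≤ n)
    (Ω : Set (VarLin.Jet n)) (hΩ : IsOpen Ω)
    (f : VarLin.Jet n → ℝ) (hf : ContDiffOn ℝ ∞ f Ω)
    (hnd : ∀ j ∈ Ω, VarLin.pderiv (VarLin.pderiv f (Fin.last n)) (Fin.last n) j ≠ 0)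
    -- the solution, the abnormal extremal, and their correspondence
    (Γ : Set (VarLin.Jet (2 * n))) (hΓ : VarLin.IsSolution (VarLin.ELset Ω f) Γ)
    (Υ : Set (VarLin.Cotangent (VarLin.JetZ n)))
    (hΥ : VarLin.IsAbnormalExtremal (VarLin.domZ Ω) (VarLin.lagrDist f) Υ)
    (hΥH : Υ ⊆ VarLin.Hset Ω f)
    (hcorr : VarLin.phiZ '' Υ = VarLin.legendre f '' Γ)
    -- the projection onto the space `Sol` of solutions, near `Γ`, with `T_Γ Sol = Q₁`
    {Q₁ : Type*} [NormedAddCommGroup Q₁] [NormedSpace ℝ Q₁]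
    (U₁ : Set (VarLin.Jet (2 * n))) (pr₁ : VarLin.Jet (2 * n) → Q₁)
    (hpr₁ : VarLin.IsLeafProjection (VarLin.ELset Ω f)
      (VarLin.solDist (VarLin.ELset Ω f)) U₁ pr₁)
    (hΓU : Γ ⊆ U₁)
    -- the projection onto the space `Abn` of abnormal extremals, near `Υ`, with `T_Υ Abn = Q₂`
    {Q₂ : Type*} [NormedAddCommGroup Q₂] [NormedSpace ℝ Q₂]
    (U₂ : Set (VarLin.Cotangent (VarLin.JetZ n))) (pr₂ : VarLin.Cotangent (VarLin.JetZ n) → Q₂)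
    (hpr₂ : VarLin.IsAbnProjection (VarLin.domZ Ω) (VarLin.lagrDist f) U₂ pr₂)
    (hΥU : Υ ⊆ U₂) :
    -- both are curves of lines
    (∀ e ∈ Γ, Module.finrank ℝ
      (VarLin.linearization pr₁ (VarLin.vertDist (VarLin.ELset Ω f) 1) e) = 1) ∧
    (∀ l ∈ Υ, Module.finrank ℝ
      (VarLin.jacobiCurve (VarLin.domZ Ω) (VarLin.lagrDist f) pr₂ (1 - (n : ℤ)) l) = 1) ∧
    -- a projective transformation `ℙ(T_Γ Sol) → ℙ(\bar Δ(Υ))` maps one onto the other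
    ∃ A : Q₁ ≃ₗ[ℝ] VarLin.barDelta (VarLin.domZ Ω) (VarLin.lagrDist f) pr₂ Υ,
      (∀ e ∈ Γ, ∀ l ∈ Υ, VarLin.phiZ l = VarLin.legendre f e →
        ((VarLin.linearization pr₁ (VarLin.vertDist (VarLin.ELset Ω f) 1) e).map
          A.toLinearMap).map (Submodule.subtype _) =
        VarLin.jacobiCurve (VarLin.domZ Ω) (VarLin.lagrDist f) pr₂ (1 - (n : ℤ)) l) ∧
      (fun L : Submodule ℝ Q₁ => (L.map A.toLinearMap).map (Submodule.subtype _)) ''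
        ((VarLin.linearization pr₁ (VarLin.vertDist (VarLin.ELset Ω f) 1)) '' Γ) =
        (VarLin.jacobiCurve (VarLin.domZ Ω) (VarLin.lagrDist f) pr₂ (1 - (n : ℤ))) '' Υ := by
  have hn0 : 0 < n := by omega
  obtain ⟨J, y, hJo, hJ, hne, hy, hE, rfl⟩ := hΓ
  have hdom : ∀ x ∈ J, VarLin.cutProlong n y x ∈ VarLin.jetDom Ω := fun x hx =>
    VarLin.cutProlong_mem_jetDom hn0 (hE x hx)
  have hretr : ∀ x ∈ J, VarLin.retr f (VarLin.cutProlong n y x) = VarLin.prolong (2 * n) y x :=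
    fun x hx => VarLin.retr_cutProlong hn0 hΩ hf hnd (hE x hx)
  have hcov : ∀ l ∈ Υ, ∃ x ∈ J,
      VarLin.phiZ l = VarLin.legendre f (VarLin.prolong (2 * n) y x) := by
    intro l hl
    obtain ⟨_, ⟨x, hx, rfl⟩, h⟩ := hcorr ▸ mem_image_of_mem VarLin.phiZ hl
    exact ⟨x, hx, h.symm⟩
  have hcov' : ∀ x ∈ J, ∃ l ∈ Υ,
      VarLin.phiZ l = VarLin.legendre f (VarLin.prolong (2 * n) y x) := by
    intro x hx
    obtain ⟨l, hl, h⟩ := hcorr.symm ▸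
      mem_image_of_mem (VarLin.legendre f) (mem_image_of_mem (VarLin.prolong (2 * n) y) hx)
    exact ⟨l, hl, h⟩
  obtain ⟨x₀, hx₀⟩ := hne
  obtain ⟨l₀, hl₀, -⟩ := hcov' x₀ hx₀
  obtain ⟨Z, hZ, hΥZ⟩ := VarLin.exists_action hn hΩ hf hnd hJo hJ hy hE hΥ hΥH ⟨l₀, hl₀⟩ hcov
  have h₁ : ∀ x ∈ J, VarLin.retr f (VarLin.cutProlong n y x) ∈ U₁ := fun x hx => by
    rw [hretr x hx]; exact hΓU (mem_image_of_mem _ hx)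
  have h₂ : ∀ x ∈ J, VarLin.legMap f (VarLin.cutProlong n y x, Z x) ∈ U₂ := fun x hx => by
    obtain ⟨l, hl, h⟩ := hcov' x hx
    rw [← hΥZ l hl x hx h]; exact hΥU hl
  have hc : ∀ x ∈ J, HasDerivAt (VarLin.cutProlong n y)
      (VarLin.flowVec f (VarLin.cutProlong n y x)) x := fun x hx => by
    rw [VarLin.flowVec, hretr x hx]; exact VarLin.hasDerivAt_cutProlong hJo hy hx
  obtain ⟨A, hinj, hA⟩ := VarLin.exists_intertwining hn hΩ hf hnd hpr₁ hpr₂ hJ ⟨x₀, hx₀⟩ hdom hc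
    hZ h₁ h₂
  have hLin : ∀ x ∈ J, VarLin.linearization pr₁ (VarLin.vertDist (VarLin.ELset Ω f) 1)
      (VarLin.prolong (2 * n) y x) = Submodule.span ℝ {fderiv ℝ (fun e => pr₁ (VarLin.retr f e))
        (VarLin.cutProlong n y x) (VarLin.subTopVec n)} := fun x hx => by
    rw [← hretr x hx]
    exact VarLin.linearization_vertDist hn0 hΩ hf hnd hpr₁ (hdom x hx) (h₁ x hx)
  have hJac : ∀ x ∈ J, VarLin.jacobiCurve (VarLin.domZ Ω) (VarLin.lagrDist f) pr₂ (1 - (n : ℤ))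
      (VarLin.legMap f (VarLin.cutProlong n y x, Z x)) = Submodule.span ℝ
        {VarLin.abnLin f pr₂ (VarLin.cutProlong n y x, Z x) (VarLin.subTopVec n)} := fun x hx =>
    VarLin.jacobiCurve_legMap hn hΩ hf hnd hpr₂ (hdom x hx) (h₂ x hx)
  -- Since `L` is onto at every point, the range of `K` is that of `A` throughout. In particular all
  -- projections of `Δ` along `Υ` coincide, and their supremum `barDelta` is the range of `A`.
  have hrange : ∀ x ∈ J, LinearMap.range
      (VarLin.abnLin f pr₂ (VarLin.cutProlong n y x, Z x)).toLinearMap = LinearMap.range A := by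
    intro x hx
    have hs := VarLin.fderiv_comp_retr_surjective hn0 hΩ hf hnd hpr₁ (hdom x hx) (h₁ x hx)
    ext q
    constructor
    · rintro ⟨w, rfl⟩
      exact ⟨_, hA x hx w⟩
    · rintro ⟨q, rfl⟩
      obtain ⟨w, rfl⟩ := hs q
      exact ⟨w, (hA x hx w).symm⟩
  have hbar : LinearMap.range A =
      VarLin.barDelta (VarLin.domZ Ω) (VarLin.lagrDist f) pr₂ Υ := by
    have h : ∀ l ∈ Υ, VarLin.linearization pr₂
        (VarLin.evenContact (VarLin.domZ Ω) (VarLin.lagrDist f)) l = LinearMap.range A := by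
      intro l hl
      obtain ⟨x, hx, hlx⟩ := hcov l hl
      rw [hΥZ l hl x hx hlx, VarLin.linearization_evenContact hn hΩ hf hnd hpr₂ (hdom x hx)
        (h₂ x hx), hrange x hx]
    refine le_antisymm ?_ (iSup₂_le fun l hl => (h l hl).le)
    rw [← h l₀ hl₀]
    exact le_iSup₂ (f := fun l (_ : l ∈ Υ) => VarLin.linearization pr₂
      (VarLin.evenContact (VarLin.domZ Ω) (VarLin.lagrDist f)) l) l₀ hl₀
  let A' := (LinearEquiv.ofInjective A hinj).trans (LinearEquiv.ofEq _ _ hbar)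
  have hA' : (Submodule.subtype _).comp A'.toLinearMap = A := LinearMap.ext fun q => rfl
  have hmap : ∀ x ∈ J, ((VarLin.linearization pr₁ (VarLin.vertDist (VarLin.ELset Ω f) 1)
      (VarLin.prolong (2 * n) y x)).map A'.toLinearMap).map (Submodule.subtype _) =
      VarLin.jacobiCurve (VarLin.domZ Ω) (VarLin.lagrDist f) pr₂ (1 - (n : ℤ))
        (VarLin.legMap f (VarLin.cutProlong n y x, Z x)) := by
    intro x hx
    rw [← Submodule.map_comp, hA', hLin x hx, hJac x hx, Submodule.map_span, image_singleton,
      hA x hx]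
  refine ⟨?_, fun l hl => ?_, A', ?_, ?_⟩
  · rintro _ ⟨x, hx, rfl⟩
    rw [hLin x hx]
    refine finrank_span_singleton fun h => VarLin.subTopVec_ne hn0 _
      ((VarLin.fderiv_comp_retr_eq_zero_iff hn0 hΩ hf hnd hpr₁ (hdom x hx) (h₁ x hx) _).1 h)
  · obtain ⟨x, hx, hlx⟩ := hcov l hl
    rw [hΥZ l hl x hx hlx, hJac x hx]
    refine finrank_span_singleton fun h => VarLin.subTopVec_ne hn0 _
      ((VarLin.abnLin_eq_zero_iff hn hΩ hf hnd hpr₂ (hdom x hx) (h₂ x hx) _).1 h)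
  · rintro _ ⟨x, hx, rfl⟩ l hl hlx
    rw [hmap x hx, ← hΥZ l hl x hx hlx]
  · ext L
    constructor
    · rintro ⟨_, ⟨_, ⟨x, hx, rfl⟩, rfl⟩, rfl⟩
      obtain ⟨l, hl, hlx⟩ := hcov' x hx
      refine ⟨l, hl, ?_⟩
      rw [hΥZ l hl x hx hlx]
      exact (hmap x hx).symm
    · rintro ⟨l, hl, rfl⟩
      obtain ⟨x, hx, hlx⟩ := hcov l hl
      refine ⟨_, ⟨_, mem_image_of_mem _ hx, rfl⟩, ?_⟩
      rw [hΥZ l hl x hx hlx]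
      exact hmap x hx
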